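/- Conventions. $\lambda\in\mathbb N$ is the security parameter; $f:\mathbb N\to\mathbb R$ is negligible if for every constant $c$, $f(\lambda)<\lambda^{-c}$ for all sufficiently large $\lambda$. QPT algorithms are non-uniform: families $(C_\lambda)_\lambda$ of quantum circuits of size polynomial in $\lambda$, possibly with polynomial-size quantum advice; interactive QPT algorithms keep a quantum register between their stages. All algorithms of the schemes below are QPT (PPT is a special case); keys, ciphertexts, certificates and messages are bit strings of lengths polynomial in $\lambda$, except where said to be quantum. Building blocks. (1) An NCE scheme $(\mathsf{KeyGen},\mathsf{Enc},\mathsf{Dec},\mathsf{Fake},\mathsf{Reveal})$. It is *RNC secure* if every QPT adversary has a negligible difference of the probabilities of outputting $1$ for $b=0$ and $b=1$ in this game: $(pk,sk,\mathsf{aux})\leftarrow\mathsf{KeyGen}(1^\lambda)$; the adversary gets $pk$ and chooses a plaintext $m$; it gets $(\mathsf{Enc}(pk,m),sk)$ if $b=0$, and $(\widetilde{ct},\mathsf{Reveal}(pk,sk,\mathsf{aux},\widetilde{ct},m))$ with $\widetilde{ct}\leftarrow\mathsf{Fake}(pk,sk,\mathsf{aux})$ if $b=1$; it outputs a bit. (2)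 A one-shot signature scheme $(\mathsf{Setup},\mathsf{KeyGen},\mathsf{Sign},\mathsf{Vrfy})$ for messages in $\{0,1\}$, with classical $\mathsf{crs}$, public keys and signatures, quantum signing keys, and deterministic $\mathsf{Vrfy}(\mathsf{crs},pk,\sigma,m)\in\{\top,\bot\}$. It is *secure* if for every QPT $\mathcal A$, with $\mathsf{crs}\leftarrow\mathsf{Setup}(1^\lambda)$ and $(pk,m_0,\sigma_0,m_1,\sigma_1)\leftarrow\mathcal A(\mathsf{crs})$, the probability that $m_0\ne m_1$ and $\mathsf{Vrfy}(\mathsf{crs},pk,\sigma_i,m_i)=\top$ for $i=0,1$ is negligible. (3) A witness encryption scheme $(\mathsf{Enc},\mathsf{Dec})$ for the language of statements $x=(\mathsf{crs},pk)$ with witnesses $\sigma$ such that $\mathsf{OSS.Vrfy}(\mathsf{crs},pk,\sigma,0)=\top$. It has *extractable security* if for every QPT $\mathcal A$, every positive polynomial $p$ and all messages $m_0=m_0(\lambda)$, $m_1=m_1(\lambda)$ there are a QPT extractor $\mathcal E$ and a positive polynomial $q$ such that for all sufficiently large $\lambda$, all statements $x$ and all mixed states $\mathsf{aux}$ (possibly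 entangled with an external register): if $$|\Pr[\mathcal A(\mathsf{aux},\mathsf{Enc}(1^\lambda,x,m_0))=1]-\Pr[\mathcal A(\mathsf{aux},\mathsf{Enc}(1^\lambda,x,m_1))=1]|\ge 1/p(\lambda),$$ then $\mathcal E(1^\lambda,x,\mathsf{aux})$ outputs a witness for $x$ with probability at least $1/q(\lambda)$. Construction $\Sigma_{\mathsf{pvcccd}}$ (plaintexts: the messages of $\mathsf{WE}$; plaintexts of $\mathsf{NCE}$: the ciphertexts of $\mathsf{WE}$). - $\mathsf{KeyGen}(1^\lambda)$: $(pk,sk,\mathsf{aux})\leftarrow\mathsf{NCE.KeyGen}(1^\lambda)$; output $(pk,sk)$. - $\mathsf{Enc}\langle\mathcal S(pk,m),\mathcal R\rangle$: the sender sends $\mathsf{crs}\leftarrow\mathsf{OSS.Setup}(1^\lambda)$; the receiver computes $(\mathsf{oss}.pk,\mathsf{oss}.sk)\leftarrow\mathsf{OSS.KeyGen}(\mathsf{crs})$ and sends $\mathsf{oss}.pk$; the sender computes $\mathsf{we}.ct\leftarrow\mathsf{WE.Enc}(1^\lambda,x,m)$ for the statement $x=(\mathsf{crs},\mathsf{oss}.pk)$,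 that is, "there is $\sigma$ with $\mathsf{OSS.Vrfy}(\mathsf{crs},\mathsf{oss}.pk,\sigma,0)=\top$", and sends $\mathsf{nce}.ct\leftarrow\mathsf{NCE.Enc}(pk,\mathsf{we}.ct)$. The sender outputs $vk=(\mathsf{crs},\mathsf{oss}.pk)$, the receiver outputs $ct=(\mathsf{nce}.ct,\mathsf{oss}.sk)$. - $\mathsf{Dec}(sk,ct)$: $\sigma\leftarrow\mathsf{OSS.Sign}(\mathsf{oss}.sk,0)$, $m'\leftarrow\mathsf{NCE.Dec}(sk,\mathsf{nce}.ct)$; output $\mathsf{WE.Dec}(m',\sigma)$ ($\bot$ if $m'=\bot$). - $\mathsf{Del}(ct)$: output $\sigma\leftarrow\mathsf{OSS.Sign}(\mathsf{oss}.sk,1)$. - $\mathsf{Vrfy}(vk,\sigma)$: output $\mathsf{OSS.Vrfy}(\mathsf{crs},\mathsf{oss}.pk,\sigma,1)$. *IND-CPA-CD security with public verification* means that every QPT adversary $\mathcal A$ has a negligible difference of the probabilities of outputting $1$ for $b=0$ and $b=1$ in this game: $(pk,sk)\leftarrow\mathsf{KeyGen}(1^\lambda)$; $\mathcal A$ gets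 $pk$ and chooses plaintexts $m_0,m_1$; the challenger as sender with input $(pk,m_b)$ runs the encryption protocol with $\mathcal A$ as receiver, obtains $vk$ and gives it to $\mathcal A$; $\mathcal A$ sends a certificate; it gets $sk$ if $\mathsf{Vrfy}$ accepts the certificate under $vk$, and $\bot$ otherwise; it outputs a bit. Theorem. If $\Sigma_{\mathsf{nce}}$ is RNC secure, $\Sigma_{\mathsf{we}}$ has extractable security and $\Sigma_{\mathsf{oss}}$ is secure, then $\Sigma_{\mathsf{pvcccd}}$ is IND-CPA-CD secure with public verification. -/

import Mathlib

namespace CertDel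

open Matrix
open scoped ComplexOrder Kronecker

/-! ## Asymptotics -/

/-- `f` is negligible: eventually smaller than every inverse power of the security parameter. -/
def Negligible (f : ℕ → ℝ) : Prop :=
  ∀ c : ℕ, ∃ n₀ : ℕ, ∀ n > n₀, f n < 1 / (n : ℝ) ^ c

/-- `f` is bounded by a polynomial in the security parameter. -/
def PolyBounded (f : ℕ → ℕ) : Prop :=
  ∃ p : Polynomial ℕ, ∀ n, f n ≤ p.eval n

/-! ## Quantum states and circuits -/

/-- Classical bit strings of length `ℓ`. -/
abbrev BitStr (ℓ : ℕ) : Type := Fin ℓ → Bool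

/-- Operators on the Hilbert space of the qubits (wires) `W`, written in the computational basis
`W → Bool`. -/
abbrev Op (W : Type) : Type := Matrix (W → Bool) (W → Bool) ℂ

/-- Mixed states (density operators) of the qubits `W`. -/
structure State (W : Type) [Fintype W] [DecidableEq W] where
  op : Op W
  psd : op.PosSemidef
  trace_eq_one : op.trace = 1

/-- The computational basis state `|x⟩⟨x|`. -/
noncomputable def State.ket {W : Type} [Fintype W] [DecidableEq W] (x : W → Bool) : State W where
  op := diagonal fun s => if s = x then 1 else 0
  psd := PosSemidef.diagonal fun s => by
    by_cases h : s = x <;> simp [h]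
  trace_eq_one := by simp [trace_diagonal]

/-- Normalisation of a nonzero positive semidefinite operator (a fixed basis state otherwise). -/
noncomputable def State.normalize {W : Type} [Fintype W] [DecidableEq W] (M : Op W) : State W :=
  open Classical in
  if h : M.PosSemidef ∧ M.trace ≠ 0 then
    { op := (M.trace)⁻¹ • M
      psd := h.1.smul (inv_nonneg.mpr h.1.trace_nonneg)
      trace_eq_one := by rw [trace_smul, smul_eq_mul, inv_mul_cancel₀ h.2] }
  else State.ket fun _ => false

/-- Elementary instructions on the wires `W`: the gates Hadamard, `T`, `X`, CNOT, Toffoli (this set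
is universal), and the measurement of one wire in the computational basis. -/
inductive Gate (W : Type) : Type where
  | hadamard (i : W)
  | phaseT (i : W)
  | not (i : W)
  | cnot (c t : W) (h : c ≠ t)
  | toffoli (c d t : W) (hcd : c ≠ d) (hct : c ≠ t) (hdt : d ≠ t)
  | measure (i : W)

section Semantics

variable {W : Type} [Fintype W] [DecidableEq W]

/-- The Hadamard gate on wire `i`, tensored with the identity on the other wires. -/
noncomputable def hadamardMatrix (i : W) : Op W :=
  Matrix.of fun s t =>
    if ∀ j, j ≠ i → s j = t j then (if s i && t i then -1 else 1) * ((√2 : ℝ) : ℂ)⁻¹ else 0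

/-- The gate `T = diag(1, e^{iπ/4})` on wire `i`. -/
noncomputable def phaseTMatrix (i : W) : Op W :=
  diagonal fun s => if s i then Complex.exp (Complex.I * (Real.pi / 4)) else 1

/-- The action on basis strings that flips the bit on wire `t` if `P` holds. -/
def flipIf (t : W) (P : (W → Bool) → Bool) (s : W → Bool) : W → Bool :=
  Function.update s t (xor (s t) (P s))

/-- The action of an instruction on operators.  A reversible classical gate is the permutation
`|s⟩ ↦ |f s⟩` of the basis for an involution `f`, hence sends `ρ` to the matrix with entries
`ρ (f s) (f t)`; a measurement of wire `i`, whose outcome stays on the wire, deletes all entries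
`ρ s t` with `s i ≠ t i`. -/
noncomputable def Gate.apply : Gate W → Op W → Op W
  | .hadamard i, ρ => hadamardMatrix i * ρ * (hadamardMatrix i)ᴴ
  | .phaseT i, ρ => phaseTMatrix i * ρ * (phaseTMatrix i)ᴴ
  | .not i, ρ => ρ.submatrix (flipIf i fun _ => true) (flipIf i fun _ => true)
  | .cnot c t _, ρ => ρ.submatrix (flipIf t fun s => s c) (flipIf t fun s => s c)
  | .toffoli c d t _ _ _, ρ =>
      ρ.submatrix (flipIf t fun s => s c && s d) (flipIf t fun s => s c && s d)
  | .measure i, ρ => Matrix.of fun s t => if s i = t i then ρ s t else 0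

/-- Run a circuit (a list of instructions, executed from left to right). -/
noncomputable def runCircuit (C : List (Gate W)) (ρ : Op W) : Op W :=
  C.foldl (fun σ g => g.apply σ) ρ

theorem flipIf_involutive (t : W) (P : (W → Bool) → Bool)
    (hP : ∀ s v, P (Function.update s t v) = P s) : Function.Involutive (flipIf t P) := by
  intro s
  simp [flipIf, hP]

theorem trace_submatrix_involutive (ρ : Op W) (f : (W → Bool) → (W → Bool))
    (hf : Function.Involutive f) : (ρ.submatrix f f).trace = ρ.trace := by
  simp only [Matrix.trace, Matrix.diag, submatrix_apply]
  exact Equiv.sum_comp hf.toPerm fun s => ρ s s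

theorem hadamard_agree (i : W) (u s : W → Bool) :
    (∀ j, j ≠ i → u j = s j) ↔ u = Function.update s i false ∨ u = Function.update s i true := by
  constructor
  · intro h
    cases hb : u i
    · left; ext j; by_cases hj : j = i
      · subst hj; simp [hb]
      · simp [hj, h j hj]
    · right; ext j; by_cases hj : j = i
      · subst hj; simp [hb]
      · simp [hj, h j hj]
  · rintro (h | h) j hj <;> simp [h, hj]

theorem hadamard_sum (i : W) (s : W → Bool) (g : (W → Bool) → ℂ) :
    (∑ u, if ∀ j, j ≠ i → u j = s j then g u else 0)
      = g (Function.update s i false) + g (Function.update s i true) := by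
  have hne : Function.update s i false ≠ Function.update s i true := fun h => by
    have := congrFun h i
    simp at this
  rw [← Finset.sum_filter,
    show (Finset.univ.filter fun u : W → Bool => ∀ j, j ≠ i → u j = s j)
      = {Function.update s i false, Function.update s i true} by
        ext u; simp only [Finset.mem_filter, Finset.mem_univ, true_and, hadamard_agree,
          Finset.mem_insert, Finset.mem_singleton], Finset.sum_pair hne]

theorem hadamard_unitary (i : W) : (hadamardMatrix i)ᴴ * hadamardMatrix i = 1 := by
  have h2 : (((√2 : ℝ) : ℂ)⁻¹) * (((√2 : ℝ) : ℂ)⁻¹) = 1 / 2 := by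
    rw [← mul_inv, ← Complex.ofReal_mul, Real.mul_self_sqrt (by norm_num)]
    norm_num
  ext s t
  have key : ((hadamardMatrix i)ᴴ * hadamardMatrix i) s t
      = ∑ u, if ∀ j, j ≠ i → u j = s j then
          ((if u i && s i then -1 else 1) * ((√2 : ℝ) : ℂ)⁻¹) * hadamardMatrix i u t else 0 := by
    rw [Matrix.mul_apply]
    refine Finset.sum_congr rfl fun u _ => ?_
    by_cases h : ∀ j, j ≠ i → u j = s j
    · simp only [conjTranspose_apply, hadamardMatrix, of_apply, if_pos h]
      congr 1
      split_ifs <;> simp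
    · simp only [conjTranspose_apply, hadamardMatrix, of_apply, if_neg h, star_zero, zero_mul]
  rw [key, hadamard_sum]
  by_cases hst : ∀ j, j ≠ i → s j = t j
  · have h' : ∀ b, ∀ j, j ≠ i → Function.update s i b j = t j := fun b j hj => by
      simp [hj, hst j hj]
    simp only [hadamardMatrix, of_apply, if_pos (h' _)]
    by_cases hi : s i = t i
    · have hs : s = t := by
        ext j; by_cases hj : j = i
        · rw [hj, hi]
        · rw [hst j hj]
      subst hs
      cases s i <;> simp [h2] <;> norm_num
    · have hs : s ≠ t := fun h => hi (by rw [h])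
      rw [one_apply_ne hs]
      revert hi
      cases s i <;> cases t i <;> simp
  · have hs : s ≠ t := fun h => hst fun j _ => by rw [h]
    have h' : ∀ b, ¬ ∀ j, j ≠ i → Function.update s i b j = t j := fun b h => hst fun j hj => by
      have := h j hj
      simpa [hj] using this
    simp only [hadamardMatrix, of_apply, if_neg (h' _), mul_zero, add_zero]
    rw [one_apply_ne hs]

theorem phaseT_unitary (i : W) : (phaseTMatrix i)ᴴ * phaseTMatrix i = 1 := by
  rw [phaseTMatrix, diagonal_conjTranspose, diagonal_mul_diagonal, ← diagonal_one]
  congr 1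
  ext s
  by_cases h : s i
  · simp only [Pi.star_apply, h, if_true]
    rw [Complex.star_def, ← Complex.exp_conj, ← Complex.exp_add]
    simp
    convert Complex.exp_zero using 2
    ring_nf
    simp [Complex.ext_iff]
  · simp [h]

theorem trace_conj_unitary (U ρ : Op W) (h : Uᴴ * U = 1) : (U * ρ * Uᴴ).trace = ρ.trace := by
  rw [Matrix.trace_mul_comm, ← Matrix.mul_assoc, h, Matrix.one_mul]

theorem Gate.trace_apply (g : Gate W) (ρ : Op W) : (g.apply ρ).trace = ρ.trace := by
  cases g with
  | hadamard i => exact trace_conj_unitary _ _ (hadamard_unitary i)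
  | phaseT i => exact trace_conj_unitary _ _ (phaseT_unitary i)
  | not i => exact trace_submatrix_involutive _ _ (flipIf_involutive _ _ (by simp))
  | cnot c t h =>
      exact trace_submatrix_involutive _ _ (flipIf_involutive _ _ (by intros; simp [h]))
  | toffoli c d t hcd hct hdt =>
      exact trace_submatrix_involutive _ _ (flipIf_involutive _ _ (by intros; simp [hct, hdt]))
  | measure i => simp [Gate.apply, Matrix.trace]

theorem Gate.posSemidef_apply (g : Gate W) {ρ : Op W} (hρ : ρ.PosSemidef) :
    (g.apply ρ).PosSemidef := by
  cases g with
  | hadamard i => exact hρ.mul_mul_conjTranspose_same _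
  | phaseT i => exact hρ.mul_mul_conjTranspose_same _
  | not i => exact hρ.submatrix _
  | cnot c t h => exact hρ.submatrix _
  | toffoli c d t hcd hct hdt => exact hρ.submatrix _
  | measure i =>
      have key : (Gate.measure i).apply ρ = ∑ b : Bool,
          (diagonal fun s : W → Bool => if s i = b then (1 : ℂ) else 0) * ρ *
            (diagonal fun s : W → Bool => if s i = b then (1 : ℂ) else 0)ᴴ := by
        ext s t
        simp only [Gate.apply, of_apply, diagonal_conjTranspose, Matrix.sum_apply, mul_diagonal,
          diagonal_mul, Fintype.sum_bool, Pi.star_apply]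
        cases s i <;> cases t i <;> simp
      rw [key]
      exact posSemidef_sum _ fun b _ => hρ.mul_mul_conjTranspose_same _

theorem runCircuit_trace (C : List (Gate W)) (ρ : Op W) : (runCircuit C ρ).trace = ρ.trace := by
  induction C generalizing ρ with
  | nil => rfl
  | cons g C ih => exact (ih _).trans (g.trace_apply ρ)

theorem runCircuit_posSemidef (C : List (Gate W)) {ρ : Op W} (hρ : ρ.PosSemidef) :
    (runCircuit C ρ).PosSemidef := by
  induction C generalizing ρ with
  | nil => exact hρ
  | cons g C ih => exact ih (g.posSemidef_apply hρ)

end Semantics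

/-! ## Quantum algorithms -/

/-- A quantum circuit with classical input wires `Ic`, quantum input wires `Iq`, classical output
wires `Oc`, quantum output wires `Oq`, and `work` further wires.  The output wires start in
`|0…0⟩` and the work wires in the state `advice`, which may contain zeros as well as arbitrary
quantum advice. -/
structure QAlg (Ic Iq Oc Oq : Type) where
  work : ℕ
  advice : State (Fin work)
  circuit : List (Gate ((Ic ⊕ Iq) ⊕ (Oc ⊕ Oq) ⊕ Fin work))

namespace QAlg

variable {Ic Iq Oc Oq : Type}
  [Fintype Ic] [DecidableEq Ic] [Fintype Iq] [DecidableEq Iq]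
  [Fintype Oc] [DecidableEq Oc] [Fintype Oq] [DecidableEq Oq]

/-- The size of a circuit: number of wires plus number of instructions. -/
def size (F : QAlg Ic Iq Oc Oq) : ℕ :=
  Fintype.card Ic + Fintype.card Iq + Fintype.card Oc + Fintype.card Oq + F.work + F.circuit.length

/-- The assignment of bits to all wires given by its five parts. -/
def wires {w : ℕ} (x : Ic → Bool) (k : Iq → Bool) (y : Oc → Bool) (u : Oq → Bool)
    (a : Fin w → Bool) : (Ic ⊕ Iq) ⊕ (Oc ⊕ Oq) ⊕ Fin w → Bool :=
  Sum.elim (Sum.elim x k) (Sum.elim (Sum.elim y u) a)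

/-- The initial operator `|x⟩⟨x| ⊗ ρ ⊗ |0…0⟩⟨0…0| ⊗ advice`. -/
noncomputable def initial (F : QAlg Ic Iq Oc Oq) (x : Ic → Bool) (ρ : Op Iq) :
    Op ((Ic ⊕ Iq) ⊕ (Oc ⊕ Oq) ⊕ Fin F.work) :=
  Matrix.of fun s t =>
    if ((∀ i, s (.inl (.inl i)) = x i) ∧ ∀ o, s (.inr (.inl o)) = false) ∧
        (∀ i, t (.inl (.inl i)) = x i) ∧ ∀ o, t (.inr (.inl o)) = false then
      ρ (fun i => s (.inl (.inr i))) (fun i => t (.inl (.inr i))) *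
        F.advice.op (fun i => s (.inr (.inr i))) (fun i => t (.inr (.inr i)))
    else 0

/-- The unnormalised state of the quantum output wires when the classical output wires are measured
with outcome `y` and all input and work wires are discarded.  Its trace is the probability of
`y`. -/
noncomputable def instrument (F : QAlg Ic Iq Oc Oq) (x : Ic → Bool) (ρ : Op Iq) (y : Oc → Bool) :
    Op Oq :=
  ∑ i : Ic → Bool, ∑ k : Iq → Bool, ∑ a : Fin F.work → Bool,
    (runCircuit F.circuit (F.initial x ρ)).submatrix
      (fun u => wires i k y u a) (fun u => wires i k y u a)

/-- Sums over all wire assignments split into sums over the five parts. -/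
theorem sum_wires {M : Type} [AddCommMonoid M] {w : ℕ}
    (f : ((Ic ⊕ Iq) ⊕ (Oc ⊕ Oq) ⊕ Fin w → Bool) → M) :
    ∑ s, f s = ∑ x : Ic → Bool, ∑ k : Iq → Bool, ∑ y : Oc → Bool, ∑ u : Oq → Bool,
      ∑ a : Fin w → Bool, f (wires x k y u a) := by
  let e : ((Ic ⊕ Iq) ⊕ (Oc ⊕ Oq) ⊕ Fin w → Bool) ≃
      (Ic → Bool) × (Iq → Bool) × (Oc → Bool) × (Oq → Bool) × (Fin w → Bool) :=
    { toFun := fun s => (fun i => s (.inl (.inl i)), fun i => s (.inl (.inr i)),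
        fun i => s (.inr (.inl (.inl i))), fun i => s (.inr (.inl (.inr i))),
        fun i => s (.inr (.inr i)))
      invFun := fun p => wires p.1 p.2.1 p.2.2.1 p.2.2.2.1 p.2.2.2.2
      left_inv := fun s => by
        ext i
        rcases i with (i | i) | (i | i) | i <;> rfl
      right_inv := fun p => rfl }
  rw [← Equiv.sum_comp e.symm f]
  simp only [Fintype.sum_prod_type]
  rfl

theorem initial_posSemidef (F : QAlg Ic Iq Oc Oq) (x : Ic → Bool) {ρ : Op Iq}
    (hρ : ρ.PosSemidef) : (F.initial x ρ).PosSemidef := by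
  set D : Op ((Ic ⊕ Iq) ⊕ (Oc ⊕ Oq) ⊕ Fin F.work) := diagonal fun s =>
    if (∀ i, s (.inl (.inl i)) = x i) ∧ ∀ o, s (.inr (.inl o)) = false then (1 : ℂ) else 0 with hD
  set e : ((Ic ⊕ Iq) ⊕ (Oc ⊕ Oq) ⊕ Fin F.work → Bool) → (Iq → Bool) × (Fin F.work → Bool) :=
    fun s => (fun i => s (.inl (.inr i)), fun i => s (.inr (.inr i))) with he
  have key : F.initial x ρ = D * ((ρ ⊗ₖ F.advice.op).submatrix e e) * Dᴴ := by
    ext s t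
    simp only [hD, diagonal_conjTranspose, mul_diagonal, diagonal_mul, submatrix_apply,
      kroneckerMap_apply, he, initial, of_apply, Pi.star_apply]
    split_ifs <;> simp_all
  rw [key]
  exact ((hρ.kronecker F.advice.psd).submatrix e).mul_mul_conjTranspose_same D

theorem initial_trace (F : QAlg Ic Iq Oc Oq) (x : Ic → Bool) (ρ : Op Iq) :
    (F.initial x ρ).trace = ρ.trace := by
  have h1 : (F.initial x ρ).trace = ∑ k : Iq → Bool, ∑ a : Fin F.work → Bool,
      ρ k k * F.advice.op a a := by
    rw [Matrix.trace, sum_wires]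
    rw [Finset.sum_eq_single x]
    · refine Finset.sum_congr rfl fun k _ => ?_
      rw [Finset.sum_eq_single fun _ => false]
      · rw [Finset.sum_eq_single fun _ => false]
        · refine Finset.sum_congr rfl fun a _ => ?_
          simp [initial, wires]
        · intro u _ hu
          refine Finset.sum_eq_zero fun a _ => ?_
          have : ¬ ∀ o, u o = false := fun h => hu (funext h)
          simp only [diag_apply, initial, wires, of_apply]
          rw [if_neg]
          rintro ⟨⟨-, h⟩, -⟩
          exact this fun o => h (.inr o)
        · simp
      · intro y _ hy
        refine Finset.sum_eq_zero fun u _ => Finset.sum_eq_zero fun a _ => ?_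
        simp only [diag_apply, initial, wires, of_apply]
        rw [if_neg]
        rintro ⟨⟨-, h⟩, -⟩
        exact hy (funext fun o => h (.inl o))
      · simp
    · intro i _ hi
      refine Finset.sum_eq_zero fun k _ => Finset.sum_eq_zero fun y _ =>
        Finset.sum_eq_zero fun u _ => Finset.sum_eq_zero fun a _ => ?_
      simp only [diag_apply, initial, wires, of_apply]
      rw [if_neg]
      rintro ⟨⟨h, -⟩, -⟩
      exact hi (funext h)
    · simp
  have h2 : ∑ a, F.advice.op a a = 1 := F.advice.trace_eq_one
  rw [h1]
  simp only [← Finset.mul_sum, h2, mul_one]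
  rfl

theorem instrument_posSemidef (F : QAlg Ic Iq Oc Oq) (x : Ic → Bool) {ρ : Op Iq}
    (hρ : ρ.PosSemidef) (y : Oc → Bool) : (F.instrument x ρ y).PosSemidef :=
  posSemidef_sum _ fun _ _ => posSemidef_sum _ fun _ _ => posSemidef_sum _ fun _ _ =>
    (runCircuit_posSemidef _ (F.initial_posSemidef x hρ)).submatrix _

theorem sum_instrument_trace (F : QAlg Ic Iq Oc Oq) (x : Ic → Bool) (ρ : Op Iq) :
    ∑ y, (F.instrument x ρ y).trace = ρ.trace := by
  rw [← F.initial_trace x ρ, ← runCircuit_trace F.circuit, Matrix.trace, sum_wires]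
  simp only [instrument, Matrix.trace_sum]
  rw [Finset.sum_comm]
  refine Finset.sum_congr rfl fun i _ => ?_
  rw [Finset.sum_comm]
  refine Finset.sum_congr rfl fun k _ => Finset.sum_congr rfl fun y _ => ?_
  rw [Finset.sum_comm]
  rfl

/-- The distribution of the classical output. -/
noncomputable def outcome (F : QAlg Ic Iq Oc Oq) (x : Ic → Bool) (ρ : State Iq) :
    PMF (Oc → Bool) :=
  PMF.ofFintype (fun y => ENNReal.ofReal (F.instrument x ρ.op y).trace.re) (by
    have h0 : ∀ y, 0 ≤ (F.instrument x ρ.op y).trace.re := fun y =>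
      (Complex.nonneg_iff.mp (F.instrument_posSemidef x ρ.psd y).trace_nonneg).1
    rw [← ENNReal.ofReal_sum_of_nonneg fun y _ => h0 y, ← Complex.re_sum, sum_instrument_trace,
      ρ.trace_eq_one]
    simp)

/-- Running the algorithm: the classical output `y` together with the state of the quantum output
wires conditioned on `y`. -/
noncomputable def run (F : QAlg Ic Iq Oc Oq) (x : Ic → Bool) (ρ : State Iq) :
    PMF ((Oc → Bool) × State Oq) :=
  (F.outcome x ρ).map fun y => (y, State.normalize (F.instrument x ρ.op y))

end QAlg

/-- The empty family of wires. -/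
abbrev NoWires : ℕ → Type := fun _ => Empty

/-- A (non-uniform) quantum polynomial time algorithm: for every security parameter a quantum
circuit with quantum advice, of size polynomial in the security parameter.  Classical probabilistic
polynomial time algorithms are special cases. -/
structure QPT (Ic Iq Oc Oq : ℕ → Type)
    [∀ n, Fintype (Ic n)] [∀ n, Fintype (Iq n)] [∀ n, Fintype (Oc n)] [∀ n, Fintype (Oq n)] where
  alg : ∀ n, QAlg (Ic n) (Iq n) (Oc n) (Oq n)
  poly : PolyBounded fun n => (alg n).size

namespace QPT

variable {Ic Iq Oc Oq : ℕ → Type}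
  [∀ n, Fintype (Ic n)] [∀ n, DecidableEq (Ic n)] [∀ n, Fintype (Iq n)] [∀ n, DecidableEq (Iq n)]
  [∀ n, Fintype (Oc n)] [∀ n, DecidableEq (Oc n)] [∀ n, Fintype (Oq n)] [∀ n, DecidableEq (Oq n)]

/-- Classical and quantum input, classical and quantum output. -/
noncomputable def run (F : QPT Ic Iq Oc Oq) (n : ℕ) (x : Ic n → Bool) (ρ : State (Iq n)) :
    PMF ((Oc n → Bool) × State (Oq n)) :=
  (F.alg n).run x ρ

/-- Classical input only, classical and quantum output. -/
noncomputable def prepare (F : QPT Ic NoWires Oc Oq) (n : ℕ) (x : Ic n → Bool) :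
    PMF ((Oc n → Bool) × State (Oq n)) :=
  (F.alg n).run x (State.ket fun _ => false)

/-- Classical and quantum input, classical output only. -/
noncomputable def measure (F : QPT Ic Iq Oc NoWires) (n : ℕ) (x : Ic n → Bool)
    (ρ : State (Iq n)) : PMF (Oc n → Bool) :=
  (F.alg n).outcome x ρ

/-- Classical input and output. -/
noncomputable def sample (F : QPT Ic NoWires Oc NoWires) (n : ℕ) (x : Ic n → Bool) :
    PMF (Oc n → Bool) :=
  (F.alg n).outcome x (State.ket fun _ => false)

end QPT

/-- The probability that an experiment outputs `1`. -/
noncomputable def prob (p : PMF Bool) : ℝ := (p true).toReal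

/-- Encoding of "`⊥` or a string" on wires: a flag and the string (all zeros for `⊥`). -/
def encodeOption {ℓ : ℕ} : Option (BitStr ℓ) → (Unit ⊕ Fin ℓ → Bool)
  | none => fun _ => false
  | some m => Sum.elim (fun _ => true) m

/-- Decoding of "`⊥` or a string". -/
def decodeOption {ℓ : ℕ} (y : Unit ⊕ Fin ℓ → Bool) : Option (BitStr ℓ) :=
  if y (.inl ()) then some fun i => y (.inr i) else none

/-! ## Receiver non-committing encryption -/

/-- A public key receiver non-committing encryption scheme with plaintext space
`{0,1}^(msgLen n)`. -/
structure NCE (msgLen : ℕ → ℕ) where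
  pkLen : ℕ → ℕ
  skLen : ℕ → ℕ
  auxLen : ℕ → ℕ
  ctLen : ℕ → ℕ
  keyGenAlg : QPT NoWires NoWires (fun n => Fin (pkLen n) ⊕ Fin (skLen n) ⊕ Fin (auxLen n)) NoWires
  encAlg : QPT (fun n => Fin (pkLen n) ⊕ Fin (msgLen n)) NoWires (fun n => Fin (ctLen n)) NoWires
  decAlg : QPT (fun n => Fin (skLen n) ⊕ Fin (ctLen n)) NoWires
    (fun n => Unit ⊕ Fin (msgLen n)) NoWires
  fakeAlg : QPT (fun n => Fin (pkLen n) ⊕ Fin (skLen n) ⊕ Fin (auxLen n)) NoWires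
    (fun n => Fin (ctLen n)) NoWires
  revealAlg : QPT
    (fun n => Fin (pkLen n) ⊕ Fin (skLen n) ⊕ Fin (auxLen n) ⊕ Fin (ctLen n) ⊕ Fin (msgLen n))
    NoWires (fun n => Fin (skLen n)) NoWires

namespace NCE

variable {msgLen : ℕ → ℕ} (S : NCE msgLen) (n : ℕ)

noncomputable def keyGen : PMF (BitStr (S.pkLen n) × BitStr (S.skLen n) × BitStr (S.auxLen n)) :=
  (S.keyGenAlg.sample n fun i => i.elim).map fun y =>
    (fun i => y (.inl i), fun i => y (.inr (.inl i)), fun i => y (.inr (.inr i)))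

noncomputable def enc (pk : BitStr (S.pkLen n)) (m : BitStr (msgLen n)) :
    PMF (BitStr (S.ctLen n)) :=
  S.encAlg.sample n (Sum.elim pk m)

noncomputable def dec (sk : BitStr (S.skLen n)) (ct : BitStr (S.ctLen n)) :
    PMF (Option (BitStr (msgLen n))) :=
  (S.decAlg.sample n (Sum.elim sk ct)).map decodeOption

noncomputable def fake (pk : BitStr (S.pkLen n)) (sk : BitStr (S.skLen n))
    (aux : BitStr (S.auxLen n)) : PMF (BitStr (S.ctLen n)) :=
  S.fakeAlg.sample n (Sum.elim pk (Sum.elim sk aux))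

noncomputable def reveal (pk : BitStr (S.pkLen n)) (sk : BitStr (S.skLen n))
    (aux : BitStr (S.auxLen n)) (ct : BitStr (S.ctLen n)) (m : BitStr (msgLen n)) :
    PMF (BitStr (S.skLen n)) :=
  S.revealAlg.sample n (Sum.elim pk (Sum.elim sk (Sum.elim aux (Sum.elim ct m))))

/-- A QPT adversary against RNC security.  It keeps a quantum register of `reg n` qubits between its
two stages. -/
structure Adversary where
  reg : ℕ → ℕ
  choose : QPT (fun n => Fin (S.pkLen n)) NoWires (fun n => Fin (msgLen n)) (fun n => Fin (reg n))
  guess : QPT (fun n => Fin (S.ctLen n) ⊕ Fin (S.skLen n)) (fun n => Fin (reg n))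
    (fun _ => Unit) NoWires

/-- The RNC experiment with challenge bit `b`. -/
noncomputable def rncExp (A : S.Adversary) (b : Bool) : PMF Bool := do
  let (pk, sk, aux) ← S.keyGen n
  let (m, st) ← A.choose.prepare n pk
  let (ct, sk') ←
    (if b then do
      let ct ← S.fake n pk sk aux
      let sk' ← S.reveal n pk sk aux ct m
      return (ct, sk')
    else do
      let ct ← S.enc n pk m
      return (ct, sk) : PMF (BitStr (S.ctLen n) × BitStr (S.skLen n)))
  let b' ← A.guess.measure n (Sum.elim ct sk') st
  return b' ()

/-- Receiver non-committing security. -/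
def RNCSecure : Prop :=
  ∀ A : S.Adversary,
    Negligible fun n => |prob (S.rncExp n A false) - prob (S.rncExp n A true)|

end NCE

/-! ## One-shot signatures -/

/-- A one-shot signature scheme for one-bit messages.  The secret key is a state of `skLen n`
qubits.  Verification is a QPT algorithm `vrfyAlg` whose verdict is determined by its input;
`vrfy` is the function that it computes. -/
structure OneShotSig where
  crsLen : ℕ → ℕ
  pkLen : ℕ → ℕ
  skLen : ℕ → ℕ
  sigLen : ℕ → ℕ
  setupAlg : QPT NoWires NoWires (fun n => Fin (crsLen n)) NoWires
  keyGenAlg : QPT (fun n => Fin (crsLen n)) NoWires (fun n => Fin (pkLen n))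
    (fun n => Fin (skLen n))
  signAlg : QPT (fun _ => Unit) (fun n => Fin (skLen n)) (fun n => Fin (sigLen n)) NoWires
  vrfyAlg : QPT (fun n => Fin (crsLen n) ⊕ Fin (pkLen n) ⊕ Fin (sigLen n) ⊕ Unit) NoWires
    (fun _ => Unit) NoWires
  vrfy : ∀ n, BitStr (crsLen n) → BitStr (pkLen n) → BitStr (sigLen n) → Bool → Bool
  vrfyAlg_eq : ∀ n crs pk σ m,
    vrfyAlg.sample n (Sum.elim crs (Sum.elim pk (Sum.elim σ fun _ => m))) =
      PMF.pure fun _ => vrfy n crs pk σ m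

namespace OneShotSig

variable (S : OneShotSig) (n : ℕ)

noncomputable def setup : PMF (BitStr (S.crsLen n)) :=
  S.setupAlg.sample n fun i => i.elim

noncomputable def keyGen (crs : BitStr (S.crsLen n)) :
    PMF (BitStr (S.pkLen n) × State (Fin (S.skLen n))) :=
  S.keyGenAlg.prepare n crs

noncomputable def sign (sk : State (Fin (S.skLen n))) (m : Bool) : PMF (BitStr (S.sigLen n)) :=
  S.signAlg.measure n (fun _ => m) sk

/-- A QPT adversary: on input `crs` it outputs `(pk, m₀, σ₀, m₁, σ₁)`. -/
abbrev Adversary : Type :=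
  QPT (fun n => Fin (S.crsLen n)) NoWires
    (fun n => Fin (S.pkLen n) ⊕ (Unit ⊕ Fin (S.sigLen n)) ⊕ (Unit ⊕ Fin (S.sigLen n))) NoWires

/-- The one-shot security experiment: the output is `1` if the adversary produces valid signatures
on two different messages under the same public key. -/
noncomputable def forgeExp (A : S.Adversary) : PMF Bool := do
  let crs ← S.setup n
  let y ← A.sample n crs
  let pk : BitStr (S.pkLen n) := fun i => y (.inl i)
  let m₀ : Bool := y (.inr (.inl (.inl ())))
  let σ₀ : BitStr (S.sigLen n) := fun i => y (.inr (.inl (.inr i)))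
  let m₁ : Bool := y (.inr (.inr (.inl ())))
  let σ₁ : BitStr (S.sigLen n) := fun i => y (.inr (.inr (.inr i)))
  return (m₀ != m₁) && S.vrfy n crs pk σ₀ m₀ && S.vrfy n crs pk σ₁ m₁

/-- Security of a one-shot signature scheme. -/
def Secure : Prop :=
  ∀ A : S.Adversary, Negligible fun n => prob (S.forgeExp n A)

/-- The length of the statements `x = (crs, pk)`. -/
abbrev stmtLen : ℕ → ℕ := fun n => S.crsLen n + S.pkLen n

/-- The witness relation of the statements `x = (crs, pk)`, read as "there is `σ` such that
`vrfy crs pk σ 0` accepts". -/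
def SignatureOnZero (n : ℕ) (x : BitStr (S.stmtLen n)) (σ : BitStr (S.sigLen n)) : Prop :=
  S.vrfy n (fun i => x (Fin.castAdd _ i)) (fun i => x (Fin.natAdd _ i)) σ false = true

end OneShotSig

/-! ## Witness encryption -/

/-- A witness encryption scheme for statements of length `stmtLen n`, witnesses of length
`witLen n`, and messages in `{0,1}^(msgLen n)`. -/
structure WitnessEnc (stmtLen witLen : ℕ → ℕ) where
  msgLen : ℕ → ℕ
  ctLen : ℕ → ℕ
  encAlg : QPT (fun n => Fin (stmtLen n) ⊕ Fin (msgLen n)) NoWires (fun n => Fin (ctLen n)) NoWires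
  decAlg : QPT (fun n => Fin (ctLen n) ⊕ Fin (witLen n)) NoWires
    (fun n => Unit ⊕ Fin (msgLen n)) NoWires

namespace WitnessEnc

variable {stmtLen witLen : ℕ → ℕ} (S : WitnessEnc stmtLen witLen) (n : ℕ)

noncomputable def enc (x : BitStr (stmtLen n)) (m : BitStr (S.msgLen n)) :
    PMF (BitStr (S.ctLen n)) :=
  S.encAlg.sample n (Sum.elim x m)

noncomputable def dec (ct : BitStr (S.ctLen n)) (w : BitStr (witLen n)) :
    PMF (Option (BitStr (S.msgLen n))) :=
  (S.decAlg.sample n (Sum.elim ct w)).map decodeOption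

/-- A QPT distinguisher: it gets a ciphertext and an auxiliary register of `reg n` qubits. -/
structure Distinguisher where
  reg : ℕ → ℕ
  guess : QPT (fun n => Fin (S.ctLen n)) (fun n => Fin (reg n)) (fun _ => Unit) NoWires

/-- The experiment `A(aux, Enc(1ⁿ, x, m))`. -/
noncomputable def distExp (A : S.Distinguisher) (x : BitStr (stmtLen n)) (m : BitStr (S.msgLen n))
    (aux : State (Fin (A.reg n))) : PMF Bool := do
  let ct ← S.enc n x m
  let b' ← A.guess.measure n ct aux
  return b' ()

/-- Extractable security with respect to the witness relation `R`: for every QPT distinguisher,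
polynomial `p` and messages there are a QPT extractor and a polynomial `q` such that, for all
sufficiently large security parameters, all statements `x` and all mixed states `aux`, distinguishing
advantage at least `1 / p` yields a witness with probability at least `1 / q`.  (Only the reduced
state on the register of the distinguisher matters for these probabilities, so that `aux` may as well
be entangled with an external register.) -/
def ExtractableSecure (R : ∀ n, BitStr (stmtLen n) → BitStr (witLen n) → Prop) : Prop :=
  ∀ (A : S.Distinguisher) (p : Polynomial ℕ), (∀ n, 0 < p.eval n) →
    ∀ m₀ m₁ : ∀ n, BitStr (S.msgLen n),
      ∃ (E : QPT (fun n => Fin (stmtLen n)) (fun n => Fin (A.reg n)) (fun n => Fin (witLen n))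
          NoWires) (q : Polynomial ℕ), (∀ n, 0 < q.eval n) ∧
        ∃ n₀ : ℕ, ∀ n > n₀, ∀ (x : BitStr (stmtLen n)) (aux : State (Fin (A.reg n))),
          1 / ((p.eval n : ℕ) : ℝ) ≤
              |prob (S.distExp n A x (m₀ n) aux) - prob (S.distExp n A x (m₁ n) aux)| →
            1 / ((q.eval n : ℕ) : ℝ) ≤ ((E.measure n x aux).toOuterMeasure {w | R n x w}).toReal

end WitnessEnc

/-! ## Public key encryption with certified deletion and classical communication -/

/-- A public key encryption scheme with certified deletion and classical communication, with
plaintext space `{0,1}^(msgLen n)`, whose encryption is a protocol of three classical messages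
(sender, receiver, sender) between a classical sender `S` with input `(pk, m)` and a quantum receiver
`R` without input.  At the end the sender outputs `vk`, and the receiver outputs a ciphertext that
consists of a classical string and a register of `ctQubits n` qubits. -/
structure PKECD where
  pkLen : ℕ → ℕ
  skLen : ℕ → ℕ
  msgLen : ℕ → ℕ
  com₁Len : ℕ → ℕ
  com₂Len : ℕ → ℕ
  com₃Len : ℕ → ℕ
  vkLen : ℕ → ℕ
  certLen : ℕ → ℕ
  ctLen : ℕ → ℕ
  ctQubits : ℕ → ℕ
  recQubits : ℕ → ℕ
  SenderState : ℕ → Type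
  keyGen : ∀ n, PMF (BitStr (pkLen n) × BitStr (skLen n))
  send₁ : ∀ n, BitStr (pkLen n) → BitStr (msgLen n) → PMF (BitStr (com₁Len n) × SenderState n)
  receive₁ : ∀ n, BitStr (com₁Len n) → PMF (BitStr (com₂Len n) × State (Fin (recQubits n)))
  send₂ : ∀ n, SenderState n → BitStr (com₂Len n) → PMF (BitStr (com₃Len n) × BitStr (vkLen n))
  receive₂ : ∀ n, State (Fin (recQubits n)) → BitStr (com₃Len n) →
    PMF (BitStr (ctLen n) × State (Fin (ctQubits n)))
  dec : ∀ n, BitStr (skLen n) → BitStr (ctLen n) × State (Fin (ctQubits n)) →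
    PMF (Option (BitStr (msgLen n)))
  del : ∀ n, BitStr (ctLen n) × State (Fin (ctQubits n)) → PMF (BitStr (certLen n))
  vrfy : ∀ n, BitStr (vkLen n) → BitStr (certLen n) → PMF Bool

namespace PKECD

variable (S : PKECD) (n : ℕ)

/-- The honest execution `Enc⟨S(pk, m), R⟩ → (vk, CT)`. -/
noncomputable def enc (pk : BitStr (S.pkLen n)) (m : BitStr (S.msgLen n)) :
    PMF (BitStr (S.vkLen n) × BitStr (S.ctLen n) × State (Fin (S.ctQubits n))) := do
  let (c₁, sst) ← S.send₁ n pk m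
  let (c₂, rst) ← S.receive₁ n c₁
  let (c₃, vk) ← S.send₂ n sst c₂
  let ct ← S.receive₂ n rst c₃
  return (vk, ct)

/-- A QPT adversary in the certified deletion experiment with public verification.  Between its
stages it keeps a quantum register. -/
structure Adversary where
  reg₁ : ℕ → ℕ
  reg₂ : ℕ → ℕ
  reg₃ : ℕ → ℕ
  choose : QPT (fun n => Fin (S.pkLen n)) NoWires (fun n => Fin (S.msgLen n) ⊕ Fin (S.msgLen n))
    (fun n => Fin (reg₁ n))
  reply : QPT (fun n => Fin (S.com₁Len n)) (fun n => Fin (reg₁ n)) (fun n => Fin (S.com₂Len n))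
    (fun n => Fin (reg₂ n))
  delete : QPT (fun n => Fin (S.com₃Len n) ⊕ Fin (S.vkLen n)) (fun n => Fin (reg₂ n))
    (fun n => Fin (S.certLen n)) (fun n => Fin (reg₃ n))
  guess : QPT (fun n => Unit ⊕ Fin (S.skLen n)) (fun n => Fin (reg₃ n)) (fun _ => Unit) NoWires

/-- The certified deletion experiment with challenge bit `b`, in which the adversary plays the
receiver, is given the verification key, and gets the secret key (or else `⊥`) if its certificate
is accepted. -/
noncomputable def certDelExp (A : S.Adversary) (b : Bool) : PMF Bool := do
  let (pk, sk) ← S.keyGen n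
  let (ms, st₁) ← A.choose.prepare n pk
  let m : BitStr (S.msgLen n) := fun i => if b then ms (.inr i) else ms (.inl i)
  let (c₁, sst) ← S.send₁ n pk m
  let (c₂, st₂) ← A.reply.run n c₁ st₁
  let (c₃, vk) ← S.send₂ n sst c₂
  let (cert, st₃) ← A.delete.run n (Sum.elim c₃ vk) st₂
  let ok ← S.vrfy n vk cert
  let b' ← A.guess.measure n (encodeOption (if ok then some sk else none)) st₃
  return b' ()

/-- IND-CPA-CD security with public verification. -/
def INDCPACDSecure : Prop :=
  ∀ A : S.Adversary,
    Negligible fun n => |prob (S.certDelExp n A false) - prob (S.certDelExp n A true)|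

end PKECD

/-! ## The construction -/

/-- The scheme built from a one-shot signature scheme, a witness encryption scheme for the statements
"there is a one-shot signature on `0`", and a receiver non-committing encryption scheme whose
plaintexts are the ciphertexts of the witness encryption scheme. -/
noncomputable def pvScheme (oss : OneShotSig) (we : WitnessEnc oss.stmtLen oss.sigLen)
    (nce : NCE we.ctLen) : PKECD where
  pkLen := nce.pkLen
  skLen := nce.skLen
  msgLen := we.msgLen
  com₁Len := oss.crsLen
  com₂Len := oss.pkLen
  com₃Len := nce.ctLen
  vkLen := oss.stmtLen
  certLen := oss.sigLen
  ctLen := nce.ctLen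
  ctQubits := oss.skLen
  recQubits := oss.skLen
  SenderState := fun n => BitStr (nce.pkLen n) × BitStr (we.msgLen n) × BitStr (oss.crsLen n)
  keyGen := fun n => do
    let (pk, sk, _) ← nce.keyGen n
    return (pk, sk)
  send₁ := fun n pk m => do
    let crs ← oss.setup n
    return (crs, (pk, m, crs))
  receive₁ := fun n crs => oss.keyGen n crs
  send₂ := fun n (pk, m, crs) osspk => do
    let x : BitStr (oss.stmtLen n) := Fin.append crs osspk
    let wect ← we.enc n x m
    let ncect ← nce.enc n pk wect
    return (ncect, x)
  receive₂ := fun _ osssk ncect => PMF.pure (ncect, osssk)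
  dec := fun n sk (ncect, osssk) => do
    let σ ← oss.sign n osssk false
    let m' ← nce.dec n sk ncect
    match m' with
    | none => return none
    | some wect => we.dec n wect σ
  del := fun n (_, osssk) => oss.sign n osssk true
  vrfy := fun n vk σ =>
    PMF.pure (oss.vrfy n (fun i => vk (Fin.castAdd _ i)) (fun i => vk (Fin.natAdd _ i)) σ true)

end CertDel

/-! The proof makes two hops. In the first, RNC security replaces the honest `nce` ciphertext and
the true secret key by a fake ciphertext and a revealed key, separately for each challenge bit. The
reduction plays the sender towards the deletion adversary, submits the witness encryption ciphertext
as its plaintext, and checks the certificate and releases the key itself. Its two experiments are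
exactly `realGame` and `fakeGame` (`rncExp_false`, `rncExp_true`).

In the fake game the transmitted ciphertext is independent of the message, which enters only through
the revealed key. Witness encryption can therefore be postponed until after the certificate has been
sent (`fakeGame_eq`). If the certificate is rejected, the key is withheld and the message has no
influence. If it is accepted, it is a signature on `1`, and the rest of the game is a distinguisher
against witness encryption whose auxiliary state is the register of the adversary. Wherever this
distinguisher has advantage at least `1/p`, the extractor finds a signature on `0` under the same
keys with probability at least `1/q`, which completes a forgery. Hence the advantage is at most `1/p
+ q * Pr[forgery]` for large parameters. Since `p` is arbitrary and forging is negligible,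
`fakeGame_negligible` follows.

Extractable security fixes the distinguisher and the messages before the statement and the auxiliary
state. The `nce` keys, the fake ciphertext, the messages and the first register of the adversary are
therefore fixed beforehand at values that maximise the advantage (`exists_setting`) and built into
the reductions, which is legitimate for non-uniform algorithms with quantum advice.

Algorithms are concrete circuits, so each reduction must be assembled as a circuit of polynomial
size and its behaviour computed. The building blocks are `step`, `finish`, `start` and `compute`,
with instruments given by `instrument_step`, `instrument_finish`, `instrument_start` and
`instrument_compute`. An experiment manipulates normalised conditional states, whereas a circuit
that discards information yields their average. The composition rules `run_stepQ`, `run_stepC` and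
`run_finishTo` are therefore stated for continuations whose success probability is linear in the
density operator (`LinCont`). -/

set_option linter.unusedSectionVars false
set_option synthInstance.maxSize 2000

/-! ### Operator calculus: circuits acting on some of the wires. -/

namespace CertDel

open Matrix
open scoped ComplexOrder Kronecker

/-! ## Circuits on part of the wires -/

/-- The same instruction on renamed wires. -/
def Gate.map {W W' : Type} (e : W ↪ W') : Gate W → Gate W'
  | .hadamard i => .hadamard (e i)
  | .phaseT i => .phaseT (e i)
  | .not i => .not (e i)
  | .cnot c t h => .cnot (e c) (e t) (e.injective.ne h)
  | .toffoli c d t hcd hct hdt =>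
      .toffoli (e c) (e d) (e t) (e.injective.ne hcd) (e.injective.ne hct) (e.injective.ne hdt)
  | .measure i => .measure (e i)

section Embedding

variable {W W' : Type}

theorem extend_comp_self (e : W ↪ W') (s : W' → Bool) :
    Function.extend e (s ∘ e) s = s := by
  ext w
  by_cases h : ∃ i, e i = w
  · obtain ⟨i, rfl⟩ := h
    simp [e.injective.extend_apply]
  · simp [Function.extend_apply' _ _ _ h]

theorem extend_comp (e : W ↪ W') (a : W → Bool) (s : W' → Bool) :
    Function.extend e a s ∘ e = a :=
  funext fun i => e.injective.extend_apply a s i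

theorem extend_extend (e : W ↪ W') (a b : W → Bool) (s : W' → Bool) :
    Function.extend e a (Function.extend e b s) = Function.extend e a s := by
  ext w
  by_cases h : ∃ i, e i = w
  · obtain ⟨i, rfl⟩ := h
    simp [e.injective.extend_apply]
  · simp [Function.extend_apply' _ _ _ h]

theorem extend_update [DecidableEq W] [DecidableEq W'] (e : W ↪ W') (s : W' → Bool) (i : W)
    (b : Bool) :
    Function.extend e (Function.update (s ∘ e) i b) s = Function.update s (e i) b := by
  ext w
  by_cases h : ∃ j, e j = w
  · obtain ⟨j, rfl⟩ := h
    by_cases hj : j = i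
    · subst hj; simp [e.injective.extend_apply]
    · simp [e.injective.extend_apply, hj]
  · have : w ≠ e i := fun hw => h ⟨i, hw.symm⟩
    simp [Function.extend_apply' _ _ _ h, this]

/-- The block of an operator that belongs to fixed row and column values of the wires outside the
range of `e`. -/
noncomputable def block (e : W ↪ W') (ρ : Op W') (s t : W' → Bool) : Op W :=
  Matrix.of fun a b => ρ (Function.extend e a s) (Function.extend e b t)

end Embedding

section Semantics

variable {W W' : Type} [Fintype W] [DecidableEq W] [Fintype W'] [DecidableEq W']

theorem hadamard_mul_apply (i : W) (M : Op W) (s t : W → Bool) :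
    (hadamardMatrix i * M) s t = ((√2 : ℝ) : ℂ)⁻¹ *
      (M (Function.update s i false) t +
        (if s i then -1 else 1) * M (Function.update s i true) t) := by
  rw [Matrix.mul_apply]
  have : ∀ u, hadamardMatrix i s u * M u t = if ∀ j, j ≠ i → u j = s j then
      ((if s i && u i then -1 else 1) * ((√2 : ℝ) : ℂ)⁻¹) * M u t else 0 := by
    intro u
    have h : (∀ j, j ≠ i → s j = u j) ↔ ∀ j, j ≠ i → u j = s j :=
      forall_congr' fun j => imp_congr_right fun _ => eq_comm
    simp only [hadamardMatrix, of_apply, h, ite_mul, zero_mul]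
  simp only [this, hadamard_sum]
  cases s i <;> simp <;> ring

theorem mul_hadamard_apply (i : W) (M : Op W) (s t : W → Bool) :
    (M * (hadamardMatrix i)ᴴ) s t = ((√2 : ℝ) : ℂ)⁻¹ *
      (M s (Function.update t i false) +
        (if t i then -1 else 1) * M s (Function.update t i true)) := by
  have : (M * (hadamardMatrix i)ᴴ) s t = star ((hadamardMatrix i * Mᴴ) t s) := by
    rw [← conjTranspose_apply, conjTranspose_mul, conjTranspose_conjTranspose]
  rw [this, hadamard_mul_apply]
  split_ifs <;> simp

/-- A gate alters row and column indices only on its own wires, so the values of `s` and `t` outside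
the range of `e` are mere parameters. This is the entrywise form of tensoring the gate with the
identity. -/
theorem Gate.map_apply (e : W ↪ W') (g : Gate W) (ρ : Op W') (s t : W' → Bool) :
    (g.map e).apply ρ s t = g.apply (block e ρ s t) (s ∘ e) (t ∘ e) := by
  have hflip : ∀ (i : W) (P : (W → Bool) → Bool) (u : W' → Bool),
      Function.extend e (flipIf i P (u ∘ e)) u = flipIf (e i) (fun v => P (v ∘ e)) u :=
    fun i P u => extend_update e u i _
  cases g with
  | hadamard i =>
      simp only [Gate.map, Gate.apply, hadamard_mul_apply, mul_hadamard_apply, block, of_apply,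
        extend_update, Function.comp_apply]
  | phaseT i =>
      simp only [Gate.map, Gate.apply, phaseTMatrix, diagonal_conjTranspose, mul_diagonal,
        diagonal_mul, block, of_apply, extend_comp_self, Function.comp_apply, Pi.star_apply]
  | not i => simp only [Gate.map, Gate.apply, submatrix_apply, block, of_apply, hflip]
  | cnot c d h => simp only [Gate.map, Gate.apply, submatrix_apply, block, of_apply, hflip]; rfl
  | toffoli c d u h h' h'' =>
      simp only [Gate.map, Gate.apply, submatrix_apply, block, of_apply, hflip]; rfl
  | measure i =>
      simp only [Gate.map, Gate.apply, block, of_apply, extend_comp_self, Function.comp_apply]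

/-- A circuit on part of the wires acts on each block separately. -/
theorem runCircuit_map (e : W ↪ W') (C : List (Gate W)) (ρ : Op W') (s t : W' → Bool) :
    runCircuit (C.map (Gate.map e)) ρ s t = runCircuit C (block e ρ s t) (s ∘ e) (t ∘ e) := by
  induction C generalizing ρ with
  | nil => simp [runCircuit, block, extend_comp_self]
  | cons g C ih =>
      -- Indices inside the block overwrite the values on the range of `e`, so all entries of the
      -- new block refer to the same old block.
      have : block e ((g.map e).apply ρ) s t = g.apply (block e ρ s t) := by
        ext a b
        simp only [block, of_apply, Gate.map_apply, extend_comp, extend_extend]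
      exact (ih _).trans (by rw [this]; rfl)

theorem runCircuit_append (C D : List (Gate W)) (ρ : Op W) :
    runCircuit (C ++ D) ρ = runCircuit D (runCircuit C ρ) :=
  List.foldl_append

theorem Gate.apply_add (g : Gate W) (ρ σ : Op W) : g.apply (ρ + σ) = g.apply ρ + g.apply σ := by
  cases g with
  | measure i => ext s t; simp only [Gate.apply, of_apply, Matrix.add_apply]; split_ifs <;> simp
  | _ => simp [Gate.apply, mul_add, add_mul, submatrix_add]

theorem Gate.apply_smul (g : Gate W) (c : ℂ) (ρ : Op W) : g.apply (c • ρ) = c • g.apply ρ := by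
  cases g with
  | measure i => ext s t; simp [Gate.apply]
  | _ => simp [Gate.apply, submatrix_smul]

/-- The action of a circuit as a linear map. -/
noncomputable def runCircuitL (C : List (Gate W)) : Op W →ₗ[ℂ] Op W where
  toFun := runCircuit C
  map_add' ρ σ := by
    induction C generalizing ρ σ with
    | nil => rfl
    | cons g C ih =>
        change runCircuit C (g.apply _) = runCircuit C (g.apply _) + runCircuit C (g.apply _)
        rw [g.apply_add, ih]
  map_smul' c ρ := by
    induction C generalizing ρ with
    | nil => rfl
    | cons g C ih =>
        change runCircuit C (g.apply _) = c • runCircuit C (g.apply _)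
        rw [g.apply_smul]
        exact ih _

theorem runCircuit_smul (C : List (Gate W)) (c : ℂ) (ρ : Op W) :
    runCircuit C (c • ρ) = c • runCircuit C ρ :=
  (runCircuitL C).map_smul c ρ

/-! ### Computing several bits at once -/

/-- The action on basis strings that flips, for all `j`, the bit on wire `t j` if `P j` holds. -/
noncomputable def flipAll {T : Type} (t : T → W) (P : T → (W → Bool) → Bool) (s : W → Bool) :
    W → Bool :=
  Function.extend t (fun j => xor (s (t j)) (P j s)) s

theorem flipAll_target {T : Type} (t : T ↪ W) (P : T → (W → Bool) → Bool) (s : W → Bool) (j : T) :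
    flipAll t P s (t j) = xor (s (t j)) (P j s) :=
  t.injective.extend_apply _ _ _

theorem flipAll_other {T : Type} (t : T → W) (P : T → (W → Bool) → Bool) (s : W → Bool) (w : W)
    (h : ∀ j, t j ≠ w) : flipAll t P s w = s w :=
  Function.extend_apply' _ _ _ fun ⟨j, hj⟩ => h j hj

/-- By `hP` no condition reads a target wire, so flipping one target never affects another
condition, and the sequential flips amount to a simultaneous one. -/
theorem runCircuit_flipAll {T : Type} [Fintype T] (t : T ↪ W) (P : T → (W → Bool) → Bool)
    (γ : T → List (Gate W))
    (hγ : ∀ j ρ, runCircuit (γ j) ρ = ρ.submatrix (flipIf (t j) (P j)) (flipIf (t j) (P j)))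
    (hP : ∀ j j' s v, P j (Function.update s (t j') v) = P j s) (ρ : Op W) :
    runCircuit (Finset.univ.toList.flatMap γ) ρ =
      ρ.submatrix (flipAll t P) (flipAll t P) := by
  classical
  -- For the induction, the flips that have not been executed are masked by membership in `l`.
  -- Distinctness of the entries prevents a target from being flipped twice.
  have key : ∀ (l : List T), l.Nodup → ∀ ρ : Op W, runCircuit (l.flatMap γ) ρ =
      ρ.submatrix (flipAll t fun j s => decide (j ∈ l) && P j s)
        (flipAll t fun j s => decide (j ∈ l) && P j s) := by
    intro l
    induction l with
    | nil =>
        intro _ ρ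
        have : (flipAll t fun j s => decide (j ∈ ([] : List T)) && P j s) = id := by
          ext s w
          by_cases h : ∃ j, t j = w
          · obtain ⟨j, rfl⟩ := h
            simp [flipAll_target]
          · rw [flipAll_other _ _ _ _ (not_exists.mp h)]; rfl
        rw [this]
        rfl
    | cons i l ih =>
        intro hl ρ
        rw [List.nodup_cons] at hl
        have hstep : ∀ s, flipIf (t i) (P i) (flipAll t (fun j s => decide (j ∈ l) && P j s) s) =
            flipAll t (fun j s => decide (j ∈ i :: l) && P j s) s := by
          intro s
          have hPs : P i (flipAll t (fun j s => decide (j ∈ l) && P j s) s) = P i s := by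
            -- `hP` covers a change of one target; induction over the set of changed targets extends
            -- it to arbitrary changes on all of them.
            have : ∀ (m : Finset T) (u : T → Bool),
                P i (Function.extend t (fun j => if j ∈ m then u j else s (t j)) s) = P i s := by
              intro m u
              induction m using Finset.induction_on with
              | empty => simp only [Finset.notMem_empty, if_false]
                         exact congrArg _ (extend_comp_self t s)
              | insert k m hk ih =>
                  rw [← ih, ← hP i k (Function.extend t (fun j => if j ∈ m then u j else s (t j)) s) (u k)]
                  congr 1
                  ext w
                  by_cases h : ∃ j, t j = w
                  · obtain ⟨j, rfl⟩ := h
                    by_cases hj : j = k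
                    · subst hj; simp [t.injective.extend_apply]
                    · simp [t.injective.extend_apply, hj]
                  · have : w ≠ t k := fun hw => h ⟨k, hw.symm⟩
                    simp [Function.extend_apply' _ _ _ h, this]
            rw [← this Finset.univ fun j => xor (s (t j)) (decide (j ∈ l) && P j s)]
            simp [flipAll]
          ext w
          by_cases h : ∃ j, t j = w
          · obtain ⟨j, rfl⟩ := h
            by_cases hj : j = i
            · subst hj
              simp [flipIf, flipAll_target, hPs, hl.1]
            · simp [flipIf, flipAll_target, hj]
          · have : w ≠ t i := fun hw => h ⟨i, hw.symm⟩
            rw [flipAll_other _ _ _ _ (not_exists.mp h)]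
            simp only [flipIf, Function.update_of_ne this]
            rw [flipAll_other _ _ _ _ (not_exists.mp h)]
        rw [List.flatMap_cons, runCircuit_append, hγ, ih hl.2, submatrix_submatrix]
        have : flipIf (t i) (P i) ∘ flipAll t (fun j s => decide (j ∈ l) && P j s) =
            flipAll t (fun j s => decide (j ∈ i :: l) && P j s) := funext hstep
        rw [this]
  rw [key _ (Finset.nodup_toList _)]
  simp

/-- Measure all the wires in the range of `t`. -/
noncomputable def measureAll {T : Type} [Fintype T] (t : T → W) : List (Gate W) :=
  Finset.univ.toList.map fun j => .measure (t j)

theorem runCircuit_measureAll {T : Type} [Fintype T] (t : T → W) (ρ : Op W) (r s : W → Bool) :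
    runCircuit (measureAll t) ρ r s = if r ∘ t = s ∘ t then ρ r s else 0 := by
  have key : ∀ (l : List T) (ρ : Op W), runCircuit (l.map fun j => Gate.measure (t j)) ρ r s =
      open Classical in if ∀ j ∈ l, r (t j) = s (t j) then ρ r s else 0 := by
    intro l
    induction l with
    | nil => intro ρ; simp [runCircuit]
    | cons i l ih =>
        intro ρ
        change runCircuit (l.map fun j => Gate.measure (t j)) _ r s = _
        rw [ih]
        simp only [Gate.apply, of_apply, List.forall_mem_cons]
        split_ifs <;> simp_all
  rw [measureAll, key]
  simp [funext_iff]

/-- Add the bits on the wires `c j` to those on the wires `t j`. -/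
noncomputable def copyAll {T : Type} [Fintype T] (c : T → W) (t : T → W) (h : ∀ j j', c j ≠ t j') :
    List (Gate W) :=
  Finset.univ.toList.flatMap fun j => [.cnot (c j) (t j) (h j j)]

theorem runCircuit_copyAll {T : Type} [Fintype T] (c : T → W) (t : T ↪ W)
    (h : ∀ j j', c j ≠ t j') (ρ : Op W) :
    runCircuit (copyAll c t h) ρ =
      ρ.submatrix (flipAll t fun j s => s (c j)) (flipAll t fun j s => s (c j)) :=
  runCircuit_flipAll t _ _ (fun _ _ => rfl) (fun j j' s v => by simp [h]) ρ

theorem length_copyAll {T : Type} [Fintype T] (c : T → W) (t : T → W)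
    (h : ∀ j j', c j ≠ t j') : (copyAll c t h).length = Fintype.card T := by
  simp [copyAll]

theorem length_measureAll {T : Type} [Fintype T] (t : T → W) :
    (measureAll t).length = Fintype.card T := by
  simp [measureAll]

end Semantics

end CertDel

/-! ### States, and algorithms with renamed wires. -/

namespace CertDel

open Matrix
open scoped ComplexOrder Kronecker

/-! ## Constructions of states -/

theorem sum_sumElim {A B M : Type} [Fintype A] [DecidableEq A] [Fintype B] [DecidableEq B]
    [AddCommMonoid M] (f : (A ⊕ B → Bool) → M) :
    ∑ a, f a = ∑ a : A → Bool, ∑ b : B → Bool, f (Sum.elim a b) := by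
  rw [← Equiv.sum_comp (Equiv.sumArrowEquivProdArrow A B Bool).symm f, Fintype.sum_prod_type]
  rfl

theorem sum_arrowCongr {A B M : Type} [Fintype A] [DecidableEq A] [Fintype B] [DecidableEq B]
    [AddCommMonoid M] (e : A ≃ B) (f : (A → Bool) → M) :
    ∑ b : B → Bool, f (b ∘ e) = ∑ a, f a := by
  rw [← Equiv.sum_comp (Equiv.arrowCongr e.symm (Equiv.refl Bool)) f]
  rfl

namespace State

variable {A B : Type} [Fintype A] [DecidableEq A] [Fintype B] [DecidableEq B]

theorem ext_op {σ τ : State A} (h : σ.op = τ.op) : σ = τ := by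
  cases σ; cases τ; simp_all

/-- The same state on renamed wires. -/
noncomputable def reindex (e : A ≃ B) (σ : State A) : State B where
  op := σ.op.submatrix (fun b => b ∘ e) (fun b => b ∘ e)
  psd := σ.psd.submatrix _
  trace_eq_one := by
    rw [← σ.trace_eq_one]
    exact sum_arrowCongr e fun a => σ.op a a

/-- The product state. -/
noncomputable def prod (σ : State A) (τ : State B) : State (A ⊕ B) where
  op := Matrix.of fun s t => σ.op (s ∘ Sum.inl) (t ∘ Sum.inl) * τ.op (s ∘ Sum.inr) (t ∘ Sum.inr)
  psd := (σ.psd.kronecker τ.psd).submatrix fun s : A ⊕ B → Bool => (s ∘ Sum.inl, s ∘ Sum.inr)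
  trace_eq_one := by
    have h1 : ∑ a, σ.op a a = 1 := σ.trace_eq_one
    have h2 : ∑ a, τ.op a a = 1 := τ.trace_eq_one
    simp only [Matrix.trace, diag_apply, of_apply, sum_sumElim]
    change ∑ a, ∑ b, σ.op a a * τ.op b b = 1
    simp only [← Finset.mul_sum, h2, mul_one, h1]

theorem ket_op_apply (x s t : A → Bool) :
    (State.ket x).op s t = if s = x ∧ t = x then 1 else 0 := by
  simp only [State.ket, diagonal_apply]
  by_cases h : s = t
  · subst h; simp
  · rw [if_neg h, if_neg]
    rintro ⟨rfl, rfl⟩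
    exact h rfl

/-- A positive semidefinite operator of trace zero vanishes, so the default value of
`State.normalize` is multiplied by zero and does no harm. Thus probability times conditional state
is always the unnormalised state. -/
theorem trace_smul_normalize {M : Op A} (h : M.PosSemidef) :
    M.trace • (State.normalize M).op = M := by
  by_cases h0 : M.trace = 0
  · rw [h0, zero_smul, h.trace_eq_zero_iff.mp h0]
  · have h' : M.PosSemidef ∧ M.trace ≠ 0 := ⟨h, h0⟩
    simp [State.normalize, dif_pos h', smul_smul, h0]

/-- On no wires there is only one state. -/
theorem eq_ket_of_isEmpty [IsEmpty A] (σ : State A) (x : A → Bool) : σ = State.ket x := by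
  apply ext_op
  ext s t
  have h1 := σ.trace_eq_one
  have h2 := (State.ket x).trace_eq_one
  simp only [Matrix.trace, diag_apply, Fintype.sum_unique] at h1 h2
  convert h1.trans h2.symm using 2

end State

namespace QAlg

variable {Ic Iq Oc Oq : Type}
  [Fintype Ic] [DecidableEq Ic] [Fintype Iq] [DecidableEq Iq]
  [Fintype Oc] [DecidableEq Oc] [Fintype Oq] [DecidableEq Oq]

theorem initial_add (F : QAlg Ic Iq Oc Oq) (x : Ic → Bool) (ρ σ : Op Iq) :
    F.initial x (ρ + σ) = F.initial x ρ + F.initial x σ := by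
  ext s t
  simp only [initial, of_apply, Matrix.add_apply, add_mul]
  split_ifs <;> simp

theorem initial_smul (F : QAlg Ic Iq Oc Oq) (x : Ic → Bool) (c : ℂ) (ρ : Op Iq) :
    F.initial x (c • ρ) = c • F.initial x ρ := by
  ext s t
  simp only [initial, of_apply, Matrix.smul_apply, smul_eq_mul, mul_assoc, mul_ite, mul_zero]

/-- The instrument as a linear map of the state of the quantum input wires. -/
noncomputable def instrumentL (F : QAlg Ic Iq Oc Oq) (x : Ic → Bool) (y : Oc → Bool) :
    Op Iq →ₗ[ℂ] Op Oq where
  toFun ρ := F.instrument x ρ y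
  map_add' ρ σ := by
    simp only [instrument, initial_add]
    simp only [← Finset.sum_add_distrib]
    refine Finset.sum_congr rfl fun i _ => Finset.sum_congr rfl fun k _ =>
      Finset.sum_congr rfl fun a _ => ?_
    exact congrArg (fun M : Op _ => M.submatrix _ _) ((runCircuitL F.circuit).map_add _ _)
  map_smul' c ρ := by
    simp only [instrument, initial_smul, RingHom.id_apply, Finset.smul_sum]
    refine Finset.sum_congr rfl fun i _ => Finset.sum_congr rfl fun k _ =>
      Finset.sum_congr rfl fun a _ => ?_
    exact congrArg (fun M : Op _ => M.submatrix _ _) ((runCircuitL F.circuit).map_smul c _)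

theorem instrumentL_apply (F : QAlg Ic Iq Oc Oq) (x : Ic → Bool) (y : Oc → Bool) (ρ : Op Iq) :
    F.instrumentL x y ρ = F.instrument x ρ y := rfl

theorem instrument_apply (F : QAlg Ic Iq Oc Oq) (x : Ic → Bool) (ρ : Op Iq) (y : Oc → Bool)
    (v v' : Oq → Bool) : F.instrument x ρ y v v' =
      ∑ i : Ic → Bool, ∑ k : Iq → Bool, ∑ a : Fin F.work → Bool,
        runCircuit F.circuit (F.initial x ρ) (wires i k y v a) (wires i k y v' a) := by
  simp only [instrument, Matrix.sum_apply, submatrix_apply]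

/-! ### Circuits with an arbitrary set of work wires -/

section OfWork

variable {Wk : Type} [Fintype Wk] [DecidableEq Wk]

/-- The circuit `C` with work wires `Wk` in the state `adv`, as a quantum algorithm. -/
noncomputable def ofWork (adv : State Wk) (C : List (Gate ((Ic ⊕ Iq) ⊕ (Oc ⊕ Oq) ⊕ Wk))) :
    QAlg Ic Iq Oc Oq where
  work := Fintype.card Wk
  advice := adv.reindex (Fintype.equivFin Wk)
  circuit := C.map (Gate.map (Equiv.sumCongr (Equiv.refl _)
    (Equiv.sumCongr (Equiv.refl _) (Fintype.equivFin Wk))).toEmbedding)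

theorem size_ofWork (adv : State Wk) (C : List (Gate ((Ic ⊕ Iq) ⊕ (Oc ⊕ Oq) ⊕ Wk))) :
    (ofWork adv C).size = Fintype.card Ic + Fintype.card Iq + Fintype.card Oc + Fintype.card Oq +
      Fintype.card Wk + C.length := by
  simp [size, ofWork]

/-- The initial operator for the work wires `Wk` in the state `adv`. -/
noncomputable def initialOf (adv : State Wk) (x : Ic → Bool) (ρ : Op Iq) :
    Op ((Ic ⊕ Iq) ⊕ (Oc ⊕ Oq) ⊕ Wk) :=
  Matrix.of fun s t =>
    if ((∀ i, s (.inl (.inl i)) = x i) ∧ ∀ o, s (.inr (.inl o)) = false) ∧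
        (∀ i, t (.inl (.inl i)) = x i) ∧ ∀ o, t (.inr (.inl o)) = false then
      ρ (fun i => s (.inl (.inr i))) (fun i => t (.inl (.inr i))) *
        adv.op (fun i => s (.inr (.inr i))) (fun i => t (.inr (.inr i)))
    else 0

/-- The assignment of bits to all wires given by its five parts. -/
def wiresOf (x : Ic → Bool) (k : Iq → Bool) (y : Oc → Bool) (u : Oq → Bool)
    (a : Wk → Bool) : (Ic ⊕ Iq) ⊕ (Oc ⊕ Oq) ⊕ Wk → Bool :=
  Sum.elim (Sum.elim x k) (Sum.elim (Sum.elim y u) a)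

theorem instrument_mk (w : ℕ) (adv : State (Fin w))
    (C : List (Gate ((Ic ⊕ Iq) ⊕ (Oc ⊕ Oq) ⊕ Fin w))) (x : Ic → Bool) (ρ : Op Iq) (y : Oc → Bool)
    (v v' : Oq → Bool) :
    (QAlg.mk w adv C).instrument x ρ y v v' =
      ∑ i : Ic → Bool, ∑ k : Iq → Bool, ∑ a : Fin w → Bool,
        runCircuit C (initialOf adv x ρ) (wiresOf i k y v a) (wiresOf i k y v' a) :=
  instrument_apply _ _ _ _ _ _

/-- Renaming by a bijection leaves no wires outside its range, so the single block in
`runCircuit_map` is the whole operator. -/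
theorem instrument_ofWork (adv : State Wk) (C : List (Gate ((Ic ⊕ Iq) ⊕ (Oc ⊕ Oq) ⊕ Wk)))
    (x : Ic → Bool) (ρ : Op Iq) (y : Oc → Bool) (v v' : Oq → Bool) :
    (ofWork adv C).instrument x ρ y v v' =
      ∑ i : Ic → Bool, ∑ k : Iq → Bool, ∑ a : Wk → Bool,
        runCircuit C (initialOf adv x ρ) (wiresOf i k y v a) (wiresOf i k y v' a) := by
  rw [ofWork, instrument_mk]
  refine Finset.sum_congr rfl fun i _ => Finset.sum_congr rfl fun k _ => ?_
  rw [← sum_arrowCongr (Fintype.equivFin Wk)]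
  refine Finset.sum_congr rfl fun a _ => ?_
  set e : (Ic ⊕ Iq) ⊕ (Oc ⊕ Oq) ⊕ Wk ≃ (Ic ⊕ Iq) ⊕ (Oc ⊕ Oq) ⊕ Fin (Fintype.card Wk) :=
    Equiv.sumCongr (Equiv.refl _) (Equiv.sumCongr (Equiv.refl _) (Fintype.equivFin Wk)) with he
  have hw : ∀ u, wiresOf i k y u a ∘ e = wiresOf i k y u (a ∘ Fintype.equivFin Wk) := by
    intro u
    ext w
    rcases w with (w | w) | (w | w) | w <;> rfl
  have hb : ∀ s t, block e.toEmbedding (initialOf (adv.reindex (Fintype.equivFin Wk)) x ρ) s t = initialOf adv x ρ := by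
    intro s t
    have hx : ∀ (b : (Ic ⊕ Iq) ⊕ (Oc ⊕ Oq) ⊕ Wk → Bool) s w,
        Function.extend e.toEmbedding b s w = b (e.symm w) := by
      intro b s w
      obtain ⟨w, rfl⟩ := e.surjective w
      rw [e.symm_apply_apply]
      exact e.injective.extend_apply b s w
    ext b c
    simp only [block, of_apply, initialOf, hx, State.reindex, submatrix_apply]
    have h1 : ((fun i => b (e.symm (Sum.inr (Sum.inr i)))) ∘ Fintype.equivFin Wk) =
        fun i => b (.inr (.inr i)) := by
      ext i
      exact congrArg b (e.symm_apply_apply (.inr (.inr i)))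
    have h2 : ((fun i => c (e.symm (Sum.inr (Sum.inr i)))) ∘ Fintype.equivFin Wk) =
        fun i => c (.inr (.inr i)) := by
      ext i
      exact congrArg c (e.symm_apply_apply (.inr (.inr i)))
    rw [h1, h2]
    rfl
  rw [runCircuit_map, hb, Equiv.coe_toEmbedding, hw, hw]

end OfWork

/-! ### Renaming the quantum output wires -/

/-- Rename the quantum output wires. -/
noncomputable def mapOut {Oq' : Type} (F : QAlg Ic Iq Oc Oq) (e : Oq ≃ Oq') : QAlg Ic Iq Oc Oq' where
  work := F.work
  advice := F.advice
  circuit := F.circuit.map (Gate.map (Equiv.sumCongr (Equiv.refl _)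
    (Equiv.sumCongr (Equiv.sumCongr (Equiv.refl _) e) (Equiv.refl _))).toEmbedding)

theorem size_mapOut {Oq' : Type} [Fintype Oq'] (F : QAlg Ic Iq Oc Oq) (e : Oq ≃ Oq') :
    (F.mapOut e).size = F.size := by
  simp [size, mapOut, Fintype.card_congr e]

theorem instrument_mapOut {Oq' : Type} [Fintype Oq'] [DecidableEq Oq'] (F : QAlg Ic Iq Oc Oq)
    (e : Oq ≃ Oq') (x : Ic → Bool) (ρ : Op Iq) (y : Oc → Bool) (v v' : Oq' → Bool) :
    (F.mapOut e).instrument x ρ y v v' = F.instrument x ρ y (v ∘ e) (v' ∘ e) := by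
  obtain ⟨w, adv, C⟩ := F
  rw [mapOut, instrument_mk, instrument_mk]
  refine Finset.sum_congr rfl fun i _ => Finset.sum_congr rfl fun k _ =>
    Finset.sum_congr rfl fun a _ => ?_
  set E : (Ic ⊕ Iq) ⊕ (Oc ⊕ Oq) ⊕ Fin w ≃ (Ic ⊕ Iq) ⊕ (Oc ⊕ Oq') ⊕ Fin w :=
    Equiv.sumCongr (Equiv.refl _) (Equiv.sumCongr (Equiv.sumCongr (Equiv.refl _) e) (Equiv.refl _))
    with hE
  have hw : ∀ u, wiresOf i k y u a ∘ E = wiresOf i k y (u ∘ e) a := by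
    intro u
    ext w
    rcases w with (w | w) | (w | w) | w <;> rfl
  have hb : ∀ s t, block E.toEmbedding (initialOf adv x ρ) s t = initialOf adv x ρ := by
    intro s t
    have hx : ∀ (b : (Ic ⊕ Iq) ⊕ (Oc ⊕ Oq) ⊕ Fin w → Bool) s w,
        Function.extend E.toEmbedding b s w = b (E.symm w) := by
      intro b s w
      obtain ⟨w, rfl⟩ := E.surjective w
      rw [E.symm_apply_apply]
      exact E.injective.extend_apply b s w
    ext b c
    simp only [block, of_apply, initialOf, hx]
    have h : ∀ b : (Ic ⊕ Iq) ⊕ (Oc ⊕ Oq) ⊕ Fin w → Bool,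
        (∀ o : Oc ⊕ Oq', b (E.symm (.inr (.inl o))) = false) ↔
          ∀ o : Oc ⊕ Oq, b (.inr (.inl o)) = false := fun b =>
      (Equiv.forall_congr_right (Equiv.sumCongr (Equiv.refl Oc) e).symm
        (q := fun o => b (.inr (.inl o)) = false))
    simp only [h]
    rfl
  rw [runCircuit_map, hb, Equiv.coe_toEmbedding, hw, hw]

end QAlg

end CertDel

/-! ### Running one circuit after another. -/

namespace CertDel

open Matrix
open scoped ComplexOrder Kronecker

namespace QAlg

variable {Ic Iq Oc Oq : Type}
  [Fintype Ic] [DecidableEq Ic] [Fintype Iq] [DecidableEq Iq]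
  [Fintype Oc] [DecidableEq Oc] [Fintype Oq] [DecidableEq Oq]

/-! ### Sequential composition -/

theorem ite_mul_ite_mul_ite {A B C D E : Prop} [Decidable A] [Decidable B] [Decidable C]
    [Decidable D] [Decidable E] (r a g : ℂ) (h : A ∧ B ∧ C ↔ D ∧ E) :
    (if A then r * (a * ((if B then 1 else 0) * ((if C then 1 else 0) * g))) else 0) =
      (if D then g else 0) * if E then r * a else 0 := by
  by_cases hA : A <;> by_cases hB : B <;> by_cases hC : C <;> by_cases hD : D <;>
    by_cases hE : E <;> simp only [hA, hB, hC, hD, hE, if_true, if_false] <;>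
    first | ring1 | (exfalso; tauto)

section Step

variable {Γ K R Ic' Oc' Oq' : Type}
  [Fintype Γ] [DecidableEq Γ] [Fintype K] [DecidableEq K] [Fintype R] [DecidableEq R]
  [Fintype Ic'] [DecidableEq Ic'] [Fintype Oc'] [DecidableEq Oc'] [Fintype Oq'] [DecidableEq Oq']

/-- The wires of the composition of two algorithms with `wP` and `wG` work wires. -/
abbrev StepWires (Ic Iq Γ K R Ic' Oc' Oq' : Type) (wP wG : ℕ) : Type :=
  (Ic ⊕ Iq) ⊕ ((Γ ⊕ Oc') ⊕ (Oq' ⊕ R)) ⊕ (Fin wP ⊕ (Ic' ⊕ (K ⊕ Fin wG)))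

/-- The wires of the first algorithm in the composition. -/
def stepFst (Ic Iq Γ K R Ic' Oc' Oq' : Type) (wP wG : ℕ) :
    (Ic ⊕ Iq) ⊕ (Γ ⊕ (K ⊕ R)) ⊕ Fin wP ↪ StepWires Ic Iq Γ K R Ic' Oc' Oq' wP wG where
  toFun
    | .inl i => .inl i
    | .inr (.inl (.inl y)) => .inr (.inl (.inl (.inl y)))
    | .inr (.inl (.inr (.inl k))) => .inr (.inr (.inr (.inr (.inl k))))
    | .inr (.inl (.inr (.inr r))) => .inr (.inl (.inr (.inr r)))
    | .inr (.inr a) => .inr (.inr (.inl a))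
  inj' := by
    rintro (i | (y | (k | r)) | a) (i' | (y' | (k' | r')) | a') h <;> simp_all

/-- The wires of the second algorithm in the composition. -/
def stepSnd (Ic Iq Γ K R Ic' Oc' Oq' : Type) (wP wG : ℕ) :
    (Ic' ⊕ K) ⊕ (Oc' ⊕ Oq') ⊕ Fin wG ↪ StepWires Ic Iq Γ K R Ic' Oc' Oq' wP wG where
  toFun
    | .inl (.inl i) => .inr (.inr (.inr (.inl i)))
    | .inl (.inr k) => .inr (.inr (.inr (.inr (.inl k))))
    | .inr (.inl (.inl y)) => .inr (.inl (.inl (.inr y)))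
    | .inr (.inl (.inr u)) => .inr (.inl (.inr (.inl u)))
    | .inr (.inr a) => .inr (.inr (.inr (.inr (.inr a))))
  inj' := by
    rintro ((i | k) | (y | u) | a) ((i' | k') | (y' | u') | a') h <;> simp_all

/-- Run `P` and then `G`, which acts on the part `K` of the quantum output of `P` and whose
classical input wires `j` are read from the classical outputs `f j` of `P`.  The classical output of
`P` is kept. -/
noncomputable def step (P : QAlg Ic Iq Γ (K ⊕ R)) (G : QAlg Ic' K Oc' Oq') (f : Ic' → Γ) :
    QAlg Ic Iq (Γ ⊕ Oc') (Oq' ⊕ R) :=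
  ofWork (P.advice.prod ((State.ket fun _ : Ic' => false).prod
      ((State.ket fun _ : K => false).prod G.advice)))
    (P.circuit.map (Gate.map (stepFst Ic Iq Γ K R Ic' Oc' Oq' P.work G.work)) ++
      (measureAll (fun y : Γ => .inr (.inl (.inl (.inl y)))) ++
        (copyAll (fun j : Ic' => .inr (.inl (.inl (.inl (f j)))))
          (fun j : Ic' => .inr (.inr (.inr (.inl j)))) (by simp) ++
          G.circuit.map (Gate.map (stepSnd Ic Iq Γ K R Ic' Oc' Oq' P.work G.work)))))

/-- The factor `2` pays for one measurement per wire of `Γ` and one copying gate per wire of `Ic'`,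
in addition to the wires themselves. -/
theorem size_step_le (P : QAlg Ic Iq Γ (K ⊕ R)) (G : QAlg Ic' K Oc' Oq') (f : Ic' → Γ) :
    (P.step G f).size ≤ 2 * P.size + 2 * G.size := by
  rw [step, size_ofWork]
  simp only [size, List.length_append, List.length_map, length_measureAll,
    length_copyAll, Fintype.card_sum, Fintype.card_fin]
  omega

section

variable {wP wG : ℕ}

theorem extend_stepFst (a : (Ic ⊕ Iq) ⊕ (Γ ⊕ (K ⊕ R)) ⊕ Fin wP → Bool)
    (s : StepWires Ic Iq Γ K R Ic' Oc' Oq' wP wG → Bool) :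
    Function.extend (stepFst Ic Iq Γ K R Ic' Oc' Oq' wP wG) a s =
      Sum.elim (fun i => a (.inl i)) (Sum.elim
        (Sum.elim (Sum.elim (fun y => a (.inr (.inl (.inl y)))) fun o => s (.inr (.inl (.inl (.inr o)))))
          (Sum.elim (fun u => s (.inr (.inl (.inr (.inl u))))) fun r => a (.inr (.inl (.inr (.inr r))))))
        (Sum.elim (fun w => a (.inr (.inr w)))
          (Sum.elim (fun j => s (.inr (.inr (.inr (.inl j)))))
            (Sum.elim (fun k => a (.inr (.inl (.inr (.inl k)))))
              fun w => s (.inr (.inr (.inr (.inr (.inr w))))))))) := by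
  ext w
  have hin := (stepFst Ic Iq Γ K R Ic' Oc' Oq' wP wG).injective.extend_apply a s
  have hout := fun b h => Function.extend_apply' (f := stepFst Ic Iq Γ K R Ic' Oc' Oq' wP wG) a s b h
  rcases w with i | ((y | o) | (u | r)) | (w | j | k | w)
  · exact hin (.inl i)
  · exact hin (.inr (.inl (.inl y)))
  · exact hout _ (by rintro ⟨(i | (y | (k | r)) | a), h⟩ <;> cases h)
  · exact hout _ (by rintro ⟨(i | (y | (k | r)) | a), h⟩ <;> cases h)
  · exact hin (.inr (.inl (.inr (.inr r))))
  · exact hin (.inr (.inr w))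
  · exact hout _ (by rintro ⟨(i | (y | (k | r)) | a), h⟩ <;> cases h)
  · exact hin (.inr (.inl (.inr (.inl k))))
  · exact hout _ (by rintro ⟨(i | (y | (k | r)) | a), h⟩ <;> cases h)

theorem extend_stepSnd (a : (Ic' ⊕ K) ⊕ (Oc' ⊕ Oq') ⊕ Fin wG → Bool)
    (s : StepWires Ic Iq Γ K R Ic' Oc' Oq' wP wG → Bool) :
    Function.extend (stepSnd Ic Iq Γ K R Ic' Oc' Oq' wP wG) a s =
      Sum.elim (fun i => s (.inl i)) (Sum.elim
        (Sum.elim (Sum.elim (fun y => s (.inr (.inl (.inl (.inl y))))) fun o => a (.inr (.inl (.inl o))))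
          (Sum.elim (fun u => a (.inr (.inl (.inr u)))) fun r => s (.inr (.inl (.inr (.inr r))))))
        (Sum.elim (fun w => s (.inr (.inr (.inl w))))
          (Sum.elim (fun j => a (.inl (.inl j)))
            (Sum.elim (fun k => a (.inl (.inr k))) fun w => a (.inr (.inr w)))))) := by
  ext w
  have hin := (stepSnd Ic Iq Γ K R Ic' Oc' Oq' wP wG).injective.extend_apply a s
  have hout := fun b h => Function.extend_apply' (f := stepSnd Ic Iq Γ K R Ic' Oc' Oq' wP wG) a s b h
  rcases w with i | ((y | o) | (u | r)) | (w | j | k | w)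
  · exact hout _ (by rintro ⟨((i | k) | (y | u) | a), h⟩ <;> cases h)
  · exact hout _ (by rintro ⟨((i | k) | (y | u) | a), h⟩ <;> cases h)
  · exact hin (.inr (.inl (.inl o)))
  · exact hin (.inr (.inl (.inr u)))
  · exact hout _ (by rintro ⟨((i | k) | (y | u) | a), h⟩ <;> cases h)
  · exact hout _ (by rintro ⟨((i | k) | (y | u) | a), h⟩ <;> cases h)
  · exact hin (.inl (.inl j))
  · exact hin (.inl (.inr k))
  · exact hin (.inr (.inr w))

theorem flipAll_step (f : Ic' → Γ) (s : StepWires Ic Iq Γ K R Ic' Oc' Oq' wP wG → Bool) :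
    flipAll (fun j : Ic' => (.inr (.inr (.inr (.inl j))) : StepWires Ic Iq Γ K R Ic' Oc' Oq' wP wG))
        (fun j s => s (.inr (.inl (.inl (.inl (f j)))))) s =
      Sum.elim (fun i => s (.inl i)) (Sum.elim (fun o => s (.inr (.inl o)))
        (Sum.elim (fun w => s (.inr (.inr (.inl w))))
          (Sum.elim (fun j => xor (s (.inr (.inr (.inr (.inl j)))))
              (s (.inr (.inl (.inl (.inl (f j)))))))
            (fun w => s (.inr (.inr (.inr (.inr w)))))))) := by
  let t : Ic' ↪ StepWires Ic Iq Γ K R Ic' Oc' Oq' wP wG :=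
    ⟨fun j => .inr (.inr (.inr (.inl j))), fun _ _ h => by simpa using h⟩
  ext w
  rcases w with i | o | w | j | w
  · exact flipAll_other _ _ _ _ (by simp)
  · exact flipAll_other _ _ _ _ (by simp)
  · exact flipAll_other _ _ _ _ (by simp)
  · exact flipAll_target t _ _ j
  · exact flipAll_other _ _ _ _ (by simp)

end

/-- Before `G` starts, its output wires are still zero and its work wires still hold its advice.
Measuring `Γ` makes row and column agree there, and copying turns the zeros on the classical input
wires of `G` into `y ∘ f`. Hence the block seen by `G` is a legitimate initial operator, with
quantum input the `(r, r')` block of the output of `P`. The operator on `K` need not be a state,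
which is why the identity is stated for instruments on arbitrary operators. -/
theorem instrument_step (P : QAlg Ic Iq Γ (K ⊕ R)) (G : QAlg Ic' K Oc' Oq') (f : Ic' → Γ)
    (x : Ic → Bool) (ρ : Op Iq) (y : Γ → Bool) (y' : Oc' → Bool) (u u' : Oq' → Bool)
    (r r' : R → Bool) :
    (P.step G f).instrument x ρ (Sum.elim y y') (Sum.elim u r) (Sum.elim u' r') =
      G.instrument (y ∘ f) (Matrix.of fun k k' =>
        P.instrument x ρ y (Sum.elim k r) (Sum.elim k' r')) y' u u' := by
  obtain ⟨wP, advP, CP⟩ := P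
  obtain ⟨wG, advG, CG⟩ := G
  rw [step, instrument_ofWork]
  dsimp only
  -- The discarded wires of `P` contribute a sum. By linearity of the instrument of `G` this sum can
  -- be matched term by term with the sum over discarded wires of the composition.
  have hR : (Matrix.of fun k k' => (QAlg.mk wP advP CP).instrument x ρ y (Sum.elim k r) (Sum.elim k' r')) =
      ∑ i : Ic → Bool, ∑ q : Iq → Bool, ∑ a : Fin wP → Bool, Matrix.of fun k k' =>
        runCircuit CP (initialOf advP x ρ) (wiresOf i q y (Sum.elim k r) a)
          (wiresOf i q y (Sum.elim k' r') a) := by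
    ext k k'
    simp only [of_apply, instrument_mk, Matrix.sum_apply]
  rw [hR, ← instrumentL_apply]
  simp only [map_sum, Matrix.sum_apply, instrumentL_apply]
  refine Finset.sum_congr rfl fun i _ => Finset.sum_congr rfl fun q _ => ?_
  rw [sum_sumElim]
  refine Finset.sum_congr rfl fun a _ => ?_
  rw [sum_sumElim, instrument_mk]
  refine Finset.sum_congr rfl fun i' _ => ?_
  rw [sum_sumElim]
  refine Finset.sum_congr rfl fun k _ => Finset.sum_congr rfl fun a' _ => ?_
  let tgt : Ic' ↪ StepWires Ic Iq Γ K R Ic' Oc' Oq' wP wG :=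
    ⟨fun j => .inr (.inr (.inr (.inl j))), fun _ _ h => by simpa using h⟩
  set ρ₁ := runCircuit CP (initialOf advP x ρ) with hρ₁
  set ρ₀ : Op (StepWires Ic Iq Γ K R Ic' Oc' Oq' wP wG) :=
    initialOf (advP.prod ((State.ket fun _ : Ic' => false).prod
      ((State.ket fun _ : K => false).prod advG))) x ρ with hρ₀
  have h1 : ∀ s t, runCircuit (CP.map (Gate.map (stepFst Ic Iq Γ K R Ic' Oc' Oq' wP wG))) ρ₀ s t =
      if ((∀ o, s (.inr (.inl (.inl (.inr o)))) = false) ∧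
          (∀ o, s (.inr (.inl (.inr (.inl o)))) = false) ∧
          (∀ j, s (.inr (.inr (.inr (.inl j)))) = false)) ∧
          (∀ o, t (.inr (.inl (.inl (.inr o)))) = false) ∧
          (∀ o, t (.inr (.inl (.inr (.inl o)))) = false) ∧
          (∀ j, t (.inr (.inr (.inr (.inl j)))) = false) then
        advG.op (fun w => s (.inr (.inr (.inr (.inr (.inr w))))))
          (fun w => t (.inr (.inr (.inr (.inr (.inr w)))))) *
        ρ₁ (s ∘ stepFst Ic Iq Γ K R Ic' Oc' Oq' wP wG)
          (t ∘ stepFst Ic Iq Γ K R Ic' Oc' Oq' wP wG) else 0 := by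
    intro s t
    have hb : block (stepFst Ic Iq Γ K R Ic' Oc' Oq' wP wG) ρ₀ s t =
        (if ((∀ o, s (.inr (.inl (.inl (.inr o)))) = false) ∧
          (∀ o, s (.inr (.inl (.inr (.inl o)))) = false) ∧
          (∀ j, s (.inr (.inr (.inr (.inl j)))) = false)) ∧
          (∀ o, t (.inr (.inl (.inl (.inr o)))) = false) ∧
          (∀ o, t (.inr (.inl (.inr (.inl o)))) = false) ∧
          (∀ j, t (.inr (.inr (.inr (.inl j)))) = false) then
        advG.op (fun w => s (.inr (.inr (.inr (.inr (.inr w))))))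
          (fun w => t (.inr (.inr (.inr (.inr (.inr w)))))) else 0) • initialOf advP x ρ := by
      ext a b
      simp only [block, of_apply, extend_stepFst, hρ₀, initialOf, State.prod, State.ket_op_apply,
        funext_iff, Function.comp_apply, Sum.forall, Sum.elim_inl, Sum.elim_inr, Matrix.smul_apply,
        smul_eq_mul]
      exact ite_mul_ite_mul_ite _ _ _ (by tauto)
    rw [runCircuit_map, hb, runCircuit_smul, Matrix.smul_apply, smul_eq_mul, ite_mul, zero_mul]
  rw [runCircuit_append, runCircuit_append, runCircuit_append, runCircuit_map]
  obtain ⟨ρ₃, hρ₃⟩ : ∃ ρ₃, runCircuit (copyAll (fun j : Ic' =>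
      (.inr (.inl (.inl (.inl (f j)))) : StepWires Ic Iq Γ K R Ic' Oc' Oq' wP wG)) tgt (fun _ _ h => by cases h))
      (runCircuit (measureAll fun y : Γ => .inr (.inl (.inl (.inl y))))
        (runCircuit (CP.map (Gate.map (stepFst Ic Iq Γ K R Ic' Oc' Oq' wP wG))) ρ₀)) = ρ₃ := ⟨_, rfl⟩
  change runCircuit CG (block (stepSnd Ic Iq Γ K R Ic' Oc' Oq' wP wG) (runCircuit (copyAll (fun j : Ic' =>
      (.inr (.inl (.inl (.inl (f j)))) : StepWires Ic Iq Γ K R Ic' Oc' Oq' wP wG)) tgt _)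
      (runCircuit (measureAll fun y : Γ => .inr (.inl (.inl (.inl y))))
        (runCircuit (CP.map (Gate.map (stepFst Ic Iq Γ K R Ic' Oc' Oq' wP wG))) ρ₀))) _ _) _ _ = _
  rw [hρ₃]
  -- Copying is an involution on basis strings; evaluating at flipped indices removes it and leaves
  -- only the effect of the measurement.
  have h3 : ∀ s t, ρ₃ (flipAll tgt (fun j s => s (.inr (.inl (.inl (.inl (f j)))))) s)
      (flipAll tgt (fun j s => s (.inr (.inl (.inl (.inl (f j)))))) t) =
      if (fun y : Γ => s (.inr (.inl (.inl (.inl y))))) = fun y => t (.inr (.inl (.inl (.inl y)))) then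
        runCircuit (CP.map (Gate.map (stepFst Ic Iq Γ K R Ic' Oc' Oq' wP wG))) ρ₀ s t else 0 := by
    intro s t
    have hc := runCircuit_copyAll (fun j : Ic' =>
      (.inr (.inl (.inl (.inl (f j)))) : StepWires Ic Iq Γ K R Ic' Oc' Oq' wP wG)) tgt (fun _ _ h => by cases h)
      (runCircuit (measureAll fun y : Γ => .inr (.inl (.inl (.inl y))))
        (runCircuit (CP.map (Gate.map (stepFst Ic Iq Γ K R Ic' Oc' Oq' wP wG))) ρ₀))
    rw [← hρ₃]
    refine (congrFun (congrFun hc _) _).trans ?_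
    rw [submatrix_apply]
    have hinv : ∀ s, flipAll tgt (fun j s => s (.inr (.inl (.inl (.inl (f j))))))
        (flipAll tgt (fun j s => s (.inr (.inl (.inl (.inl (f j)))))) s) = s := by
      intro s
      have := flipAll_step (K := K) (wP := wP) (wG := wG) (Iq := Iq) (Ic := Ic) (Oc' := Oc')
        (R := R) (Oq' := Oq') f
      change ∀ s, flipAll tgt _ s = _ at this
      rw [this, this]
      ext w
      rcases w with i | o | w | j | w <;> simp
    rw [hinv, hinv, runCircuit_measureAll]
    rfl
  have hM : ∀ s t, (∀ j, s (.inr (.inl (.inl (.inl j)))) = y j) →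
      (∀ j, t (.inr (.inl (.inl (.inl j)))) = y j) →
      block (stepSnd Ic Iq Γ K R Ic' Oc' Oq' wP wG) ρ₃ s t = initialOf advG (y ∘ f)
        (Matrix.of fun k k' => ρ₁
          (wiresOf (fun i => s (.inl (.inl i))) (fun i => s (.inl (.inr i))) y
            (Sum.elim k fun r => s (.inr (.inl (.inr (.inr r))))) fun w => s (.inr (.inr (.inl w))))
          (wiresOf (fun i => t (.inl (.inl i))) (fun i => t (.inl (.inr i))) y
            (Sum.elim k' fun r => t (.inr (.inl (.inr (.inr r)))))
            fun w => t (.inr (.inr (.inl w))))) := by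
    intro s t hs ht
    ext a b
    -- Undoing the copy puts `a j xor y (f j)` on the classical input wires of `G`. These wires
    -- started at zero, so only the entries with `a j = y (f j)` survive.
    have hpre : ∀ (s : StepWires Ic Iq Γ K R Ic' Oc' Oq' wP wG → Bool)
        (a : (Ic' ⊕ K) ⊕ (Oc' ⊕ Oq') ⊕ Fin wG → Bool),
        (∀ j, s (.inr (.inl (.inl (.inl j)))) = y j) →
        Function.extend (stepSnd Ic Iq Γ K R Ic' Oc' Oq' wP wG) a s =
          flipAll tgt (fun j s => s (.inr (.inl (.inl (.inl (f j)))))) (Sum.elim (fun i => s (.inl i))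
            (Sum.elim (Sum.elim (Sum.elim y fun o => a (.inr (.inl (.inl o))))
              (Sum.elim (fun u => a (.inr (.inl (.inr u)))) fun r => s (.inr (.inl (.inr (.inr r))))))
              (Sum.elim (fun w => s (.inr (.inr (.inl w))))
                (Sum.elim (fun j => xor (a (.inl (.inl j))) (y (f j)))
                  (Sum.elim (fun k => a (.inl (.inr k))) fun w => a (.inr (.inr w))))))) := by
      intro s a hs
      have := flipAll_step (K := K) (wP := wP) (wG := wG) (Iq := Iq) (Ic := Ic) (Oc' := Oc')
        (R := R) (Oq' := Oq') f
      change ∀ s, flipAll tgt _ s = _ at this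
      rw [this, extend_stepSnd]
      ext w
      rcases w with i | ((y | o) | (u | r)) | (w | j | k | w) <;> simp [hs]
    have hfst : ∀ (s : StepWires Ic Iq Γ K R Ic' Oc' Oq' wP wG → Bool)
        (a : (Ic' ⊕ K) ⊕ (Oc' ⊕ Oq') ⊕ Fin wG → Bool),
        (Sum.elim (fun i => s (.inl i))
            (Sum.elim (Sum.elim (Sum.elim y fun o => a (.inr (.inl (.inl o))))
              (Sum.elim (fun u => a (.inr (.inl (.inr u)))) fun r => s (.inr (.inl (.inr (.inr r))))))
              (Sum.elim (fun w => s (.inr (.inr (.inl w))))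
                (Sum.elim (fun j => xor (a (.inl (.inl j))) (y (f j)))
                  (Sum.elim (fun k => a (.inl (.inr k))) fun w => a (.inr (.inr w))))))) ∘
            stepFst Ic Iq Γ K R Ic' Oc' Oq' wP wG =
          wiresOf (fun i => s (.inl (.inl i))) (fun i => s (.inl (.inr i))) y
            (Sum.elim (fun k => a (.inl (.inr k))) fun r => s (.inr (.inl (.inr (.inr r)))))
            fun w => s (.inr (.inr (.inl w))) := by
      intro s a
      ext w
      rcases w with (i | i) | (y | (k | r)) | w <;> rfl
    have hxor : ∀ a b : Bool, (a ^^ b) = false ↔ a = b := by decide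
    rw [block, of_apply, hpre s a hs, hpre t b ht, h3, h1, hfst, hfst]
    simp only [Sum.elim_inl, Sum.elim_inr, if_true, initialOf, of_apply, Function.comp_apply,
      Sum.forall, hxor]
    rw [mul_comm]
    congr 1
    exact propext (by tauto)
  rw [hM _ _ (fun _ => rfl) fun _ => rfl]
  congr 1 <;>
  · ext w
    rcases w with (i | i) | (o | u) | w <;> rfl

end Step

end QAlg

end CertDel

/-! ### Selecting outputs, preparing inputs and computing bits. -/

namespace CertDel

open Matrix
open scoped ComplexOrder Kronecker

namespace QAlg

variable {Ic Iq Oc Oq : Type}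
  [Fintype Ic] [DecidableEq Ic] [Fintype Iq] [DecidableEq Iq]
  [Fintype Oc] [DecidableEq Oc] [Fintype Oq] [DecidableEq Oq]

theorem xor_eq_false (a b : Bool) : (a ^^ b) = false ↔ a = b := by
  revert a b; decide

theorem ite_mul_ite_mul {A B D E : Prop} [Decidable A] [Decidable B] [Decidable D] [Decidable E]
    (r g : ℂ) (h : A ∧ B ↔ D ∧ E) :
    (if A then r * ((if B then 1 else 0) * g) else 0) =
      (if D then 1 else 0) * if E then r * g else 0 := by
  by_cases hA : A <;> by_cases hB : B <;> by_cases hD : D <;> by_cases hE : E <;>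
    simp only [hA, hB, hD, hE, if_true, if_false] <;> first | ring1 | (exfalso; tauto)

/-! ### Selecting the output -/

section Finish

variable {Γ Q K : Type} [Fintype Γ] [DecidableEq Γ] [Fintype Q] [DecidableEq Q]
  [Fintype K] [DecidableEq K]

/-- The wires of an algorithm whose classical output wires become work wires. -/
def finishEmb (Ic Iq Oc Γ Q K : Type) (w : ℕ) :
    (Ic ⊕ Iq) ⊕ (Γ ⊕ Q) ⊕ Fin w ↪ (Ic ⊕ Iq) ⊕ (Oc ⊕ (Q ⊕ K)) ⊕ (Γ ⊕ Fin w) where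
  toFun
    | .inl i => .inl i
    | .inr (.inl (.inl y)) => .inr (.inr (.inl y))
    | .inr (.inl (.inr q)) => .inr (.inl (.inr (.inl q)))
    | .inr (.inr a) => .inr (.inr (.inr a))
  inj' := by
    rintro (i | (y | q) | a) (i' | (y' | q') | a') h <;> simp_all

/-- The wires that receive the selected output bits. -/
def finishTarget (Ic Iq Oc Γ Q K : Type) (w : ℕ) :
    Oc ⊕ K ↪ (Ic ⊕ Iq) ⊕ (Oc ⊕ (Q ⊕ K)) ⊕ (Γ ⊕ Fin w) where
  toFun
    | .inl o => .inr (.inl (.inl o))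
    | .inr k => .inr (.inl (.inr (.inr k)))
  inj' := by
    rintro (o | k) (o' | k') h <;> simp_all

/-- Run `P`, output the bits `g` of its classical output, store the bits `h` of its classical output
in the quantum output, and discard the rest of the classical output. -/
noncomputable def finish (P : QAlg Ic Iq Γ Q) (g : Oc → Γ) (h : K → Γ) : QAlg Ic Iq Oc (Q ⊕ K) :=
  ofWork ((State.ket fun _ : Γ => false).prod P.advice)
    (P.circuit.map (Gate.map (finishEmb Ic Iq Oc Γ Q K P.work)) ++
      copyAll (fun j => .inr (.inr (.inl (Sum.elim g h j)))) (finishTarget Ic Iq Oc Γ Q K P.work)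
        (by rintro j (j' | j') h <;> cases h))

theorem size_finish_le (P : QAlg Ic Iq Γ Q) (g : Oc → Γ) (h : K → Γ) :
    (P.finish g h).size ≤ P.size + 2 * Fintype.card Oc + 2 * Fintype.card K := by
  rw [finish, size_ofWork]
  simp only [size, List.length_append, List.length_map,
    length_copyAll, Fintype.card_sum, Fintype.card_fin]
  omega

theorem extend_finishEmb {w : ℕ} (a : (Ic ⊕ Iq) ⊕ (Γ ⊕ Q) ⊕ Fin w → Bool)
    (s : (Ic ⊕ Iq) ⊕ (Oc ⊕ (Q ⊕ K)) ⊕ (Γ ⊕ Fin w) → Bool) :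
    Function.extend (finishEmb Ic Iq Oc Γ Q K w) a s =
      Sum.elim (fun i => a (.inl i)) (Sum.elim
        (Sum.elim (fun o => s (.inr (.inl (.inl o))))
          (Sum.elim (fun q => a (.inr (.inl (.inr q)))) fun k => s (.inr (.inl (.inr (.inr k))))))
        (Sum.elim (fun y => a (.inr (.inl (.inl y)))) fun w => a (.inr (.inr w)))) := by
  ext w'
  have hin := (finishEmb Ic Iq Oc Γ Q K w).injective.extend_apply a s
  have hout := fun b h => Function.extend_apply' (f := finishEmb Ic Iq Oc Γ Q K w) a s b h
  rcases w' with i | (o | (q | k)) | (y | w')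
  · exact hin (.inl i)
  · exact hout _ (by rintro ⟨(i | (y | q) | a), h⟩ <;> cases h)
  · exact hin (.inr (.inl (.inr q)))
  · exact hout _ (by rintro ⟨(i | (y | q) | a), h⟩ <;> cases h)
  · exact hin (.inr (.inl (.inl y)))
  · exact hin (.inr (.inr w'))

/-- The old classical outputs `γ` become discarded work wires. Discarding sums over equal row and
column values, so no separate measurement is needed. The copied bits must equal `γ ∘ g` and `γ ∘ h`
because their targets started at zero. -/
theorem instrument_finish (P : QAlg Ic Iq Γ Q) (g : Oc → Γ) (h : K → Γ) (x : Ic → Bool)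
    (ρ : Op Iq) (y : Oc → Bool) (v v' : Q → Bool) (z z' : K → Bool) :
    (P.finish g h).instrument x ρ y (Sum.elim v z) (Sum.elim v' z') =
      ∑ γ : Γ → Bool, if y = γ ∘ g ∧ z = γ ∘ h ∧ z' = γ ∘ h then P.instrument x ρ γ v v' else 0 := by
  obtain ⟨wP, advP, CP⟩ := P
  rw [finish, instrument_ofWork]
  dsimp only
  set ρ₀ : Op ((Ic ⊕ Iq) ⊕ (Oc ⊕ (Q ⊕ K)) ⊕ (Γ ⊕ Fin wP)) :=
    initialOf ((State.ket fun _ : Γ => false).prod advP) x ρ with hρ₀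
  have h1 : ∀ s t, runCircuit (CP.map (Gate.map (finishEmb Ic Iq Oc Γ Q K wP))) ρ₀ s t =
      if ((∀ o, s (.inr (.inl (.inl o))) = false) ∧ ∀ k, s (.inr (.inl (.inr (.inr k)))) = false) ∧
        (∀ o, t (.inr (.inl (.inl o))) = false) ∧ ∀ k, t (.inr (.inl (.inr (.inr k)))) = false then
        runCircuit CP (initialOf advP x ρ) (s ∘ finishEmb Ic Iq Oc Γ Q K wP)
          (t ∘ finishEmb Ic Iq Oc Γ Q K wP) else 0 := by
    intro s t
    have hb : block (finishEmb Ic Iq Oc Γ Q K wP) ρ₀ s t =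
        (if ((∀ o, s (.inr (.inl (.inl o))) = false) ∧
            ∀ k, s (.inr (.inl (.inr (.inr k)))) = false) ∧
          (∀ o, t (.inr (.inl (.inl o))) = false) ∧
            ∀ k, t (.inr (.inl (.inr (.inr k)))) = false then (1 : ℂ) else 0) •
          initialOf advP x ρ := by
      ext a b
      simp only [block, of_apply, extend_finishEmb, hρ₀, initialOf, State.prod, State.ket_op_apply,
        funext_iff, Function.comp_apply, Sum.forall, Sum.elim_inl, Sum.elim_inr, Matrix.smul_apply,
        smul_eq_mul]
      exact ite_mul_ite_mul _ _ (by tauto)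
    rw [runCircuit_map, hb, runCircuit_smul, Matrix.smul_apply, smul_eq_mul, ite_mul, zero_mul,
      one_mul]
  have hc := fun ρ : Op ((Ic ⊕ Iq) ⊕ (Oc ⊕ (Q ⊕ K)) ⊕ (Γ ⊕ Fin wP)) =>
    runCircuit_copyAll (fun j => (.inr (.inr (.inl (Sum.elim g h j))) :
      (Ic ⊕ Iq) ⊕ (Oc ⊕ (Q ⊕ K)) ⊕ (Γ ⊕ Fin wP)))
      (finishTarget Ic Iq Oc Γ Q K wP) (by rintro j (j' | j') h <;> cases h) ρ
  have hf : ∀ (i : Ic → Bool) (q : Iq → Bool) (v : Q → Bool) (z : K → Bool) (γ : Γ → Bool)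
      (a : Fin wP → Bool), flipAll (finishTarget Ic Iq Oc Γ Q K wP)
        (fun j s => s (.inr (.inr (.inl (Sum.elim g h j)))))
        (wiresOf i q y (Sum.elim v z) (Sum.elim γ a)) =
      wiresOf i q (fun o => y o ^^ γ (g o)) (Sum.elim v fun k => z k ^^ γ (h k)) (Sum.elim γ a) := by
    intro i q v z γ a
    ext w
    rcases w with i | (o | (q | k)) | (y | w)
    · exact flipAll_other _ _ _ _ (by rintro (j | j) h <;> cases h)
    · exact flipAll_target (finishTarget Ic Iq Oc Γ Q K wP) _ _ (.inl o)
    · exact flipAll_other _ _ _ _ (by rintro (j | j) h <;> cases h)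
    · exact flipAll_target (finishTarget Ic Iq Oc Γ Q K wP) _ _ (.inr k)
    · exact flipAll_other _ _ _ _ (by rintro (j | j) h <;> cases h)
    · exact flipAll_other _ _ _ _ (by rintro (j | j) h <;> cases h)
  have he : ∀ (i : Ic → Bool) (q : Iq → Bool) (y : Oc → Bool) (v : Q → Bool) (z : K → Bool)
      (γ : Γ → Bool) (a : Fin wP → Bool),
      wiresOf i q y (Sum.elim v z) (Sum.elim γ a) ∘ finishEmb Ic Iq Oc Γ Q K wP =
        wiresOf i q γ v a := by
    intro i q y v z γ a
    ext w
    rcases w with (i | i) | (y | q) | w <;> rfl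
  have hR : ∀ γ : Γ → Bool, (if y = γ ∘ g ∧ z = γ ∘ h ∧ z' = γ ∘ h then
      (QAlg.mk wP advP CP).instrument x ρ γ v v' else 0) =
      ∑ i : Ic → Bool, ∑ q : Iq → Bool, ∑ a : Fin wP → Bool,
        if y = γ ∘ g ∧ z = γ ∘ h ∧ z' = γ ∘ h then runCircuit CP (initialOf advP x ρ)
          (wiresOf i q γ v a) (wiresOf i q γ v' a) else 0 := by
    intro γ
    split_ifs
    · exact instrument_mk _ _ _ _ _ _ _ _
    · simp
  simp only [hR, sum_sumElim]
  refine Eq.trans (Finset.sum_congr rfl fun i _ => ?_) Finset.sum_comm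
  refine Eq.trans ?_ Finset.sum_comm
  refine Finset.sum_congr rfl fun q _ => Finset.sum_congr rfl fun γ _ =>
    Finset.sum_congr rfl fun a _ => ?_
  rw [runCircuit_append, hc, submatrix_apply, hf, hf, h1, he, he]
  simp only [wiresOf, Sum.elim_inl, Sum.elim_inr, xor_eq_false]
  congr 1
  simp only [funext_iff, Function.comp_apply]
  exact propext (by tauto)

end Finish

/-! ### Copying and moving the input to the output -/

section Start

variable {A K B : Type} [Fintype A] [DecidableEq A] [Fintype K] [DecidableEq K] [Fintype B]
  [DecidableEq B]

/-- The wires that `start` copies. -/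
def startSource (Ic A K B : Type) :
    (Ic ⊕ K) ⊕ (A ⊕ B) ↪ (Ic ⊕ (A ⊕ K)) ⊕ ((Ic ⊕ K) ⊕ (A ⊕ B)) ⊕ B where
  toFun
    | .inl (.inl i) => .inl (.inl i)
    | .inl (.inr k) => .inl (.inr (.inr k))
    | .inr (.inl a) => .inl (.inr (.inl a))
    | .inr (.inr b) => .inr (.inr b)
  inj' := by
    rintro ((i | k) | (a | b)) ((i' | k') | (a' | b')) h <;> simp_all

/-- Output the classical input and the result of measuring the input wires `K`, and move the input
wires `A` and the advice `st` to the quantum output. -/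
noncomputable def start (Ic A K : Type) [Fintype Ic] [DecidableEq Ic] [Fintype A] [DecidableEq A]
    [Fintype K] [DecidableEq K] (st : State B) : QAlg Ic (A ⊕ K) (Ic ⊕ K) (A ⊕ B) :=
  ofWork st
    (copyAll (startSource Ic A K B) (fun j => .inr (.inl j))
        (by rintro ((i | k) | (a | b)) j h <;> cases h) ++
      copyAll (fun j : A ⊕ B => .inr (.inl (.inr j))) (fun j => startSource Ic A K B (.inr j))
        (by rintro j (a | b) h <;> cases h))

theorem size_start_le (st : State B) : (start Ic A K st).size ≤
    3 * Fintype.card Ic + 4 * Fintype.card A + 3 * Fintype.card K + 4 * Fintype.card B := by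
  rw [start, size_ofWork]
  simp only [List.length_append, length_copyAll, Fintype.card_sum]
  omega

/-- The second round of copying resets the sources `A` and `B` to zero, so their contents are moved
to the output without leaving a trace on discarded wires. The sources `Ic` and `K` are not reset;
discarding them acts as a measurement, which is why row and column share the value `z`. -/
theorem instrument_start (st : State B) (x : Ic → Bool) (ρ : Op (A ⊕ K)) (x' : Ic → Bool)
    (z : K → Bool) (v v' : A → Bool) (u u' : B → Bool) :
    (start Ic A K st).instrument x ρ (Sum.elim x' z) (Sum.elim v u) (Sum.elim v' u') =
      if x' = x then ρ (Sum.elim v z) (Sum.elim v' z) * st.op u u' else 0 := by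
  rw [start, instrument_ofWork]
  let t₁ : (Ic ⊕ K) ⊕ (A ⊕ B) ↪ (Ic ⊕ (A ⊕ K)) ⊕ ((Ic ⊕ K) ⊕ (A ⊕ B)) ⊕ B :=
    ⟨fun j => .inr (.inl j), fun _ _ h => by simpa using h⟩
  let t₂ : A ⊕ B ↪ (Ic ⊕ (A ⊕ K)) ⊕ ((Ic ⊕ K) ⊕ (A ⊕ B)) ⊕ B :=
    ⟨fun j => startSource Ic A K B (.inr j), fun _ _ h => by simpa using h⟩
  have hc : ∀ ρ s t, runCircuit (copyAll (startSource Ic A K B) (fun j => .inr (.inl j))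
        (by rintro ((i | k) | (a | b)) j h <;> cases h) ++
      copyAll (fun j : A ⊕ B => .inr (.inl (.inr j))) (fun j => startSource Ic A K B (.inr j))
        (by rintro j (a | b) h <;> cases h)) ρ s t =
      ρ (flipAll t₁ (fun j s => s (startSource Ic A K B j))
          (flipAll t₂ (fun j s => s (.inr (.inl (.inr j)))) s))
        (flipAll t₁ (fun j s => s (startSource Ic A K B j))
          (flipAll t₂ (fun j s => s (.inr (.inl (.inr j)))) t)) := by
    intro ρ s t
    have h1 := runCircuit_copyAll (startSource Ic A K B) t₁
      (by rintro ((i | k) | (a | b)) j h <;> cases h) ρ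
    have h2 := runCircuit_copyAll (fun j : A ⊕ B =>
        (.inr (.inl (.inr j)) : (Ic ⊕ (A ⊕ K)) ⊕ ((Ic ⊕ K) ⊕ (A ⊕ B)) ⊕ B)) t₂
      (by rintro j (a | b) h <;> cases h) (ρ.submatrix
        (flipAll t₁ fun j s => s (startSource Ic A K B j))
        (flipAll t₁ fun j s => s (startSource Ic A K B j)))
    rw [runCircuit_append]
    refine (congrFun (congrFun ((congrArg _ h1).trans h2) s) t)
  have hf : ∀ (i : Ic → Bool) (q : A → Bool) (k : K → Bool) (v : A → Bool) (u a : B → Bool),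
      flipAll t₁ (fun j s => s (startSource Ic A K B j))
        (flipAll t₂ (fun j s => s (.inr (.inl (.inr j))))
          (wiresOf i (Sum.elim q k) (Sum.elim x' z) (Sum.elim v u) a)) =
      wiresOf i (Sum.elim (fun j => q j ^^ v j) k)
        (Sum.elim (fun j => x' j ^^ i j) (fun j => z j ^^ k j)) (Sum.elim q a)
        (fun j => a j ^^ u j) := by
    intro i q k v u c
    have h2 : flipAll t₂ (fun j s => s (.inr (.inl (.inr j))))
          (wiresOf i (Sum.elim q k) (Sum.elim x' z) (Sum.elim v u) c) =
        wiresOf i (Sum.elim (fun j => q j ^^ v j) k) (Sum.elim x' z) (Sum.elim v u)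
          (fun j => c j ^^ u j) := by
      ext w
      rcases w with (i | (a | k)) | ((i | k) | (a | b)) | b
      · exact flipAll_other _ _ _ _ (by rintro (a | b) h <;> cases h)
      · exact flipAll_target t₂ _ _ (.inl a)
      · exact flipAll_other _ _ _ _ (by rintro (a | b) h <;> cases h)
      · exact flipAll_other _ _ _ _ (by rintro (a | b) h <;> cases h)
      · exact flipAll_other _ _ _ _ (by rintro (a | b) h <;> cases h)
      · exact flipAll_other _ _ _ _ (by rintro (a | b) h <;> cases h)
      · exact flipAll_other _ _ _ _ (by rintro (a | b) h <;> cases h)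
      · exact flipAll_target t₂ _ _ (.inr b)
    rw [h2]
    ext w
    rcases w with (i | (a | k)) | o | b
    · exact flipAll_other _ _ _ _ (by rintro j h; cases h)
    · exact flipAll_other _ _ _ _ (by rintro j h; cases h)
    · exact flipAll_other _ _ _ _ (by rintro j h; cases h)
    · refine (flipAll_target t₁ _ _ o).trans ?_
      rcases o with (i | k) | (a | b)
      · rfl
      · rfl
      · change (v a ^^ (q a ^^ v a)) = q a
        cases v a <;> cases q a <;> rfl
      · change (u b ^^ (c b ^^ u b)) = c b
        cases u b <;> cases c b <;> rfl
    · exact flipAll_other _ _ _ _ (by rintro j h; cases h)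
  -- Exactly one term of the sum over discarded values can survive: the moved wires are zero, and
  -- the copied wires still hold `x` and `z`.
  have hterm : ∀ (i : Ic → Bool) (q : A → Bool) (k : K → Bool) (a : B → Bool),
      initialOf st x ρ
        (wiresOf i (Sum.elim (fun j => q j ^^ v j) k)
          (Sum.elim (fun j => x' j ^^ i j) (fun j => z j ^^ k j)) (Sum.elim q a)
          (fun j => a j ^^ u j))
        (wiresOf i (Sum.elim (fun j => q j ^^ v' j) k)
          (Sum.elim (fun j => x' j ^^ i j) (fun j => z j ^^ k j)) (Sum.elim q a)
          (fun j => a j ^^ u' j)) =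
      if a = fun _ => false then if k = z then if q = fun _ => false then if i = x then
        if x' = x then ρ (Sum.elim v z) (Sum.elim v' z) * st.op u u' else 0 else 0 else 0
        else 0 else 0 := by
    intro i q k a
    simp only [initialOf, of_apply, wiresOf, Sum.forall, Sum.elim_inl, Sum.elim_inr, xor_eq_false]
    by_cases h : a = (fun _ => false) ∧ k = z ∧ q = (fun _ => false) ∧ i = x
    · obtain ⟨rfl, rfl, rfl, rfl⟩ := h
      simp only [Bool.false_xor, and_true, true_and, and_self, if_true, implies_true,
        funext_iff]
    · rw [if_neg]
      · split_ifs with h1 h2 h3 h4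
        · exact (h ⟨h1, h2, h3, h4⟩).elim
        all_goals rfl
      · rintro ⟨⟨h1, ⟨h2, h3⟩, h4, h5⟩, -⟩
        exact h ⟨funext h5, funext fun j => (h3 j).symm, funext h4, funext h1⟩
  simp only [hc, sum_sumElim, hf, hterm, Finset.sum_ite_eq', Finset.mem_univ, if_true]

end Start

/-! ### Classical computations -/

section Compute

/-- The circuit `γ o` flips the output bit `o` if `φ x o` holds for the classical input `x`. -/
noncomputable def compute (γ : Oc → List (Gate ((Ic ⊕ Empty) ⊕ (Oc ⊕ Empty) ⊕ Empty))) :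
    QAlg Ic Empty Oc Empty :=
  ofWork (State.ket fun i => i.elim) (Finset.univ.toList.flatMap γ)

theorem size_compute_le (γ : Oc → List (Gate ((Ic ⊕ Empty) ⊕ (Oc ⊕ Empty) ⊕ Empty)))
    (h : ∀ o, (γ o).length ≤ 1) :
    (compute γ).size ≤ Fintype.card Ic + 2 * Fintype.card Oc := by
  have : (Finset.univ.toList.flatMap γ).length ≤ Fintype.card Oc := by
    rw [List.length_flatMap]
    refine (List.sum_le_card_nsmul _ 1 (by simpa using h)).trans (by simp)
  rw [compute, size_ofWork]
  simp only [Fintype.card_empty]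
  omega

theorem instrument_compute (γ : Oc → List (Gate ((Ic ⊕ Empty) ⊕ (Oc ⊕ Empty) ⊕ Empty)))
    (φ : (Ic → Bool) → Oc → Bool)
    (hγ : ∀ o ρ, runCircuit (γ o) ρ = ρ.submatrix
      (flipIf (.inr (.inl (.inl o))) fun s => φ (fun i => s (.inl (.inl i))) o)
      (flipIf (.inr (.inl (.inl o))) fun s => φ (fun i => s (.inl (.inl i))) o))
    (x : Ic → Bool) (ρ : Op Empty) (y : Oc → Bool) :
    (compute γ).instrument x ρ y = if y = φ x then ρ else 0 := by
  let t : Oc ↪ (Ic ⊕ Empty) ⊕ (Oc ⊕ Empty) ⊕ Empty :=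
    ⟨fun j => .inr (.inl (.inl j)), fun _ _ h => by simpa using h⟩
  have hc := runCircuit_flipAll t (fun o s => φ (fun i => s (.inl (.inl i))) o) γ hγ
    (fun j j' s v => by simp [t])
  have hf : ∀ (i : Ic → Bool) k u a,
      flipAll t (fun o s => φ (fun i => s (.inl (.inl i))) o) (wiresOf i k y u a) =
        wiresOf i k (fun o => y o ^^ φ i o) u a := by
    intro i k u a
    ext w
    rcases w with (i | i) | (o | i) | i
    · exact flipAll_other _ _ _ _ (by rintro j h; cases h)
    · exact i.elim
    · exact flipAll_target t _ _ o
    · exact i.elim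
    · exact i.elim
  ext u u'
  rw [compute, instrument_ofWork]
  simp only [hc, submatrix_apply, hf]
  have hterm : ∀ (i : Ic → Bool) k a, initialOf (State.ket fun i : Empty => i.elim) x ρ
      (wiresOf i k (fun o => y o ^^ φ i o) u a) (wiresOf i k (fun o => y o ^^ φ i o) u' a) =
      if i = x then if y = φ x then ρ u u' else 0 else 0 := by
    intro i k a
    simp only [initialOf, of_apply, wiresOf, Sum.forall, Sum.elim_inl, Sum.elim_inr, xor_eq_false,
      IsEmpty.forall_iff, and_true, and_self, State.ket_op_apply]
    have hu : ∀ u : Empty → Bool, (fun i => k i) = u := fun u => Subsingleton.elim _ _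
    have ha : (fun i => a i) = fun i : Empty => i.elim := Subsingleton.elim _ _
    obtain rfl : u' = u := Subsingleton.elim _ _
    simp only [hu u', ha, if_true, mul_one]
    by_cases hi : i = x
    · subst hi
      simp only [implies_true, true_and, if_true, funext_iff]
    · rw [if_neg hi, if_neg fun h => hi (funext h.1)]
  simp only [hterm]
  split_ifs <;> simp

end Compute

end QAlg

end CertDel

/-! ### From operators to experiments: linear continuations. -/

namespace CertDel

open Matrix
open scoped ComplexOrder Kronecker

/-! ## Experiments as linear functionals of the state -/

theorem eq_of_prob_eq {p q : PMF Bool} (h : prob p = prob q) : p = q := by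
  have ht : p true = q true :=
    (ENNReal.toReal_eq_toReal_iff' (p.apply_ne_top _) (q.apply_ne_top _)).mp h
  have hp := p.tsum_coe
  have hq := q.tsum_coe
  rw [tsum_fintype, Fintype.sum_bool] at hp hq
  ext b
  cases b
  · rw [ht] at hp
    exact (ENNReal.add_right_inj (q.apply_ne_top true)).mp (hp.trans hq.symm)
  · exact ht

theorem prob_bind {α : Type} [Fintype α] (p : PMF α) (f : α → PMF Bool) :
    prob (p >>= f) = ∑ a, (p a).toReal * prob (f a) := by
  change ((p.bind f) true).toReal = _
  rw [PMF.bind_apply, tsum_fintype, ENNReal.toReal_sum]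
  · simp [prob]
  · exact fun a _ => ENNReal.mul_ne_top (p.apply_ne_top a) ((f a).apply_ne_top _)

/-- The success probability of the experiment `f` is linear in the density operator. -/
def LinCont {W : Type} [Fintype W] [DecidableEq W] (f : State W → PMF Bool) : Prop :=
  ∃ g : Op W →ₗ[ℂ] ℂ, ∀ σ, (prob (f σ) : ℂ) = g σ.op

namespace QAlg

variable {Ic Iq Oc Oq : Type}
  [Fintype Ic] [DecidableEq Ic] [Fintype Iq] [DecidableEq Iq]
  [Fintype Oc] [DecidableEq Oc] [Fintype Oq] [DecidableEq Oq]

theorem outcome_toReal (F : QAlg Ic Iq Oc Oq) (x : Ic → Bool) (ρ : State Iq) (y : Oc → Bool) :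
    ((F.outcome x ρ y).toReal : ℂ) = (F.instrument x ρ.op y).trace := by
  have h := Complex.nonneg_iff.mp (F.instrument_posSemidef x ρ.psd y).trace_nonneg
  rw [outcome, PMF.ofFintype_apply, ENNReal.toReal_ofReal h.1]
  exact Complex.ext rfl h.2

theorem run_bind (F : QAlg Ic Iq Oc Oq) (x : Ic → Bool) (ρ : State Iq)
    (f : (Oc → Bool) × State Oq → PMF Bool) :
    (F.run x ρ >>= f) =
      (F.outcome x ρ >>= fun y => f (y, State.normalize (F.instrument x ρ.op y))) := by
  change (PMF.map _ _).bind _ = PMF.bind _ _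
  rw [PMF.bind_map]
  rfl

/-- The probability of `y` is the trace of the unnormalised output, so linearity of `g y` absorbs it
and the normalisation of the conditional state cancels. -/
theorem prob_run_bind (F : QAlg Ic Iq Oc Oq) (x : Ic → Bool) (ρ : State Iq)
    (f : (Oc → Bool) × State Oq → PMF Bool) (g : (Oc → Bool) → Op Oq →ₗ[ℂ] ℂ)
    (h : ∀ y σ, (prob (f (y, σ)) : ℂ) = g y σ.op) :
    (prob (F.run x ρ >>= f) : ℂ) = ∑ y, g y (F.instrument x ρ.op y) := by
  rw [run_bind, prob_bind, Complex.ofReal_sum]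
  refine Finset.sum_congr rfl fun y _ => ?_
  rw [Complex.ofReal_mul, outcome_toReal, h, ← smul_eq_mul, ← map_smul,
    State.trace_smul_normalize (F.instrument_posSemidef x ρ.psd y)]

theorem outcome_bind {β : Type} (F : QAlg Ic Iq Oc Oq) (x : Ic → Bool) (ρ : State Iq)
    (f : (Oc → Bool) → PMF β) :
    (F.outcome x ρ >>= f) = (F.run x ρ >>= fun p => f p.1) := by
  change PMF.bind _ _ = (PMF.map _ _).bind _
  rw [PMF.bind_map]
  rfl

end QAlg

namespace LinCont

variable {W : Type} [Fintype W] [DecidableEq W]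
variable {Ic Oc Oq : Type} [Fintype Ic] [DecidableEq Ic] [Fintype Oc] [DecidableEq Oc]
  [Fintype Oq] [DecidableEq Oq]

theorem const (p : PMF Bool) : LinCont fun _ : State W => p :=
  -- A constant becomes linear as a multiple of the trace, which equals one on states.
  ⟨(prob p : ℂ) • traceLinearMap _ ℂ ℂ, fun σ => by simp [σ.trace_eq_one]⟩

theorem bind {α : Type} [Fintype α] (p : PMF α) {f : α → State W → PMF Bool}
    (h : ∀ a, LinCont (f a)) : LinCont fun σ => p >>= fun a => f a σ := by
  choose g hg using h
  refine ⟨∑ a, ((p a).toReal : ℂ) • g a, fun σ => ?_⟩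
  simp [prob_bind, hg]

theorem run (F : QAlg Ic W Oc Oq) (x : Ic → Bool) {f : (Oc → Bool) × State Oq → PMF Bool}
    (h : ∀ y, LinCont fun σ => f (y, σ)) : LinCont fun σ => F.run x σ >>= f := by
  choose g hg using h
  refine ⟨∑ y, g y ∘ₗ F.instrumentL x y, fun σ => ?_⟩
  rw [F.prob_run_bind x σ f g hg]
  simp [QAlg.instrumentL_apply]

theorem outcome (F : QAlg Ic W Oc Oq) (x : Ic → Bool) (f : (Oc → Bool) → PMF Bool) :
    LinCont fun σ => F.outcome x σ >>= f := by
  simp only [QAlg.outcome_bind]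
  exact run F x fun y => const (f y)

end LinCont

/-! ## Composition of algorithms in experiments -/

namespace State

variable {A B C : Type} [Fintype A] [DecidableEq A] [Fintype B] [DecidableEq B]
  [Fintype C] [DecidableEq C]

theorem prod_ket_reindex_sumEmpty (σ : State A) (x : Empty → Bool) :
    (σ.prod (ket x)).reindex (Equiv.sumEmpty A Empty) = σ := by
  apply ext_op
  ext s t
  simp only [reindex, prod, submatrix_apply, of_apply, ket_op_apply]
  rw [if_pos ⟨Subsingleton.elim _ _, Subsingleton.elim _ _⟩, mul_one]
  rfl

/-- The linear map `M ↦ M ⊗ |z⟩⟨z|`. -/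
noncomputable def prodKetL (z : B → Bool) (e : A ⊕ B ≃ C) : Op A →ₗ[ℂ] Op C where
  toFun M := Matrix.of fun s t =>
    M (s ∘ e ∘ Sum.inl) (t ∘ e ∘ Sum.inl) * (ket z).op (s ∘ e ∘ Sum.inr) (t ∘ e ∘ Sum.inr)
  map_add' M N := by ext s t; simp [add_mul]
  map_smul' c M := by ext s t; simp [mul_assoc]

end State

namespace QAlg

variable {Ic Iq Oc Oq : Type}
  [Fintype Ic] [DecidableEq Ic] [Fintype Iq] [DecidableEq Iq]
  [Fintype Oc] [DecidableEq Oc] [Fintype Oq] [DecidableEq Oq]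
variable {Γ Q K Ic' Oc' Oq' : Type}
  [Fintype Γ] [DecidableEq Γ] [Fintype Q] [DecidableEq Q] [Fintype K] [DecidableEq K]
  [Fintype Ic'] [DecidableEq Ic'] [Fintype Oc'] [DecidableEq Oc'] [Fintype Oq'] [DecidableEq Oq']

/-- Run `P` and then `G` on the quantum output of `P`. -/
noncomputable def stepQ (P : QAlg Ic Iq Γ Q) (G : QAlg Ic' Q Oc' Oq') (f : Ic' → Γ) :
    QAlg Ic Iq (Γ ⊕ Oc') Oq' :=
  ((P.mapOut (Equiv.sumEmpty Q Empty).symm).step G f).mapOut (Equiv.sumEmpty Oq' Empty)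

/-- Run `P` and then the classical algorithm `G`. -/
noncomputable def stepC (P : QAlg Ic Iq Γ Q) (G : QAlg Ic' Empty Oc' Empty) (f : Ic' → Γ) :
    QAlg Ic Iq (Γ ⊕ Oc') Q :=
  ((P.mapOut (Equiv.emptySum Empty Q).symm).step G f).mapOut (Equiv.emptySum Empty Q)

theorem size_stepQ_le (P : QAlg Ic Iq Γ Q) (G : QAlg Ic' Q Oc' Oq') (f : Ic' → Γ) :
    (P.stepQ G f).size ≤ 2 * P.size + 2 * G.size := by
  rw [stepQ, size_mapOut]
  exact (size_step_le _ _ _).trans (by rw [size_mapOut])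

theorem size_stepC_le (P : QAlg Ic Iq Γ Q) (G : QAlg Ic' Empty Oc' Empty) (f : Ic' → Γ) :
    (P.stepC G f).size ≤ 2 * P.size + 2 * G.size := by
  rw [stepC, size_mapOut]
  exact (size_step_le _ _ _).trans (by rw [size_mapOut])

theorem instrument_stepQ (P : QAlg Ic Iq Γ Q) (G : QAlg Ic' Q Oc' Oq') (f : Ic' → Γ)
    (x : Ic → Bool) (ρ : Op Iq) (y : Γ → Bool) (y' : Oc' → Bool) :
    (P.stepQ G f).instrument x ρ (Sum.elim y y') =
      G.instrument (y ∘ f) (P.instrument x ρ y) y' := by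
  have hu : ∀ u : Oq' → Bool, u ∘ Equiv.sumEmpty Oq' Empty = Sum.elim u fun i => i.elim := by
    intro u; ext (i | i)
    · rfl
    · exact i.elim
  ext u u'
  rw [stepQ, instrument_mapOut, hu, hu, instrument_step]
  congr 2
  ext k k'
  rw [of_apply, instrument_mapOut]
  rfl

/-- With all of `Q` kept aside, the quantum input of `G` has no wires and is just a scalar, so `G`
contributes only the probability of its output. -/
theorem instrument_stepC (P : QAlg Ic Iq Γ Q) (G : QAlg Ic' Empty Oc' Empty) (f : Ic' → Γ)
    (x : Ic → Bool) (ρ : Op Iq) (y : Γ → Bool) (y' : Oc' → Bool) (z : Empty → Bool) :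
    (P.stepC G f).instrument x ρ (Sum.elim y y') =
      (G.instrument (y ∘ f) (State.ket z).op y').trace • P.instrument x ρ y := by
  have hu : ∀ u : Q → Bool, u ∘ Equiv.emptySum Empty Q = Sum.elim (fun i => i.elim) u := by
    intro u; ext (i | i)
    · exact i.elim
    · rfl
  ext u u'
  rw [stepC, instrument_mapOut, hu, hu, instrument_step]
  have hM : (Matrix.of fun k k' : Empty → Bool =>
      (P.mapOut (Equiv.emptySum Empty Q).symm).instrument x ρ y (Sum.elim k u) (Sum.elim k' u')) =
      P.instrument x ρ y u u' • (State.ket z).op := by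
    ext k k'
    rw [of_apply, instrument_mapOut, Matrix.smul_apply, State.ket_op_apply,
      if_pos ⟨Subsingleton.elim _ _, Subsingleton.elim _ _⟩, smul_eq_mul, mul_one]
    rfl
  rw [hM, ← instrumentL_apply, map_smul, Matrix.smul_apply, Matrix.smul_apply, smul_eq_mul,
    smul_eq_mul, mul_comm, instrumentL_apply]
  congr 1
  simp only [Matrix.trace, diag_apply, Fintype.sum_unique]
  congr 1 <;> exact Subsingleton.elim _ _

theorem run_stepQ (P : QAlg Ic Iq Γ Q) (G : QAlg Ic' Q Oc' Oq') (f : Ic' → Γ)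
    (x : Ic → Bool) (ρ : State Iq) (k : (Γ ⊕ Oc' → Bool) × State Oq' → PMF Bool)
    (hk : ∀ y, LinCont fun σ => k (y, σ)) :
    ((P.stepQ G f).run x ρ >>= k) =
      (P.run x ρ >>= fun p => G.run (p.1 ∘ f) p.2 >>= fun p' => k (Sum.elim p.1 p'.1, p'.2)) := by
  choose g hg using hk
  apply eq_of_prob_eq
  apply Complex.ofReal_injective
  rw [prob_run_bind _ _ _ _ g hg, prob_run_bind _ _ _ _ (fun y => ∑ y', g (Sum.elim y y') ∘ₗ
    G.instrumentL (y ∘ f) y'), sum_sumElim]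
  · simp only [instrument_stepQ, LinearMap.sum_apply, LinearMap.comp_apply, instrumentL_apply]
  · intro y σ
    rw [prob_run_bind _ _ _ _ (fun y' => g (Sum.elim y y')) (fun y' σ => hg _ _)]
    simp only [LinearMap.sum_apply, LinearMap.comp_apply, instrumentL_apply]

theorem run_stepC (P : QAlg Ic Iq Γ Q) (G : QAlg Ic' Empty Oc' Empty) (f : Ic' → Γ)
    (x : Ic → Bool) (ρ : State Iq) (z : State Empty) (k : (Γ ⊕ Oc' → Bool) × State Q → PMF Bool)
    (hk : ∀ y, LinCont fun σ => k (y, σ)) :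
    ((P.stepC G f).run x ρ >>= k) =
      (P.run x ρ >>= fun p => G.outcome (p.1 ∘ f) z >>= fun y' => k (Sum.elim p.1 y', p.2)) := by
  choose g hg using hk
  obtain rfl := State.eq_ket_of_isEmpty z fun i => i.elim
  apply eq_of_prob_eq
  apply Complex.ofReal_injective
  rw [prob_run_bind _ _ _ _ g hg, prob_run_bind _ _ _ _ (fun y => ∑ y',
    (G.instrument (y ∘ f) (State.ket fun i => i.elim).op y').trace • g (Sum.elim y y')), sum_sumElim]
  · simp only [instrument_stepC _ _ _ _ _ _ _ fun i => i.elim, LinearMap.sum_apply,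
      LinearMap.smul_apply, map_smul]
  · intro y σ
    simp only [prob_bind, Complex.ofReal_sum, Complex.ofReal_mul, outcome_toReal, hg,
      LinearMap.sum_apply, LinearMap.smul_apply, smul_eq_mul]

/-- Select the output of an algorithm, see `finish`. -/
noncomputable def finishTo (P : QAlg Ic Iq Γ Q) (g : Oc → Γ) (h : K → Γ) (e : Q ⊕ K ≃ Oq) :
    QAlg Ic Iq Oc Oq :=
  (P.finish g h).mapOut e

theorem size_finishTo_le (P : QAlg Ic Iq Γ Q) (g : Oc → Γ) (h : K → Γ) (e : Q ⊕ K ≃ Oq) :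
    (P.finishTo g h e).size ≤ P.size + 2 * Fintype.card Oc + 2 * Fintype.card K := by
  rw [finishTo, size_mapOut]
  exact size_finish_le _ _ _

theorem instrument_finishTo (P : QAlg Ic Iq Γ Q) (g : Oc → Γ) (h : K → Γ) (e : Q ⊕ K ≃ Oq)
    (x : Ic → Bool) (ρ : Op Iq) (y : Oc → Bool) :
    (P.finishTo g h e).instrument x ρ y =
      ∑ γ : Γ → Bool, if y = γ ∘ g then State.prodKetL (γ ∘ h) e (P.instrument x ρ γ) else 0 := by
  ext u u'
  have hu : ∀ u : Oq → Bool, u ∘ e = Sum.elim (u ∘ e ∘ Sum.inl) (u ∘ e ∘ Sum.inr) := by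
    intro u; ext (i | i) <;> rfl
  rw [finishTo, instrument_mapOut, hu, hu u', instrument_finish, Matrix.sum_apply]
  refine Finset.sum_congr rfl fun γ _ => ?_
  by_cases hy : y = γ ∘ g
  · simp only [State.prodKetL, State.ket_op_apply, hy, true_and, if_true, mul_ite, mul_one, mul_zero,
      LinearMap.coe_mk, AddHom.coe_mk, of_apply]
  · rw [if_neg hy, if_neg fun h => hy h.1]
    rfl

/-- The two sides may induce different distributions on states: the circuit discards part of the
outcome `γ` and holds an average, while the right side continues with each conditional state. A
continuation linear in the density operator cannot tell them apart, hence `hk`. -/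
theorem run_finishTo (P : QAlg Ic Iq Γ Q) (g : Oc → Γ) (h : K → Γ) (e : Q ⊕ K ≃ Oq)
    (x : Ic → Bool) (ρ : State Iq) (k : (Oc → Bool) × State Oq → PMF Bool)
    (hk : ∀ y, LinCont fun σ => k (y, σ)) :
    ((P.finishTo g h e).run x ρ >>= k) =
      (P.run x ρ >>= fun p => k (p.1 ∘ g, (p.2.prod (State.ket (p.1 ∘ h))).reindex e)) := by
  choose l hl using hk
  apply eq_of_prob_eq
  apply Complex.ofReal_injective
  rw [prob_run_bind _ _ _ _ l hl, prob_run_bind _ _ _ _ (fun γ => l (γ ∘ g) ∘ₗ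
    State.prodKetL (γ ∘ h) e)]
  · simp only [instrument_finishTo, map_sum, LinearMap.comp_apply]
    rw [Finset.sum_comm]
    refine Finset.sum_congr rfl fun γ _ => ?_
    rw [Finset.sum_eq_single (γ ∘ g) (fun y _ hy => by rw [if_neg hy, map_zero]) (by simp),
      if_pos rfl]
  · intro γ σ
    exact hl _ _

/-! ### Renaming the quantum input wires -/

/-- Rename the quantum input wires. -/
noncomputable def mapIn {Iq' : Type} (F : QAlg Ic Iq Oc Oq) (e : Iq ≃ Iq') : QAlg Ic Iq' Oc Oq where
  work := F.work
  advice := F.advice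
  circuit := F.circuit.map (Gate.map (Equiv.sumCongr (Equiv.sumCongr (Equiv.refl _) e)
    (Equiv.refl _)).toEmbedding)

theorem size_mapIn {Iq' : Type} [Fintype Iq'] (F : QAlg Ic Iq Oc Oq) (e : Iq ≃ Iq') :
    (F.mapIn e).size = F.size := by
  simp [size, mapIn, Fintype.card_congr e]

theorem instrument_mapIn {Iq' : Type} [Fintype Iq'] [DecidableEq Iq'] (F : QAlg Ic Iq Oc Oq)
    (e : Iq ≃ Iq') (x : Ic → Bool) (ρ : Op Iq) (y : Oc → Bool) :
    (F.mapIn e).instrument x (ρ.submatrix (fun b => b ∘ e) (fun b => b ∘ e)) y =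
      F.instrument x ρ y := by
  ext v v'
  obtain ⟨w, adv, C⟩ := F
  rw [mapIn, instrument_mk, instrument_mk]
  refine Finset.sum_congr rfl fun i _ => ?_
  rw [← sum_arrowCongr e.symm]
  refine Finset.sum_congr rfl fun k _ => Finset.sum_congr rfl fun a _ => ?_
  set E : (Ic ⊕ Iq) ⊕ (Oc ⊕ Oq) ⊕ Fin w ≃ (Ic ⊕ Iq') ⊕ (Oc ⊕ Oq) ⊕ Fin w :=
    Equiv.sumCongr (Equiv.sumCongr (Equiv.refl _) e) (Equiv.refl _)
    with hE
  have hw : ∀ u, wiresOf i (k ∘ e.symm) y u a ∘ E = wiresOf i k y u a := by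
    intro u
    ext w
    rcases w with (w | w) | (w | w) | w <;> simp [hE, wiresOf]
  have hb : ∀ s t, block E.toEmbedding
      (initialOf adv x (ρ.submatrix (fun b => b ∘ e) (fun b => b ∘ e))) s t = initialOf adv x ρ := by
    intro s t
    have hx : ∀ (b : (Ic ⊕ Iq) ⊕ (Oc ⊕ Oq) ⊕ Fin w → Bool) s w,
        Function.extend E.toEmbedding b s w = b (E.symm w) := by
      intro b s w
      obtain ⟨w, rfl⟩ := E.surjective w
      rw [E.symm_apply_apply]
      exact E.injective.extend_apply b s w
    ext b c
    simp only [block, of_apply, initialOf, hx, submatrix_apply]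
    have h1 : ∀ b : (Ic ⊕ Iq) ⊕ (Oc ⊕ Oq) ⊕ Fin w → Bool,
        (fun i => b (E.symm (Sum.inl (Sum.inr i)))) ∘ e = fun i => b (.inl (.inr i)) := fun b => by
      ext i
      exact congrArg b (E.symm_apply_apply (.inl (.inr i)))
    rw [h1, h1]
    rfl
  rw [runCircuit_map, hb, Equiv.coe_toEmbedding, hw, hw]

/-! ### Initial algorithms -/

/-- Output the classical input and the bits stored in the part `K` of the quantum input. -/
noncomputable def load (Ic : Type) [Fintype Ic] [DecidableEq Ic] (e : Q ⊕ K ≃ Iq) :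
    QAlg Ic Iq (Ic ⊕ K) Q :=
  ((start Ic Q K (State.ket fun i : Empty => i.elim)).mapOut (Equiv.sumEmpty Q Empty)).mapIn e

theorem size_load_le (e : Q ⊕ K ≃ Iq) : (load Ic e).size ≤
    3 * Fintype.card Ic + 4 * Fintype.card Iq := by
  rw [load, size_mapIn, size_mapOut, ← Fintype.card_congr e, Fintype.card_sum]
  refine (size_start_le _).trans ?_
  rw [Fintype.card_empty]
  omega

/-- The part `K` is in a basis state in product with `σ`, so measuring it returns `z` with certainty
and leaves `σ` undisturbed. -/
theorem run_load (e : Q ⊕ K ≃ Iq) (x : Ic → Bool) (σ : State Q) (z : K → Bool)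
    (k : (Ic ⊕ K → Bool) × State Q → PMF Bool) (hk : ∀ y, LinCont fun σ => k (y, σ)) :
    ((load Ic e).run x ((σ.prod (State.ket z)).reindex e) >>= k) = k (Sum.elim x z, σ) := by
  choose g hg using hk
  apply eq_of_prob_eq
  apply Complex.ofReal_injective
  have hi : ∀ x' z', (load Ic e).instrument x ((σ.prod (State.ket z)).reindex e).op
      (Sum.elim x' z') = if x' = x then if z' = z then σ.op else 0 else 0 := by
    intro x' z'
    ext v v'
    have hu : ∀ u : Q → Bool, u ∘ Equiv.sumEmpty Q Empty = Sum.elim u fun i => i.elim := by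
      intro u; ext (i | i)
      · rfl
      · exact i.elim
    rw [load, State.reindex]
    dsimp only
    have h0 : (State.ket fun i : Empty => i.elim).op (fun i => i.elim) (fun i => i.elim) = 1 := by
      rw [State.ket_op_apply, if_pos ⟨rfl, rfl⟩]
    rw [instrument_mapIn, instrument_mapOut, hu, hu, instrument_start, h0, mul_one]
    by_cases hx : x' = x
    · by_cases hz : z' = z
      · subst hx hz
        simp [State.prod, State.ket_op_apply]
      · simp [State.prod, State.ket_op_apply, hz]
    · simp [hx]
  rw [prob_run_bind _ _ _ _ g hg, sum_sumElim, hg]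
  simp only [hi]
  rw [Finset.sum_eq_single x, Finset.sum_eq_single z]
  · simp
  · intro z' _ hz; simp [hz]
  · simp
  · intro x' _ hx; simp [hx]
  · simp

/-- Output the classical input and the advice `st`. -/
noncomputable def adviceAlg (Ic : Type) [Fintype Ic] [DecidableEq Ic] (st : State Q) :
    QAlg Ic Empty (Ic ⊕ Empty) Q :=
  ((start Ic Empty Empty st).mapOut (Equiv.emptySum Empty Q)).mapIn (Equiv.sumEmpty Empty Empty)

theorem size_adviceAlg_le (st : State Q) : (adviceAlg Ic st).size ≤
    3 * Fintype.card Ic + 4 * Fintype.card Q := by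
  rw [adviceAlg, size_mapIn, size_mapOut]
  refine (size_start_le _).trans ?_
  rw [Fintype.card_empty]
  omega

theorem run_adviceAlg (st : State Q) (x : Ic → Bool) (z : State Empty)
    (k : (Ic ⊕ Empty → Bool) × State Q → PMF Bool) (hk : ∀ y, LinCont fun σ => k (y, σ)) :
    ((adviceAlg Ic st).run x z >>= k) = k (Sum.elim x fun i => i.elim, st) := by
  choose g hg using hk
  apply eq_of_prob_eq
  apply Complex.ofReal_injective
  have hi : ∀ x' z', (adviceAlg Ic st).instrument x z.op (Sum.elim x' z') =
      if x' = x then st.op else 0 := by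
    intro x' z'
    ext v v'
    have hu : ∀ u : Q → Bool, u ∘ Equiv.emptySum Empty Q = Sum.elim (fun i => i.elim) u := by
      intro u; ext (i | i)
      · exact i.elim
      · rfl
    -- There is only one state on no wires, so the input can be given the reindexed product form
    -- required by `instrument_mapIn`.
    have hz : z = (((State.ket fun i : Empty => i.elim).prod (State.ket fun i : Empty => i.elim)
        ).reindex (Equiv.sumEmpty Empty Empty)) :=
      (State.eq_ket_of_isEmpty _ fun i => i.elim).trans
        (State.eq_ket_of_isEmpty _ fun i => i.elim).symm
    rw [hz, adviceAlg, State.reindex]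
    dsimp only
    rw [instrument_mapIn, instrument_mapOut, hu, hu, instrument_start]
    by_cases hx : x' = x
    · subst hx
      rw [if_pos rfl, if_pos rfl]
      simp only [State.prod, of_apply, State.ket_op_apply]
      rw [if_pos ⟨Subsingleton.elim _ _, Subsingleton.elim _ _⟩,
        if_pos ⟨Subsingleton.elim _ _, Subsingleton.elim _ _⟩, one_mul, one_mul]
    · simp [hx]
  rw [prob_run_bind _ _ _ _ g hg, sum_sumElim, hg]
  simp only [hi]
  rw [Finset.sum_eq_single x, Finset.sum_eq_single fun i => i.elim]
  · simp
  · intro z' _ hz; exact (hz (Subsingleton.elim _ _)).elim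
  · exact fun h => (h (Finset.mem_univ _)).elim
  · intro x' _ hx; simp [hx]
  · simp

/-! ### Deterministic classical algorithms -/

theorem outcome_compute (γ : Oc → List (Gate ((Ic ⊕ Empty) ⊕ (Oc ⊕ Empty) ⊕ Empty)))
    (φ : (Ic → Bool) → Oc → Bool)
    (hγ : ∀ o ρ, runCircuit (γ o) ρ = ρ.submatrix
      (flipIf (.inr (.inl (.inl o))) fun s => φ (fun i => s (.inl (.inl i))) o)
      (flipIf (.inr (.inl (.inl o))) fun s => φ (fun i => s (.inl (.inl i))) o))
    (x : Ic → Bool) (ρ : State Empty) : (compute γ).outcome x ρ = PMF.pure (φ x) := by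
  ext y
  rw [outcome, PMF.ofFintype_apply, instrument_compute γ φ hγ, PMF.pure_apply]
  split_ifs
  · rw [ρ.trace_eq_one]; simp
  · simp

/-- Output the bits `c`. -/
noncomputable def const (c : K → Bool) : QAlg Empty Empty K Empty :=
  compute fun k => if c k then [.not (.inr (.inl (.inl k)))] else []

theorem size_const_le (c : K → Bool) : (const c).size ≤ 2 * Fintype.card K := by
  refine (size_compute_le _ fun o => ?_).trans (by simp)
  split_ifs <;> simp

theorem outcome_const (c : K → Bool) (x : Empty → Bool) (ρ : State Empty) :
    (const c).outcome x ρ = PMF.pure c := by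
  refine outcome_compute _ (fun _ => c) (fun o ρ => ?_) x ρ
  cases h : c o
  · have : flipIf (W := (Empty ⊕ Empty) ⊕ (K ⊕ Empty) ⊕ Empty) (.inr (.inl (.inl o)))
        (fun _ => false) = id := by
      ext s w
      simp [flipIf]
    rw [this]
    rfl
  · rfl

/-- Output the first bit and its products with the other bits. -/
noncomputable def mask (K : Type) [Fintype K] [DecidableEq K] :
    QAlg (Unit ⊕ K) Empty (Unit ⊕ K) Empty :=
  compute (Sum.elim
    (fun _ => [.cnot (.inl (.inl (.inl ()))) (.inr (.inl (.inl (.inl ())))) (by simp)])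
    fun k => [.toffoli (.inl (.inl (.inl ()))) (.inl (.inl (.inr k))) (.inr (.inl (.inl (.inr k))))
      (by simp) (by simp) (by simp)])

theorem size_mask_le : (mask K).size ≤ 3 + 3 * Fintype.card K := by
  refine (size_compute_le _ ?_).trans ?_
  · rintro (o | o) <;> simp
  · rw [Fintype.card_sum, Fintype.card_unit]
    omega

theorem outcome_mask (x : Unit ⊕ K → Bool) (ρ : State Empty) : (mask K).outcome x ρ =
    PMF.pure (Sum.elim (fun _ => x (.inl ())) fun k => x (.inl ()) && x (.inr k)) := by
  refine outcome_compute (Ic := Unit ⊕ K) (Oc := Unit ⊕ K) _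
    (fun x => Sum.elim (fun _ => x (.inl ())) fun k => x (.inl ()) && x (.inr k))
    (fun o ρ => ?_) x ρ
  rcases o with o | o <;> rfl

end QAlg

end CertDel

/-! ### Composition of polynomial size families. -/

namespace CertDel

open Matrix
open scoped ComplexOrder Kronecker

/-! ## Polynomial bounds -/

namespace PolyBounded

theorem mono {f g : ℕ → ℕ} (hg : PolyBounded g) (h : ∀ n, f n ≤ g n) : PolyBounded f :=
  hg.imp fun _ hp n => (h n).trans (hp n)

theorem add {f g : ℕ → ℕ} (hf : PolyBounded f) (hg : PolyBounded g) :
    PolyBounded fun n => f n + g n := by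
  obtain ⟨p, hp⟩ := hf
  obtain ⟨q, hq⟩ := hg
  exact ⟨p + q, fun n => by rw [Polynomial.eval_add]; exact add_le_add (hp n) (hq n)⟩

theorem const_mul (c : ℕ) {f : ℕ → ℕ} (hf : PolyBounded f) : PolyBounded fun n => c * f n := by
  obtain ⟨p, hp⟩ := hf
  exact ⟨Polynomial.C c * p, fun n => by
    rw [Polynomial.eval_mul, Polynomial.eval_C]; exact Nat.mul_le_mul_left c (hp n)⟩

theorem const (c : ℕ) : PolyBounded fun _ => c :=
  ⟨Polynomial.C c, fun n => by rw [Polynomial.eval_C]⟩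

end PolyBounded

/-! ## Composition of polynomial time algorithms -/

namespace QPT

variable {Ic Iq Oc Oq : ℕ → Type}
  [∀ n, Fintype (Ic n)] [∀ n, DecidableEq (Ic n)] [∀ n, Fintype (Iq n)] [∀ n, DecidableEq (Iq n)]
  [∀ n, Fintype (Oc n)] [∀ n, DecidableEq (Oc n)] [∀ n, Fintype (Oq n)] [∀ n, DecidableEq (Oq n)]
variable {Γ Q K Ic' Oc' Oq' : ℕ → Type}
  [∀ n, Fintype (Γ n)] [∀ n, DecidableEq (Γ n)] [∀ n, Fintype (Q n)] [∀ n, DecidableEq (Q n)]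
  [∀ n, Fintype (K n)] [∀ n, DecidableEq (K n)]
  [∀ n, Fintype (Ic' n)] [∀ n, DecidableEq (Ic' n)] [∀ n, Fintype (Oc' n)]
  [∀ n, DecidableEq (Oc' n)] [∀ n, Fintype (Oq' n)] [∀ n, DecidableEq (Oq' n)]

theorem poly_Ic (F : QPT Ic Iq Oc Oq) : PolyBounded fun n => Fintype.card (Ic n) :=
  F.poly.mono fun n => by rw [QAlg.size]; omega

theorem poly_Iq (F : QPT Ic Iq Oc Oq) : PolyBounded fun n => Fintype.card (Iq n) :=
  F.poly.mono fun n => by rw [QAlg.size]; omega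

theorem poly_Oc (F : QPT Ic Iq Oc Oq) : PolyBounded fun n => Fintype.card (Oc n) :=
  F.poly.mono fun n => by rw [QAlg.size]; omega

/-- Run `P` and then `G` on the quantum output of `P`. -/
noncomputable def stepQ (P : QPT Ic Iq Γ Q) (G : QPT Ic' Q Oc' Oq') (f : ∀ n, Ic' n → Γ n) :
    QPT Ic Iq (fun n => Γ n ⊕ Oc' n) Oq' where
  alg n := (P.alg n).stepQ (G.alg n) (f n)
  poly := ((P.poly.const_mul 2).add (G.poly.const_mul 2)).mono fun _ => QAlg.size_stepQ_le _ _ _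

/-- Run `P` and then the classical algorithm `G`. -/
noncomputable def stepC (P : QPT Ic Iq Γ Q) (G : QPT Ic' NoWires Oc' NoWires)
    (f : ∀ n, Ic' n → Γ n) : QPT Ic Iq (fun n => Γ n ⊕ Oc' n) Q where
  alg n := (P.alg n).stepC (G.alg n) (f n)
  poly := ((P.poly.const_mul 2).add (G.poly.const_mul 2)).mono fun _ => QAlg.size_stepC_le _ _ _

/-- Select the output of an algorithm. -/
noncomputable def finish (P : QPT Ic Iq Γ Q) (hOc : PolyBounded fun n => Fintype.card (Oc n))
    (hK : PolyBounded fun n => Fintype.card (K n)) (g : ∀ n, Oc n → Γ n) (h : ∀ n, K n → Γ n)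
    (e : ∀ n, Q n ⊕ K n ≃ Oq n) : QPT Ic Iq Oc Oq where
  alg n := (P.alg n).finishTo (g n) (h n) (e n)
  poly := ((P.poly.add (hOc.const_mul 2)).add (hK.const_mul 2)).mono fun _ =>
    QAlg.size_finishTo_le _ _ _ _

/-- Output the classical input and the bits stored in the part `K` of the quantum input. -/
noncomputable def load (hIc : PolyBounded fun n => Fintype.card (Ic n))
    (hIq : PolyBounded fun n => Fintype.card (Iq n)) (e : ∀ n, Q n ⊕ K n ≃ Iq n) :
    QPT Ic Iq (fun n => Ic n ⊕ K n) Q where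
  alg n := QAlg.load (Ic n) (e n)
  poly := ((hIc.const_mul 3).add (hIq.const_mul 4)).mono fun _ => QAlg.size_load_le _

/-- Output the classical input and the advice `st`. -/
noncomputable def advice (hIc : PolyBounded fun n => Fintype.card (Ic n))
    (hQ : PolyBounded fun n => Fintype.card (Q n)) (st : ∀ n, State (Q n)) :
    QPT Ic NoWires (fun n => Ic n ⊕ Empty) Q where
  alg n := QAlg.adviceAlg (Ic n) (st n)
  poly := ((hIc.const_mul 3).add (hQ.const_mul 4)).mono fun _ => QAlg.size_adviceAlg_le _

/-- Output the bits `c`. -/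
noncomputable def const (hK : PolyBounded fun n => Fintype.card (K n)) (c : ∀ n, K n → Bool) :
    QPT NoWires NoWires K NoWires where
  alg n := QAlg.const (c n)
  poly := (hK.const_mul 2).mono fun _ => QAlg.size_const_le _

/-- Output the first bit and its products with the other bits. -/
noncomputable def mask (hK : PolyBounded fun n => Fintype.card (K n)) :
    QPT (fun n => Unit ⊕ K n) NoWires (fun n => Unit ⊕ K n) NoWires where
  alg n := QAlg.mask (K n)
  poly := ((PolyBounded.const 3).add (hK.const_mul 3)).mono fun _ => QAlg.size_mask_le

variable (n : ℕ)

theorem run_stepQ (P : QPT Ic Iq Γ Q) (G : QPT Ic' Q Oc' Oq') (f : ∀ n, Ic' n → Γ n)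
    (x : Ic n → Bool) (ρ : State (Iq n)) (k : (Γ n ⊕ Oc' n → Bool) × State (Oq' n) → PMF Bool)
    (hk : ∀ y, LinCont fun σ => k (y, σ)) :
    ((P.stepQ G f).run n x ρ >>= k) = (P.run n x ρ >>= fun p =>
      G.run n (p.1 ∘ f n) p.2 >>= fun p' => k (Sum.elim p.1 p'.1, p'.2)) :=
  QAlg.run_stepQ _ _ _ _ _ _ hk

theorem run_stepC (P : QPT Ic Iq Γ Q) (G : QPT Ic' NoWires Oc' NoWires) (f : ∀ n, Ic' n → Γ n)
    (x : Ic n → Bool) (ρ : State (Iq n)) (k : (Γ n ⊕ Oc' n → Bool) × State (Q n) → PMF Bool)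
    (hk : ∀ y, LinCont fun σ => k (y, σ)) :
    ((P.stepC G f).run n x ρ >>= k) = (P.run n x ρ >>= fun p =>
      G.sample n (p.1 ∘ f n) >>= fun y' => k (Sum.elim p.1 y', p.2)) :=
  QAlg.run_stepC _ _ _ _ _ _ _ hk

theorem run_finish (P : QPT Ic Iq Γ Q) (hOc : PolyBounded fun n => Fintype.card (Oc n))
    (hK : PolyBounded fun n => Fintype.card (K n)) (g : ∀ n, Oc n → Γ n) (h : ∀ n, K n → Γ n)
    (e : ∀ n, Q n ⊕ K n ≃ Oq n) (x : Ic n → Bool) (ρ : State (Iq n))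
    (k : (Oc n → Bool) × State (Oq n) → PMF Bool) (hk : ∀ y, LinCont fun σ => k (y, σ)) :
    ((P.finish hOc hK g h e).run n x ρ >>= k) = (P.run n x ρ >>= fun p =>
      k (p.1 ∘ g n, (p.2.prod (State.ket (p.1 ∘ h n))).reindex (e n))) :=
  QAlg.run_finishTo _ _ _ _ _ _ _ hk

theorem run_load (hIc : PolyBounded fun n => Fintype.card (Ic n))
    (hIq : PolyBounded fun n => Fintype.card (Iq n)) (e : ∀ n, Q n ⊕ K n ≃ Iq n)
    (x : Ic n → Bool) (σ : State (Q n)) (z : K n → Bool)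
    (k : (Ic n ⊕ K n → Bool) × State (Q n) → PMF Bool) (hk : ∀ y, LinCont fun σ => k (y, σ)) :
    ((load hIc hIq e).run n x ((σ.prod (State.ket z)).reindex (e n)) >>= k) =
      k (Sum.elim x z, σ) :=
  QAlg.run_load _ _ _ _ _ hk

theorem run_advice (hIc : PolyBounded fun n => Fintype.card (Ic n))
    (hQ : PolyBounded fun n => Fintype.card (Q n)) (st : ∀ n, State (Q n))
    (x : Ic n → Bool) (z : State (NoWires n)) (k : (Ic n ⊕ Empty → Bool) × State (Q n) → PMF Bool)
    (hk : ∀ y, LinCont fun σ => k (y, σ)) :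
    ((advice hIc hQ st).run n x z >>= k) = k (Sum.elim x fun i => i.elim, st n) :=
  QAlg.run_adviceAlg _ _ _ _ hk

theorem sample_const (hK : PolyBounded fun n => Fintype.card (K n)) (c : ∀ n, K n → Bool)
    (x : NoWires n → Bool) : (const hK c).sample n x = PMF.pure (c n) :=
  QAlg.outcome_const _ _ _

theorem sample_mask (hK : PolyBounded fun n => Fintype.card (K n)) (x : Unit ⊕ K n → Bool) :
    (mask hK).sample n x =
      PMF.pure (Sum.elim (fun _ => x (.inl ())) fun k => x (.inl ()) && x (.inr k)) :=
  QAlg.outcome_mask _ _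

theorem measure_bind {β : Type} (F : QPT Ic Iq Oc NoWires) (x : Ic n → Bool) (ρ : State (Iq n))
    (k : (Oc n → Bool) → PMF β) : (F.measure n x ρ >>= k) = (F.run n x ρ >>= fun p => k p.1) :=
  QAlg.outcome_bind _ _ _ _

theorem sample_bind {β : Type} (F : QPT Ic NoWires Oc NoWires) (x : Ic n → Bool)
    (k : (Oc n → Bool) → PMF β) :
    (F.sample n x >>= k) = (F.run n x (State.ket fun _ => false) >>= fun p => k p.1) :=
  QAlg.outcome_bind _ _ _ _

end QPT

namespace LinCont

variable {W Ic Oc Oq : ℕ → Type} [∀ n, Fintype (W n)] [∀ n, DecidableEq (W n)]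
  [∀ n, Fintype (Ic n)] [∀ n, DecidableEq (Ic n)]
  [∀ n, Fintype (Oc n)] [∀ n, DecidableEq (Oc n)] [∀ n, Fintype (Oq n)] [∀ n, DecidableEq (Oq n)]
  (n : ℕ)

theorem qptRun (F : QPT Ic W Oc Oq) (x : Ic n → Bool) {f : (Oc n → Bool) × State (Oq n) → PMF Bool}
    (h : ∀ y, LinCont fun σ => f (y, σ)) : LinCont fun σ => F.run n x σ >>= f :=
  run _ _ h

theorem qptMeasure (F : QPT Ic W Oc NoWires) (x : Ic n → Bool) (f : (Oc n → Bool) → PMF Bool) :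
    LinCont fun σ => F.measure n x σ >>= f :=
  outcome _ _ _

end LinCont

end CertDel

/-! ### First hop: reduction to non-committing encryption. -/

namespace CertDel

open Matrix
open scoped ComplexOrder Kronecker

theorem LinCont.prodKet {Q K W : Type} [Fintype Q] [DecidableEq Q] [Fintype K] [DecidableEq K]
    [Fintype W] [DecidableEq W] {f : State W → PMF Bool} (h : LinCont f) (z : K → Bool)
    (e : Q ⊕ K ≃ W) : LinCont fun σ : State Q => f ((σ.prod (State.ket z)).reindex e) := by
  obtain ⟨l, hl⟩ := h
  exact ⟨l ∘ₗ State.prodKetL z e, fun σ => hl _⟩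

attribute [local irreducible] LinCont

/-! ## The games -/

theorem comp_finAppend {α β : Type} {a b : ℕ} (z : α → β) (f : Fin a → α) (g : Fin b → α) :
    z ∘ Fin.append f g = Fin.append (z ∘ f) (z ∘ g) := by
  funext i
  refine Fin.addCases (fun i => ?_) (fun i => ?_) i <;> simp

/-- The half of a pair of strings chosen by `b`. -/
def choosePart {ℓ : ℕ} (b : Bool) (ms : Fin ℓ ⊕ Fin ℓ → Bool) : BitStr ℓ :=
  fun i => if b then ms (.inr i) else ms (.inl i)

namespace OneShotSig

/-- Verification of signatures on `1` under the keys of the statement `x`. -/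
def acceptsOne (S : OneShotSig) (n : ℕ) (x : BitStr (S.stmtLen n)) (σ : BitStr (S.sigLen n)) :
    Bool :=
  S.vrfy n (fun i => x (Fin.castAdd _ i)) (fun i => x (Fin.natAdd _ i)) σ true

end OneShotSig

theorem polyBounded_of_card {f : ℕ → ℕ} (h : PolyBounded fun n => Fintype.card (Fin (f n))) :
    PolyBounded f := by
  simpa using h

theorem polyBounded_card_fin {f : ℕ → ℕ} (h : PolyBounded f) :
    PolyBounded fun n => Fintype.card (Fin (f n)) := by
  simpa using h

theorem polyBounded_card_unit : PolyBounded fun _ => Fintype.card Unit :=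
  .const _

theorem polyBounded_card_empty : PolyBounded fun _ => Fintype.card Empty :=
  .const _

theorem pmf_pure_bind {α β : Type} (a : α) (f : α → PMF β) : (PMF.pure a >>= f) = f a :=
  PMF.pure_bind a f

namespace PVSecurity

variable (oss : OneShotSig) (we : WitnessEnc oss.stmtLen oss.sigLen) (nce : NCE we.ctLen)
variable {r₁ r₂ r₃ : ℕ → ℕ}
  (Ach : QPT (fun n => Fin (nce.pkLen n)) NoWires (fun n => Fin (we.msgLen n) ⊕ Fin (we.msgLen n))
    (fun n => Fin (r₁ n)))
  (Are : QPT (fun n => Fin (oss.crsLen n)) (fun n => Fin (r₁ n)) (fun n => Fin (oss.pkLen n))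
    (fun n => Fin (r₂ n)))
  (Ade : QPT (fun n => Fin (nce.ctLen n) ⊕ Fin (oss.stmtLen n)) (fun n => Fin (r₂ n))
    (fun n => Fin (oss.sigLen n)) (fun n => Fin (r₃ n)))
  (Agu : QPT (fun n => Unit ⊕ Fin (nce.skLen n)) (fun n => Fin (r₃ n)) (fun _ => Unit) NoWires)
  (n : ℕ)

/-- The stages of the experiment after the ciphertext has been sent. -/
noncomputable def deletionStage (sk : BitStr (nce.skLen n)) (c : BitStr (nce.ctLen n))
    (x : BitStr (oss.stmtLen n)) (st : State (Fin (r₂ n))) : PMF Bool :=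
  Ade.run n (Sum.elim c x) st >>= fun d =>
    Agu.measure n (encodeOption (if oss.acceptsOne n x d.1 then some sk else none)) d.2 >>= fun y =>
      pure (y ())

/-- The stages of the experiment in which the ciphertext of the witness encryption scheme is
produced, followed by `k`. -/
noncomputable def encryptionStage (m : BitStr (we.msgLen n)) (st : State (Fin (r₁ n)))
    (k : BitStr (oss.stmtLen n) → BitStr (we.ctLen n) → State (Fin (r₂ n)) → PMF Bool) : PMF Bool :=
  oss.setup n >>= fun crs => Are.run n crs st >>= fun q =>
    we.enc n (Fin.append crs q.1) m >>= fun w => k (Fin.append crs q.1) w q.2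

/-- The certified deletion experiment of the construction. -/
noncomputable def realGame (b : Bool) : PMF Bool :=
  nce.keyGen n >>= fun key => Ach.prepare n key.1 >>= fun p =>
    encryptionStage oss we Are n (choosePart b p.1) p.2 fun x w st =>
      nce.enc n key.1 w >>= fun c => deletionStage oss we nce Ade Agu n key.2.1 c x st

/-- The experiment with a fake ciphertext and a revealed secret key. -/
noncomputable def fakeGame (b : Bool) : PMF Bool :=
  nce.keyGen n >>= fun key => Ach.prepare n key.1 >>= fun p =>
    encryptionStage oss we Are n (choosePart b p.1) p.2 fun x w st =>
      nce.fake n key.1 key.2.1 key.2.2 >>= fun c =>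
        nce.reveal n key.1 key.2.1 key.2.2 c w >>= fun sk =>
          deletionStage oss we nce Ade Agu n sk c x st

/-- The first stage of the adversary against the non-committing encryption scheme. -/
noncomputable def rncChoose (b : Bool) :
    QPT (fun n => Fin (nce.pkLen n)) NoWires (fun n => Fin (we.ctLen n))
      (fun n => Fin (r₂ n + oss.stmtLen n)) :=
  QPT.finish (K := fun n => Fin (oss.stmtLen n))
    -- Classical outputs accumulate as `((messages ⊕ crs) ⊕ oss.pk) ⊕ we.ct`; the index maps pick
    -- the input of each stage from these wires.
    (((Ach.stepC oss.setupAlg fun _ i => i.elim).stepQ Are fun _ => Sum.inr).stepC we.encAlg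
      fun _ => Sum.elim (Fin.append (fun i => .inl (.inr i)) .inr) fun i =>
        .inl (.inl (if b then .inr i else .inl i)))
    we.encAlg.poly_Oc
    (polyBounded_card_fin ((polyBounded_of_card oss.setupAlg.poly_Oc).add
      (polyBounded_of_card Are.poly_Oc)))
    -- The only memory between the stages is a quantum register, so the statement, needed later as
    -- verification key, is stored there as a basis state.
    (fun _ => Sum.inr) (fun _ i => .inl (Fin.append (fun i => .inl (.inr i)) .inr i)) fun _ => finSumFinEquiv

theorem rncChoose_run (b : Bool) (pk : BitStr (nce.pkLen n))
    (k : BitStr (we.ctLen n) × State (Fin (r₂ n + oss.stmtLen n)) → PMF Bool)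
    (hk : ∀ y, LinCont fun σ => k (y, σ)) :
    ((rncChoose oss we nce Ach Are b).prepare n pk >>= k) =
      (Ach.prepare n pk >>= fun p => encryptionStage oss we Are n (choosePart b p.1) p.2
        fun x w st => k (w, (st.prod (State.ket x)).reindex finSumFinEquiv)) := by
  change ((rncChoose oss we nce Ach Are b).run n pk (State.ket fun _ => false) >>= k) = _
  have h1 := fun (y : BitStr (we.ctLen n)) (z : BitStr (oss.stmtLen n)) =>
    (hk y).prodKet z (finSumFinEquiv (m := r₂ n))
  rw [rncChoose, QPT.run_finish _ _ _ _ _ _ _ _ _ _ hk, QPT.run_stepC, QPT.run_stepQ, QPT.run_stepC]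
  · refine bind_congr fun p => ?_
    have e0 : (p.1 ∘ fun i : Empty => i.elim) = fun i : Empty => i.elim := funext fun i => i.elim
    refine Eq.trans (congrArg (fun z => oss.setupAlg.sample n z >>= _) e0) ?_
    refine bind_congr fun crs => bind_congr fun q => ?_
    have e1 : (Sum.elim (Sum.elim p.1 crs) q.1 ∘ Sum.elim (Fin.append (fun i => .inl (.inr i)) .inr) fun i =>
        .inl (.inl (if b then .inr i else .inl i))) =
        Sum.elim (Fin.append crs q.1) (choosePart b p.1) := by
      funext i
      rcases i with i | i
      · exact congrFun (comp_finAppend (Sum.elim (Sum.elim p.1 crs) q.1) _ _) i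
      · cases b <;> rfl
    refine Eq.trans (congrArg (fun z => we.encAlg.sample n z >>= _) e1) ?_
    refine bind_congr fun w => ?_
    exact congrArg (fun z => k (w, (q.2.prod (State.ket z)).reindex finSumFinEquiv))
      (comp_finAppend (Sum.elim (Sum.elim p.1 crs) q.1) _ _)
  -- The remaining goals say that the continuations met on the way are linear in the state; they are
  -- built from runs, classical samples and `k` itself.
  all_goals
    intro y
    repeat' first
      | dsimp only
      | exact h1 _ _
      | refine LinCont.bind _ fun _ => ?_
      | refine LinCont.qptRun n Are _ fun _ => ?_

/-- The second stage of the adversary against the non-committing encryption scheme. -/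
noncomputable def rncGuess :
    QPT (fun n => Fin (nce.ctLen n) ⊕ Fin (nce.skLen n)) (fun n => Fin (r₂ n + oss.stmtLen n))
      (fun _ => Unit) NoWires :=
  QPT.finish (K := NoWires)
    ((((((QPT.load (Ic := fun n => Fin (nce.ctLen n) ⊕ Fin (nce.skLen n))
        (Q := fun n => Fin (r₂ n)) (K := fun n => Fin (oss.stmtLen n))
        ((Ade.poly_Ic.add Agu.poly_Ic).mono fun n => by
          simp only [Fintype.card_sum, Fintype.card_fin]; omega)
        (polyBounded_card_fin ((polyBounded_of_card Ade.poly_Iq).add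
          (Ade.poly_Ic.mono fun n => by simp only [Fintype.card_sum, Fintype.card_fin]; omega)))
        fun _ => finSumFinEquiv).stepQ Ade
      fun _ => Sum.elim (fun i => Sum.inl (Sum.inl i)) Sum.inr).stepC
      -- The constant bit is the message `1` for which the certificate is verified.
      (QPT.const polyBounded_card_unit fun _ _ => true) fun _ i => i.elim).stepC oss.vrfyAlg
      fun _ => Sum.elim (fun i => Sum.inl (Sum.inl (Sum.inr (Fin.castAdd _ i)))) <|
          Sum.elim (fun i => Sum.inl (Sum.inl (Sum.inr (Fin.natAdd _ i)))) <|
          Sum.elim (fun i => Sum.inl (Sum.inr i)) Sum.inr).stepC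
      -- Multiplying the key by the verdict gives exactly `encodeOption`: flag and key on
      -- acceptance, all zeros on rejection.
      (QPT.mask (K := fun n => Fin (nce.skLen n)) (Agu.poly_Ic.mono fun n => by
          simp only [Fintype.card_sum, Fintype.card_fin]; omega))
      fun _ => Sum.elim Sum.inr fun i =>
        Sum.inl (Sum.inl (Sum.inl (Sum.inl (Sum.inr i))))).stepQ Agu fun _ => Sum.inr)
    polyBounded_card_unit polyBounded_card_empty (fun _ => Sum.inr) (fun _ i => i.elim)
    fun _ => Equiv.sumEmpty _ _

theorem rncGuess_measure (c : BitStr (nce.ctLen n)) (sk : BitStr (nce.skLen n))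
    (x : BitStr (oss.stmtLen n)) (st : State (Fin (r₂ n))) :
    ((rncGuess oss we nce Ade Agu).measure n (Sum.elim c sk)
        ((st.prod (State.ket x)).reindex finSumFinEquiv) >>= fun y => pure (y ())) =
      deletionStage oss we nce Ade Agu n sk c x st := by
  rw [QPT.measure_bind, rncGuess, QPT.run_finish, QPT.run_stepQ, QPT.run_stepC, QPT.run_stepC,
    QPT.run_stepC, QPT.run_stepQ, QPT.run_load]
  · simp only [QPT.sample_const, pmf_pure_bind]
    rw [deletionStage]
    have e1 : Sum.elim (Sum.elim c sk) x ∘ Sum.elim (fun i => Sum.inl (Sum.inl i)) Sum.inr =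
        Sum.elim c x := by
      funext i
      cases i <;> rfl
    refine Eq.trans (congrArg (fun z => Ade.run n z st >>= _) e1) (bind_congr fun d => ?_)
    have e2 : Sum.elim (Sum.elim (Sum.elim (Sum.elim c sk) x) d.1) (fun _ => true) ∘
        (Sum.elim (fun i => Sum.inl (Sum.inl (Sum.inr (Fin.castAdd (oss.pkLen n) i)))) <|
          Sum.elim (fun i => Sum.inl (Sum.inl (Sum.inr (Fin.natAdd (oss.crsLen n) i)))) <|
          Sum.elim (fun i => Sum.inl (Sum.inr i)) Sum.inr) =
        Sum.elim (fun i => x (Fin.castAdd _ i)) (Sum.elim (fun i => x (Fin.natAdd _ i))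
          (Sum.elim d.1 fun _ : Unit => true)) := by
      funext i
      rcases i with i | i | i | i <;> rfl
    refine Eq.trans (congrArg (fun z => oss.vrfyAlg.sample n z >>= _) e2) ?_
    rw [oss.vrfyAlg_eq, pmf_pure_bind, QPT.sample_mask, pmf_pure_bind]
    rw [QPT.measure_bind]
    refine congrArg (fun z => Agu.run n z d.2 >>= _) ?_
    funext i
    change _ = encodeOption (if oss.vrfy n _ _ d.1 true then some sk else none) i
    cases h : oss.vrfy n (fun i => x (Fin.castAdd _ i)) (fun i => x (Fin.natAdd _ i)) d.1 true <;>
      rcases i with i | i <;> simp [encodeOption]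
  all_goals
    intro y
    repeat' first
      | dsimp only
      | exact LinCont.const _
      | refine LinCont.bind _ fun _ => ?_
      | refine LinCont.qptRun n Agu _ fun _ => ?_
      | refine LinCont.qptRun n Ade _ fun _ => ?_

/-- The adversary against the non-committing encryption scheme. -/
noncomputable def rncAdversary (b : Bool) : nce.Adversary where
  reg n := r₂ n + oss.stmtLen n
  choose := rncChoose oss we nce Ach Are b
  guess := rncGuess oss we nce Ade Agu

/-- The bit `b` of the deletion game is built into the adversary; only the RNC challenge bit decides
between the real and the fake game. -/
theorem rncExp_false (b : Bool) :
    nce.rncExp n (rncAdversary oss we nce Ach Are Ade Agu b) false =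
      realGame oss we nce Ach Are Ade Agu n b := by
  rw [NCE.rncExp, realGame]
  refine bind_congr fun key => ?_
  refine (rncChoose_run oss we nce Ach Are n b key.1 _ fun y => ?_).trans ?_
  · simp only [Bool.false_eq_true, if_false, bind_assoc, pure_bind]
    exact .bind _ fun c => .qptMeasure n (rncGuess oss we nce Ade Agu) _ _
  · simp only [Bool.false_eq_true, if_false, bind_assoc, pure_bind]
    refine bind_congr fun p => congrArg (encryptionStage oss we Are n _ _) ?_
    funext x w st
    exact bind_congr fun c => rncGuess_measure oss we nce Ade Agu n c key.2.1 x st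

theorem rncExp_true (b : Bool) :
    nce.rncExp n (rncAdversary oss we nce Ach Are Ade Agu b) true =
      fakeGame oss we nce Ach Are Ade Agu n b := by
  rw [NCE.rncExp, fakeGame]
  refine bind_congr fun key => ?_
  refine (rncChoose_run oss we nce Ach Are n b key.1 _ fun y => ?_).trans ?_
  · simp only [if_true, bind_assoc, pure_bind]
    exact .bind _ fun c => .bind _ fun sk => .qptMeasure n (rncGuess oss we nce Ade Agu) _ _
  · simp only [if_true, bind_assoc, pure_bind]
    refine bind_congr fun p => congrArg (encryptionStage oss we Are n _ _) ?_
    funext x w st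
    exact bind_congr fun c => bind_congr fun sk => rncGuess_measure oss we nce Ade Agu n c sk x st

theorem certDelExp_eq_realGame (b : Bool) :
    (pvScheme oss we nce).certDelExp n ⟨r₁, r₂, r₃, Ach, Are, Ade, Agu⟩ b =
      realGame oss we nce Ach Are Ade Agu n b := by
  rw [PKECD.certDelExp, realGame]
  simp only [pvScheme, bind_assoc, pure_bind, pmf_pure_bind, encryptionStage, deletionStage]
  rfl

end PVSecurity

end CertDel

/-! ### Averaging arguments and closure of negligible functions. -/

namespace CertDel

open Matrix
open scoped ComplexOrder Kronecker

/-! ## Averaging -/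

theorem prob_nonneg (p : PMF Bool) : 0 ≤ prob p := ENNReal.toReal_nonneg

theorem prob_le_one (p : PMF Bool) : prob p ≤ 1 :=
  ENNReal.toReal_mono ENNReal.one_ne_top (p.coe_le_one true)

theorem abs_prob_sub_le_one (p q : PMF Bool) : |prob p - prob q| ≤ 1 := by
  have := prob_nonneg p
  have := prob_nonneg q
  have := prob_le_one p
  have := prob_le_one q
  rw [abs_le]
  constructor <;> linarith

theorem sum_toReal {α : Type} [Fintype α] (p : PMF α) : ∑ a, (p a).toReal = 1 := by
  rw [← ENNReal.toReal_sum fun a _ => p.apply_ne_top a, ← tsum_fintype (L := .unconditional _),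
    p.tsum_coe, ENNReal.toReal_one]

/-- A bound affine in the success probability of `h` is stable under mixing. This lets the
comparison of advantage and forging probability be made for each transcript separately. -/
theorem abs_prob_bind_sub_le {α : Type} [Fintype α] (p : PMF α) {f g h : α → PMF Bool} {ε K : ℝ}
    (H : ∀ a, |prob (f a) - prob (g a)| ≤ ε + K * prob (h a)) :
    |prob (p >>= f) - prob (p >>= g)| ≤ ε + K * prob (p >>= h) := by
  rw [prob_bind, prob_bind, prob_bind, ← Finset.sum_sub_distrib]
  calc |∑ a, ((p a).toReal * prob (f a) - (p a).toReal * prob (g a))|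
      ≤ ∑ a, |(p a).toReal * prob (f a) - (p a).toReal * prob (g a)| :=
        Finset.abs_sum_le_sum_abs _ _
    _ ≤ ∑ a, (p a).toReal * (ε + K * prob (h a)) := by
        refine Finset.sum_le_sum fun a _ => ?_
        rw [← mul_sub, abs_mul, abs_of_nonneg ENNReal.toReal_nonneg]
        exact mul_le_mul_of_nonneg_left (H a) ENNReal.toReal_nonneg
    _ = ε + K * ∑ a, (p a).toReal * prob (h a) := by
        simp only [mul_add, Finset.sum_add_distrib, ← Finset.sum_mul, sum_toReal, one_mul,
          Finset.mul_sum]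
        congr 1
        exact Finset.sum_congr rfl fun a _ => by ring

/-- A maximising `a` works, since an average does not exceed the maximum. This is how randomness is
fixed non-uniformly. -/
theorem exists_abs_prob_bind_sub_le {α : Type} [Fintype α] (p : PMF α) (f g : α → PMF Bool) :
    ∃ a, |prob (p >>= f) - prob (p >>= g)| ≤ |prob (f a) - prob (g a)| := by
  have : Nonempty α := p.support_nonempty.to_type
  obtain ⟨a, ha⟩ := Finite.exists_max fun a => |prob (f a) - prob (g a)|
  refine ⟨a, ?_⟩
  have := abs_prob_bind_sub_le p (h := f) (K := 0) fun b => by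
    simpa using ha b
  simpa using this

namespace QPT

variable {Ic Iq Oc Oq : ℕ → Type}
  [∀ n, Fintype (Ic n)] [∀ n, DecidableEq (Ic n)] [∀ n, Fintype (Iq n)] [∀ n, DecidableEq (Iq n)]
  [∀ n, Fintype (Oc n)] [∀ n, DecidableEq (Oc n)] [∀ n, Fintype (Oq n)] [∀ n, DecidableEq (Oq n)]

/-- The type of states is infinite, but the output state is a function of the classical outcome, so
the average is over finitely many outcomes. -/
theorem abs_prob_run_bind_sub_le (F : QPT Ic Iq Oc Oq) (n : ℕ) (x : Ic n → Bool)
    (ρ : State (Iq n)) {f g h : (Oc n → Bool) × State (Oq n) → PMF Bool} {ε K : ℝ}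
    (H : ∀ a, |prob (f a) - prob (g a)| ≤ ε + K * prob (h a)) :
    |prob (F.run n x ρ >>= f) - prob (F.run n x ρ >>= g)| ≤ ε + K * prob (F.run n x ρ >>= h) := by
  simp only [run, QAlg.run_bind]
  exact abs_prob_bind_sub_le _ fun a => H _

theorem exists_abs_prob_run_bind_sub_le (F : QPT Ic Iq Oc Oq) (n : ℕ) (x : Ic n → Bool)
    (ρ : State (Iq n)) (f g : (Oc n → Bool) × State (Oq n) → PMF Bool) :
    ∃ a, |prob (F.run n x ρ >>= f) - prob (F.run n x ρ >>= g)| ≤ |prob (f a) - prob (g a)| := by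
  simp only [run, QAlg.run_bind]
  obtain ⟨a, ha⟩ := exists_abs_prob_bind_sub_le ((F.alg n).outcome x ρ)
    (fun y => f (y, State.normalize ((F.alg n).instrument x ρ.op y)))
    (fun y => g (y, State.normalize ((F.alg n).instrument x ρ.op y)))
  exact ⟨_, ha⟩

end QPT

/-! ## Negligible functions -/

namespace Negligible

theorem mono {f g : ℕ → ℝ} (hg : Negligible g) (h : ∀ n, f n ≤ g n) : Negligible f := fun c =>
  (hg c).imp fun _ hn n hlt => (h n).trans_lt (hn n hlt)

theorem inv_pow_succ_add {n : ℕ} (hn : 2 ≤ n) (c : ℕ) :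
    1 / (n : ℝ) ^ (c + 1) + 1 / (n : ℝ) ^ (c + 1) ≤ 1 / (n : ℝ) ^ c := by
  have h2 : (2 : ℝ) ≤ n := by exact_mod_cast hn
  have h0 : (0 : ℝ) < n := by linarith
  rw [← add_div, pow_succ, div_le_div_iff₀ (by positivity) (by positivity)]
  nlinarith [pow_pos h0 c]

theorem add {f g : ℕ → ℝ} (hf : Negligible f) (hg : Negligible g) :
    Negligible fun n => f n + g n := fun c => by
  obtain ⟨a, ha⟩ := hf (c + 1)
  obtain ⟨b, hb⟩ := hg (c + 1)
  refine ⟨max 2 (max a b), fun n hn => ?_⟩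
  have := ha n (by omega)
  have := hb n (by omega)
  have := inv_pow_succ_add (n := n) (by omega) c
  linarith

theorem const_mul {f : ℕ → ℝ} (hf : Negligible f) (a : ℕ) :
    Negligible fun n => (a : ℝ) * f n := fun c => by
  obtain ⟨b, hb⟩ := hf (c + 1)
  refine ⟨max a b, fun n hn => ?_⟩
  have hna : (a : ℝ) < n := by exact_mod_cast (show a < n by omega)
  have h0 : (0 : ℝ) < n := lt_of_le_of_lt a.cast_nonneg hna
  calc (a : ℝ) * f n ≤ a * (1 / (n : ℝ) ^ (c + 1)) :=
        mul_le_mul_of_nonneg_left (hb n (by omega)).le a.cast_nonneg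
    _ < n * (1 / (n : ℝ) ^ (c + 1)) := mul_lt_mul_of_pos_right hna (by positivity)
    _ = 1 / (n : ℝ) ^ c := by field_simp; ring

theorem pow_mul {f : ℕ → ℝ} (hf : Negligible f) (k : ℕ) :
    Negligible fun n => (n : ℝ) ^ k * f n := fun c => by
  obtain ⟨b, hb⟩ := hf (c + k)
  refine ⟨b, fun n hn => ?_⟩
  have h0 : (0 : ℝ) < n := by exact_mod_cast (show 0 < n by omega)
  calc (n : ℝ) ^ k * f n < (n : ℝ) ^ k * (1 / (n : ℝ) ^ (c + k)) :=
        mul_lt_mul_of_pos_left (hb n hn) (by positivity)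
    _ = 1 / (n : ℝ) ^ c := by rw [pow_add]; field_simp

/-- This absorbs the loss `q` of the extractor. -/
theorem polynomial_mul {f : ℕ → ℝ} (hf : Negligible f) (q : Polynomial ℕ) :
    Negligible fun n => ((q.eval n : ℕ) : ℝ) * f n := by
  induction q using Polynomial.induction_on' with
  | add p q hp hq => 
    refine (hp.add hq).mono fun n => le_of_eq ?_
    rw [Polynomial.eval_add, Nat.cast_add, add_mul]
  | monomial k a =>
    refine ((hf.pow_mul k).const_mul a).mono fun n => le_of_eq ?_
    rw [Polynomial.eval_monomial, Nat.cast_mul, Nat.cast_pow, mul_assoc]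

end Negligible

end CertDel

/-! ### Second hop: extraction of a forgery from the fake game. -/

namespace CertDel

open Matrix
open scoped ComplexOrder Kronecker

attribute [local irreducible] LinCont

theorem pmf_bind_comm {α β γ : Type} (p : PMF α) (q : PMF β) (f : α → β → PMF γ) :
    (p >>= fun a => q >>= f a) = (q >>= fun b => p >>= fun a => f a b) :=
  PMF.bind_comm p q f

theorem pmf_bind_const {α β : Type} (p : PMF α) (q : PMF β) : (p >>= fun _ => q) = q :=
  PMF.bind_const p q

theorem prob_bind_pure_true_and {α : Type} (p : PMF α) (f : α → Bool) :
    prob (p >>= fun a => pure (true && f a)) = (p.toOuterMeasure {a | f a = true}).toReal := by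
  have : (p >>= fun a => pure (true && f a)) = p.map f := by
    simp only [Bool.true_and]
    rfl
  rw [this, prob, ← PMF.toOuterMeasure_apply_singleton, PMF.toOuterMeasure_map_apply]
  rfl

namespace PVSecurity

variable (oss : OneShotSig) (we : WitnessEnc oss.stmtLen oss.sigLen) (nce : NCE we.ctLen)
variable {r₁ r₂ r₃ : ℕ → ℕ}
  (Ach : QPT (fun n => Fin (nce.pkLen n)) NoWires (fun n => Fin (we.msgLen n) ⊕ Fin (we.msgLen n))
    (fun n => Fin (r₁ n)))
  (Are : QPT (fun n => Fin (oss.crsLen n)) (fun n => Fin (r₁ n)) (fun n => Fin (oss.pkLen n))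
    (fun n => Fin (r₂ n)))
  (Ade : QPT (fun n => Fin (nce.ctLen n) ⊕ Fin (oss.stmtLen n)) (fun n => Fin (r₂ n))
    (fun n => Fin (oss.sigLen n)) (fun n => Fin (r₃ n)))
  (Agu : QPT (fun n => Unit ⊕ Fin (nce.skLen n)) (fun n => Fin (r₃ n)) (fun _ => Unit) NoWires)

/-! ## The experiment for a fixed fake ciphertext -/

/-- The keys of the non-committing encryption scheme and a fake ciphertext. -/
abbrev Setting (n : ℕ) : Type :=
  (BitStr (nce.pkLen n) × BitStr (nce.skLen n) × BitStr (nce.auxLen n)) × BitStr (nce.ctLen n)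

/-- The last stages of the experiment with a fake ciphertext, in which the message is encrypted only
after the deletion. -/
noncomputable def finalStage (n : ℕ) (τ : Setting oss we nce n) (x : BitStr (oss.stmtLen n))
    (ok : Bool) (m : BitStr (we.msgLen n)) (st : State (Fin (r₃ n))) : PMF Bool :=
  we.enc n x m >>= fun w => nce.reveal n τ.1.1 τ.1.2.1 τ.1.2.2 τ.2 w >>= fun sk =>
    Agu.measure n (encodeOption (if ok then some sk else none)) st >>= fun y => pure (y ())

/-- The stages of the experiment between the choice of the messages and `k`. -/
noncomputable def middleStages (n : ℕ) (c : BitStr (nce.ctLen n)) (st : State (Fin (r₁ n)))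
    (k : BitStr (oss.stmtLen n) → BitStr (oss.sigLen n) × State (Fin (r₃ n)) → PMF Bool) :
    PMF Bool :=
  oss.setup n >>= fun crs => Are.run n crs st >>= fun q =>
    Ade.run n (Sum.elim c (Fin.append crs q.1)) q.2 >>= k (Fin.append crs q.1)

/-- `nce.fake` reads only the keys, and the witness encryption ciphertext is used only by
`nce.reveal`. Independent samplings commute, so the fake ciphertext can be drawn before the protocol
and the encryption moved behind the deletion. -/
theorem fakeGame_eq (n : ℕ) (b : Bool) :
    fakeGame oss we nce Ach Are Ade Agu n b =
      (nce.keyGen n >>= fun key => Ach.prepare n key.1 >>= fun p =>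
        nce.fake n key.1 key.2.1 key.2.2 >>= fun c =>
          middleStages oss we nce Are Ade n c p.2 fun x d =>
            finalStage oss we nce Agu n (key, c) x (oss.acceptsOne n x d.1) (choosePart b p.1) d.2) := by
  rw [fakeGame]
  refine bind_congr fun key => bind_congr fun p => ?_
  simp only [encryptionStage, middleStages, deletionStage, finalStage]
  rw [pmf_bind_comm (nce.fake n _ _ _)]
  refine bind_congr fun crs => ?_
  rw [pmf_bind_comm (nce.fake n _ _ _)]
  refine bind_congr fun q => ?_
  rw [pmf_bind_comm]
  refine bind_congr fun c => ?_
  rw [pmf_bind_comm (Ade.run n _ _)]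
  refine bind_congr fun w => ?_
  rw [pmf_bind_comm (Ade.run n _ _)]

/-- The circuits of the distinguisher against the witness encryption scheme. -/
noncomputable def distinguisherGuess (τ : ∀ n, Setting oss we nce n) :
    QPT (fun n => Fin (we.ctLen n)) (fun n => Fin (r₃ n)) (fun _ => Unit) NoWires :=
  QPT.finish (K := NoWires)
    ((((QPT.load (Ic := fun n => Fin (we.ctLen n)) (Q := fun n => Fin (r₃ n)) (K := NoWires)
        we.encAlg.poly_Oc Agu.poly_Iq fun _ => Equiv.sumEmpty _ _).stepC
      -- The setting `τ` is hardwired as constants. The extra bit `true` is the flag of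
      -- `encodeOption (some sk)`, as the distinguisher simulates only the accepting branch.
      (QPT.const (K := fun n => Fin (nce.pkLen n) ⊕ Fin (nce.skLen n) ⊕ Fin (nce.auxLen n) ⊕
          Fin (nce.ctLen n) ⊕ Unit)
        (((nce.revealAlg.poly_Ic).add polyBounded_card_unit).mono fun n => by
          simp only [Fintype.card_sum, Fintype.card_fin, Fintype.card_unit]; omega)
        fun n => Sum.elim (τ n).1.1 <| Sum.elim (τ n).1.2.1 <| Sum.elim (τ n).1.2.2 <|
          Sum.elim (τ n).2 fun _ => true) fun _ i => i.elim).stepC nce.revealAlg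
      fun _ => Sum.elim (fun i => Sum.inr (Sum.inl i)) <|
        Sum.elim (fun i => Sum.inr (Sum.inr (Sum.inl i))) <|
        Sum.elim (fun i => Sum.inr (Sum.inr (Sum.inr (Sum.inl i)))) <|
        Sum.elim (fun i => Sum.inr (Sum.inr (Sum.inr (Sum.inr (Sum.inl i))))) fun i =>
          Sum.inl (Sum.inl i)).stepQ Agu
      fun _ => Sum.elim (fun i => Sum.inl (Sum.inr (Sum.inr (Sum.inr (Sum.inr (Sum.inr i)))))) Sum.inr)
    polyBounded_card_unit polyBounded_card_empty (fun _ => Sum.inr) (fun _ i => i.elim)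
    fun _ => Equiv.sumEmpty _ _

theorem distinguisherGuess_measure (τ : ∀ n, Setting oss we nce n) (n : ℕ)
    (w : BitStr (we.ctLen n)) (st : State (Fin (r₃ n))) :
    ((distinguisherGuess oss we nce Agu τ).measure n w st >>= fun y => pure (y ())) =
      (nce.reveal n (τ n).1.1 (τ n).1.2.1 (τ n).1.2.2 (τ n).2 w >>= fun sk =>
        Agu.measure n (encodeOption (some sk)) st >>= fun y => pure (y ())) := by
  have hst : ((st.prod (State.ket fun i : Empty => i.elim)).reindex (Equiv.sumEmpty _ _)) = st :=
    State.prod_ket_reindex_sumEmpty st _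
  conv_lhs => rw [← hst]
  rw [QPT.measure_bind, distinguisherGuess, QPT.run_finish, QPT.run_stepQ, QPT.run_stepC, QPT.run_stepC,
    QPT.run_load (K := NoWires)]
  · simp only [QPT.sample_const, pmf_pure_bind]
    have e1 : Sum.elim (Sum.elim w fun i : Empty => i.elim) (Sum.elim (τ n).1.1 <|
        Sum.elim (τ n).1.2.1 <| Sum.elim (τ n).1.2.2 <| Sum.elim (τ n).2 fun _ : Unit => true) ∘
        (Sum.elim (fun i => Sum.inr (Sum.inl i)) <|
          Sum.elim (fun i => Sum.inr (Sum.inr (Sum.inl i))) <|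
          Sum.elim (fun i => Sum.inr (Sum.inr (Sum.inr (Sum.inl i)))) <|
          Sum.elim (fun i => Sum.inr (Sum.inr (Sum.inr (Sum.inr (Sum.inl i))))) fun i =>
            Sum.inl (Sum.inl i)) =
        Sum.elim (τ n).1.1 (Sum.elim (τ n).1.2.1 (Sum.elim (τ n).1.2.2 (Sum.elim (τ n).2 w))) := by
      funext i
      rcases i with i | i | i | i | i <;> rfl
    refine Eq.trans (congrArg (fun z => nce.revealAlg.sample n z >>= _) e1)
      (bind_congr fun sk => ?_)
    rw [QPT.measure_bind]
    refine congrArg (fun z => Agu.run n z st >>= _) ?_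
    funext i
    rcases i with i | i <;> rfl
  all_goals
    intro y
    repeat' first
      | dsimp only
      | exact LinCont.const _
      | refine LinCont.bind _ fun _ => ?_
      | refine LinCont.qptRun n Agu _ fun _ => ?_

/-- The distinguisher against the witness encryption scheme. -/
noncomputable def distinguisher (τ : ∀ n, Setting oss we nce n) : we.Distinguisher where
  reg := r₃
  guess := distinguisherGuess oss we nce Agu τ

theorem distExp_distinguisher (τ : ∀ n, Setting oss we nce n) (n : ℕ) (x : BitStr (oss.stmtLen n))
    (m : BitStr (we.msgLen n)) (st : State (Fin (r₃ n))) :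
    we.distExp n (distinguisher oss we nce Agu τ) x m st =
      finalStage oss we nce Agu n (τ n) x true m st :=
  bind_congr fun w => distinguisherGuess_measure oss we nce Agu τ n w st

/-- The adversary against the one-shot signature scheme that runs the extractor `E`. -/
noncomputable def forger (τ : ∀ n, Setting oss we nce n) (st : ∀ n, State (Fin (r₁ n)))
    (E : QPT (fun n => Fin (oss.stmtLen n)) (fun n => Fin (r₃ n)) (fun n => Fin (oss.sigLen n))
      NoWires) : oss.Adversary :=
  QPT.finish (K := NoWires)
    -- The register left by the choice of messages is supplied as quantum advice, so the forger
    -- starts directly at the reply to `crs`.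
    (((((QPT.advice Are.poly_Ic Are.poly_Iq st).stepQ Are fun _ => Sum.inl).stepC
      (QPT.const (K := fun n => Fin (nce.ctLen n) ⊕ Unit ⊕ Unit)
        (((nce.encAlg.poly_Oc).add (PolyBounded.const 2)).mono fun n => by
          simp only [Fintype.card_sum, Fintype.card_fin, Fintype.card_unit]; omega)
        fun n => Sum.elim (τ n).2 (Sum.elim (fun _ => true) fun _ => false))
      fun _ i => i.elim).stepQ Ade
      fun _ => Sum.elim (fun i => Sum.inr (Sum.inl i))
        (Fin.append (fun i => Sum.inl (Sum.inl (Sum.inl i))) fun i => Sum.inl (Sum.inr i))).stepQ E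
      fun _ => Fin.append (fun i => Sum.inl (Sum.inl (Sum.inl (Sum.inl i)))) fun i =>
        Sum.inl (Sum.inl (Sum.inr i)))
    (((Are.poly_Oc.add (E.poly_Oc.const_mul 2)).add (PolyBounded.const 2)).mono fun n => by
      simp only [Fintype.card_sum, Fintype.card_fin, Fintype.card_unit]; omega)
    polyBounded_card_empty
    -- The output is the public key, then `1` with the certificate, then `0` with the extracted
    -- witness.
    (fun _ => Sum.elim (fun i => Sum.inl (Sum.inl (Sum.inl (Sum.inr i)))) <|
      Sum.elim (Sum.elim (fun i => Sum.inl (Sum.inl (Sum.inr (Sum.inr (Sum.inl i))))) fun i =>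
        Sum.inl (Sum.inr i)) <|
      Sum.elim (fun i => Sum.inl (Sum.inl (Sum.inr (Sum.inr (Sum.inr i))))) Sum.inr)
    (fun _ i => i.elim) fun _ => Equiv.sumEmpty _ _

theorem forgeExp_forger (τ : ∀ n, Setting oss we nce n) (st : ∀ n, State (Fin (r₁ n)))
    (E : QPT (fun n => Fin (oss.stmtLen n)) (fun n => Fin (r₃ n)) (fun n => Fin (oss.sigLen n))
      NoWires) (n : ℕ) :
    oss.forgeExp n (forger oss we nce Are Ade τ st E) =
      middleStages oss we nce Are Ade n (τ n).2 (st n) fun x d =>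
        E.measure n x d.2 >>= fun w => pure (oss.acceptsOne n x d.1 &&
          oss.vrfy n (fun i => x (Fin.castAdd _ i)) (fun i => x (Fin.natAdd _ i)) w false) := by
  rw [OneShotSig.forgeExp, middleStages]
  refine bind_congr fun crs => ?_
  refine (QPT.sample_bind n (forger oss we nce Are Ade τ st E) crs _).trans ?_
  rw [forger, QPT.run_finish, QPT.run_stepQ, QPT.run_stepQ, QPT.run_stepC, QPT.run_stepQ,
    QPT.run_advice]
  · simp only [QPT.sample_const, pmf_pure_bind, QPT.measure_bind]
    refine bind_congr fun q => ?_
    set K : Fin (nce.ctLen n) ⊕ Unit ⊕ Unit → Bool :=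
      Sum.elim (τ n).2 (Sum.elim (fun _ => true) fun _ => false) with hK
    have e1 : Sum.elim (Sum.elim (Sum.elim crs fun i : Empty => i.elim) q.1) K ∘
        Sum.elim (fun i => Sum.inr (Sum.inl i))
          (Fin.append (fun i => Sum.inl (Sum.inl (Sum.inl i))) fun i => Sum.inl (Sum.inr i)) =
        Sum.elim (τ n).2 (Fin.append crs q.1) := by
      rw [Sum.comp_elim, comp_finAppend]
      rfl
    refine Eq.trans (congrArg (fun z => Ade.run n z q.2 >>= _) e1) (bind_congr fun d => ?_)
    have e2 : Sum.elim (Sum.elim (Sum.elim (Sum.elim crs fun i : Empty => i.elim) q.1) K) d.1 ∘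
        (Fin.append (fun i => Sum.inl (Sum.inl (Sum.inl (Sum.inl i)))) fun i =>
          Sum.inl (Sum.inl (Sum.inr i))) = Fin.append crs q.1 := by
      rw [comp_finAppend]
      rfl
    refine Eq.trans (congrArg (fun z => E.run n z d.2 >>= _) e2) (bind_congr fun w => ?_)
    simp only [OneShotSig.acceptsOne, Fin.append_left, Fin.append_right]
    rfl
  all_goals
    intro y
    repeat' first
      | dsimp only
      | exact LinCont.const _
      | refine LinCont.bind _ fun _ => ?_
      | refine LinCont.qptRun n E _ fun _ => ?_
      | refine LinCont.qptRun n Ade _ fun _ => ?_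
      | refine LinCont.qptRun n Are _ fun _ => ?_

/-! ## The reduction -/

/-- After a rejection the revealed key is replaced by `⊥`, so encryption and key revelation have no
effect and the message drops out. -/
theorem finalStage_false (n : ℕ) (τ : Setting oss we nce n) (x : BitStr (oss.stmtLen n))
    (m : BitStr (we.msgLen n)) (st : State (Fin (r₃ n))) :
    finalStage oss we nce Agu n τ x false m st =
      (Agu.measure n (encodeOption none) st >>= fun y => pure (y ())) := by
  simp only [finalStage, Bool.false_eq_true, if_false, pmf_bind_const]

/-- A setting of the fake game in which the advantage is at least that of the fake game. -/
theorem exists_setting (n : ℕ) : ∃ (τ : Setting oss we nce n)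
    (ms : Fin (we.msgLen n) ⊕ Fin (we.msgLen n) → Bool) (st : State (Fin (r₁ n))),
    |prob (fakeGame oss we nce Ach Are Ade Agu n false) -
        prob (fakeGame oss we nce Ach Are Ade Agu n true)| ≤
      |prob (middleStages oss we nce Are Ade n τ.2 st fun x d =>
          finalStage oss we nce Agu n τ x (oss.acceptsOne n x d.1) (choosePart false ms) d.2) -
        prob (middleStages oss we nce Are Ade n τ.2 st fun x d =>
          finalStage oss we nce Agu n τ x (oss.acceptsOne n x d.1) (choosePart true ms) d.2)| := by
  simp only [fakeGame_eq]
  obtain ⟨key, h1⟩ := exists_abs_prob_bind_sub_le (nce.keyGen n) _ _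
  obtain ⟨p, h2⟩ := QPT.exists_abs_prob_run_bind_sub_le Ach n key.1 (State.ket fun _ => false) _ _
  obtain ⟨c, h3⟩ := exists_abs_prob_bind_sub_le (nce.fake n key.1 key.2.1 key.2.2) _ _
  exact ⟨(key, c), p.1, p.2, (h1.trans h2).trans h3⟩

/-- One pair `E`, `q` serves all statements and states, so it can be applied to whatever statement
and register each run of the protocol produces. -/
theorem exists_extractor (hwe : we.ExtractableSecure oss.SignatureOnZero)
    (τ : ∀ n, Setting oss we nce n) (p : Polynomial ℕ) (hp : ∀ n, 0 < p.eval n)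
    (m₀ m₁ : ∀ n, BitStr (we.msgLen n)) :
    ∃ (E : QPT (fun n => Fin (oss.stmtLen n)) (fun n => Fin (r₃ n)) (fun n => Fin (oss.sigLen n))
        NoWires) (q : Polynomial ℕ), (∀ n, 0 < q.eval n) ∧ ∃ n₀ : ℕ, ∀ n > n₀,
      ∀ (x : BitStr (oss.stmtLen n)) (st : State (Fin (r₃ n))),
        1 / ((p.eval n : ℕ) : ℝ) ≤ |prob (finalStage oss we nce Agu n (τ n) x true (m₀ n) st) -
            prob (finalStage oss we nce Agu n (τ n) x true (m₁ n) st)| →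
          1 / ((q.eval n : ℕ) : ℝ) ≤
            ((E.measure n x st).toOuterMeasure {w | oss.SignatureOnZero n x w}).toReal := by
  obtain ⟨E, q, hq, n₀, hE⟩ := hwe (distinguisher oss we nce Agu τ) p hp m₀ m₁
  refine ⟨E, q, hq, n₀, fun n hn x st h => hE n hn x st ?_⟩
  have e := distExp_distinguisher oss we nce Agu τ n x
  exact h.trans (le_of_eq (congrArg₂ (fun a b => |prob a - prob b|) (e _ st).symm (e _ st).symm))

theorem fakeGame_negligible (hwe : we.ExtractableSecure oss.SignatureOnZero) (hoss : oss.Secure) :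
    Negligible fun n => |prob (fakeGame oss we nce Ach Are Ade Agu n false) -
      prob (fakeGame oss we nce Ach Are Ade Agu n true)| := by
  choose τ ms st hτ using exists_setting oss we nce Ach Are Ade Agu
  intro c
  -- The summand `1` keeps the polynomial positive also at `0`. The exponent `c + 1` leaves room for
  -- adding two error terms. Extractor and forger may depend on `c`, since each exponent is treated
  -- separately.
  obtain ⟨E, q, hq, n₀, hE⟩ := exists_extractor oss we nce Agu hwe τ (Polynomial.X ^ (c + 1) + 1)
    (fun n => by simp) (fun n => choosePart false (ms n)) fun n => choosePart true (ms n)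
  have key : ∀ n > n₀, |prob (fakeGame oss we nce Ach Are Ade Agu n false) -
      prob (fakeGame oss we nce Ach Are Ade Agu n true)| ≤
        1 / (((Polynomial.X ^ (c + 1) + 1 : Polynomial ℕ).eval n : ℕ) : ℝ) +
          ((q.eval n : ℕ) : ℝ) * prob (oss.forgeExp n (forger oss we nce Are Ade τ st E)) := by
    intro n hn
    refine (hτ n).trans ?_
    rw [forgeExp_forger]
    refine abs_prob_bind_sub_le _ fun crs => ?_
    refine QPT.abs_prob_run_bind_sub_le Are n _ _ fun a => ?_
    refine QPT.abs_prob_run_bind_sub_le Ade n _ _ fun d => ?_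
    have hp0 : (0 : ℝ) ≤ 1 / (((Polynomial.X ^ (c + 1) + 1 : Polynomial ℕ).eval n : ℕ) : ℝ) := by
      positivity
    beta_reduce
    -- Rejection gives difference zero. On acceptance, either the advantage is below `1/p`, or `q`
    -- times the extraction probability is at least `1`, which bounds any advantage.
    cases hok : oss.acceptsOne n (Fin.append crs a.1) d.1
    · rw [finalStage_false, finalStage_false, sub_self, abs_zero]
      exact add_nonneg hp0 (mul_nonneg (Nat.cast_nonneg _) (prob_nonneg _))
    · have h := hE n hn (Fin.append crs a.1) d.2
      rcases le_total (1 / (((Polynomial.X ^ (c + 1) + 1 : Polynomial ℕ).eval n : ℕ) : ℝ))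
        |prob (finalStage oss we nce Agu n (τ n) (Fin.append crs a.1) true
            (choosePart false (ms n)) d.2) -
          prob (finalStage oss we nce Agu n (τ n) (Fin.append crs a.1) true
            (choosePart true (ms n)) d.2)| with hle | hle
      · have hq' : (0 : ℝ) < ((q.eval n : ℕ) : ℝ) := by exact_mod_cast hq n
        have hw := h hle
        rw [div_le_iff₀' hq'] at hw
        rw [prob_bind_pure_true_and]
        exact (abs_prob_sub_le_one _ _).trans (hw.trans (le_add_of_nonneg_left hp0))
      · exact hle.trans (le_add_of_nonneg_right (mul_nonneg (Nat.cast_nonneg _) (prob_nonneg _)))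
  obtain ⟨n₁, h₁⟩ := (hoss (forger oss we nce Are Ade τ st E)).polynomial_mul q (c + 1)
  refine ⟨max 2 (max n₀ n₁), fun n hn => ?_⟩
  have h2 := key n (by omega)
  have h3 := h₁ n (by omega)
  have h4 := Negligible.inv_pow_succ_add (n := n) (by omega) c
  have h0 : (0 : ℝ) < n := by exact_mod_cast (show 0 < n by omega)
  have h5 : 1 / (((Polynomial.X ^ (c + 1) + 1 : Polynomial ℕ).eval n : ℕ) : ℝ) ≤
      1 / (n : ℝ) ^ (c + 1) := by
    refine one_div_le_one_div_of_le (by positivity) ?_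
    simp
  linarith

/-- Triangle inequality along real and fake game for `false`, then fake and real game for `true`;
the outer differences are RNC advantages of two adversaries. -/
theorem realGame_negligible (hnce : nce.RNCSecure)
    (hwe : we.ExtractableSecure oss.SignatureOnZero) (hoss : oss.Secure) :
    Negligible fun n => |prob (realGame oss we nce Ach Are Ade Agu n false) -
      prob (realGame oss we nce Ach Are Ade Agu n true)| := by
  have h₀ := hnce (rncAdversary oss we nce Ach Are Ade Agu false)
  have h₁ := hnce (rncAdversary oss we nce Ach Are Ade Agu true)
  simp only [rncExp_false, rncExp_true] at h₀ h₁
  refine ((h₀.add (fakeGame_negligible oss we nce Ach Are Ade Agu hwe hoss)).add h₁).mono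
    fun n => ?_
  have h2 := abs_sub_le (prob (realGame oss we nce Ach Are Ade Agu n false))
    (prob (fakeGame oss we nce Ach Are Ade Agu n false))
    (prob (realGame oss we nce Ach Are Ade Agu n true))
  have h3 := abs_sub_le (prob (fakeGame oss we nce Ach Are Ade Agu n false))
    (prob (fakeGame oss we nce Ach Are Ade Agu n true))
    (prob (realGame oss we nce Ach Are Ade Agu n true))
  rw [abs_sub_comm (prob (fakeGame oss we nce Ach Are Ade Agu n true))] at h3
  linarith

end PVSecurity

end CertDel

/-- If the non-committing encryption scheme is RNC secure, the witness encryption scheme has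
extractable security for the statements "there is a one-shot signature on `0`", and the one-shot
signature scheme is secure, then the constructed public key encryption scheme with publicly
verifiable certified deletion and classical communication is IND-CPA-CD secure. -/
theorem mainTheorem4 (oss : CertDel.OneShotSig)
    (we : CertDel.WitnessEnc oss.stmtLen oss.sigLen) (nce : CertDel.NCE we.ctLen)
    (hnce : nce.RNCSecure)
    (hwe : we.ExtractableSecure oss.SignatureOnZero)
    (hoss : oss.Secure) :
    (CertDel.pvScheme oss we nce).INDCPACDSecure := by
  rintro ⟨r₁, r₂, r₃, Ach, Are, Ade, Agu⟩
  refine (CertDel.PVSecurity.realGame_negligible oss we nce Ach Are Ade Agu hnce hwe hoss).mono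
    fun n => le_of_eq ?_
  exact congrArg₂ (fun a b => |CertDel.prob a - CertDel.prob b|)
    (CertDel.PVSecurity.certDelExp_eq_realGame oss we nce Ach Are Ade Agu n false)
    (CertDel.PVSecurity.certDelExp_eq_realGame oss we nce Ach Are Ade Agu n true)
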